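/- Let $n\ge 2$, let $D\subset\mathbb R^n$ be a bounded open set with boundary of class $C^2$ and outer unit normal $\nu$, and let $f(u)=u-u^3$. **Noise.** Let $(W(t))_{t\ge 0}$ and $(\widetilde W(t))_{t\ge 0}$ be independent Brownian motions on a probability space, put $W(t)=\widetilde W(-t)$ for $t<0$, let $\rho\ge 0$ be a smooth even function supported in $[-1,1]$ with $\int\rho=1$, let $0<\gamma<\frac23$, $\rho^\varepsilon(x)=\varepsilon^{-\gamma}\rho(x/\varepsilon^\gamma)$, and $\xi^\varepsilon=\frac{d}{dt}(W*\rho^\varepsilon)$. Consider $$\partial_t u=\Delta u+\varepsilon^{-2}f(u)+\varepsilon^{-1}\xi^\varepsilon(t)\ \text{ in } D,\qquad \partial_\nu u=0\ \text{ on }\partial D. \tag{1}$$ Solutions, subsolutions and supersolutions on $[0,\tau]$ are classical: continuous on $\overline D\times[0,\tau]$, $C^2$ in $x$ and differentiable in $t$ on $D\times(0,\tau)$; for a supersolution (subsolution) the two equalities in (1) are replaced by $\ge$ ($\le$), and a solution, subsolution or supersolution satisfies its relation in $D\times(0,\tau)$ and on $\partial D\times(0,\tau)$. **Travelling wave.**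 Let $\delta_0>0$, let $m_\pm$ be continuous on $[-\delta_0,\delta_0]$ with $f(m_\pm(\delta))+\delta=0$ and $m_\pm(0)=\pm1$, and let $m(x,\delta)$, $c(\delta)$, $|\delta|\le\delta_0$, satisfy $$\partial_x^2m+c(\delta)\,\partial_xm+f(m)+\delta=0,\qquad m(\pm\infty,\delta)=m_\pm(\delta),$$ with $m$ strictly increasing in $x$ and smooth in $(x,\delta)\in\mathbb R\times[-\delta_0,\delta_0]$. **Surfaces.** Let $1<\beta<2$ and $N>0$. For $\eta>0$ and either sign let $\Sigma^{\pm}(t)=\partial U^{\pm}(t)\neq\emptyset$, $0\le t\le\tau^\pm$, be hypersurfaces whose $\eta$-neighbourhoods lie in an open set $\mathcal O^\pm\subset D$, such that the signed distance $d^\pm(x,t)$ to $\Sigma^\pm(t)$ (negative in $U^\pm(t)$) is, on $\mathcal O^\pm$, jointly continuous for $t\in[0,\tau^\pm]$, $C^2$ in $x$ for each $t\in[0,\tau^\pm]$, and differentiable in $t$ for $t\in(0,\tau^\pm)$. Suppose that the principal curvatures of $\Sigma^\pm(t)$ are bounded by $N$ for $0\le t\le\tau^\pm$, and that for $0<t<\tau^\pm$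 the velocity $V=-\partial_td^\pm$ of $\Sigma^\pm(t)$ in the direction of the exterior normal of $U^\pm(t)$ is $$V=(n-1)\kappa+\varepsilon^{-1}c(\varepsilon\xi^\varepsilon(t)\pm\varepsilon^\beta),\qquad (n-1)\kappa=-\Delta d^\pm,$$ so that the mean curvature $\kappa$ is negative for spheres bounding balls. (Thus $\tau^\pm$ is any time up to the stopping time until which such an evolution exists with principal curvatures bounded by $N$.) Let $\tilde d^\pm$ be an extension of $d^\pm$ from $\mathcal O^\pm\times[0,\tau^\pm]$ to $\overline D\times[0,\tau^\pm]$ that is continuous on $\overline D\times[0,\tau^\pm]$, and $C^2$ in $x$ and differentiable in $t$ on $D\times(0,\tau^\pm)$, with $\tilde d^\pm\le-\eta$ on $(D\cap U^\pm(t))\setminus\mathcal O^\pm$, $\tilde d^\pm\ge\eta$ on $D\setminus(U^\pm(t)\cup\mathcal O^\pm)$, $|\nabla\tilde d^\pm|\le1$ on $D\times(0,\tau^\pm)$, with $\tilde d^\pm(\cdot,t)$ constant near each point of $\partial D$, and with $|\partial_t\tilde d^\pm|,|\Delta\tilde d^\pm|\le K\varepsilon^{-p}$ on $D\times(0,\tau^\pm)$,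 where $K$ and $p$ do not depend on $\varepsilon$. For $a,c_1>0$ put $$u^{\varepsilon,\pm}(x,t)=m\Bigl(\frac{\tilde d^\pm(x,t)\pm\varepsilon^ae^{c_1t}}{\varepsilon},\ \varepsilon\xi^\varepsilon(t)\pm\varepsilon^\beta\Bigr).$$ **Claim.** There are constants $a>0$ and $c_1>0$ such that almost surely the following holds: for all $\eta,K,T>0$ and $p\in\mathbb N$ there is a (random) $\varepsilon_0>0$ such that for all $0<\varepsilon\le\varepsilon_0$ and all surfaces $\Sigma^\pm$ and extensions $\tilde d^\pm$ as above with $0\le\tau^\pm\le T$, 1. $u^{\varepsilon,-}$ is a subsolution of (1) on $[0,\tau^-]$ and $u^{\varepsilon,+}$ is a supersolution of (1) on $[0,\tau^+]$; 2. for every solution $u$ of (1) on some interval $[0,\tau]$ with $u^{\varepsilon,-}(x,0)\le u(x,0)\le u^{\varepsilon,+}(x,0)$ for all $x\in D$, one has, for all $x\in D$ and $t\in[0,\tau]$, $u^{\varepsilon,-}(x,t)\le u(x,t)$ if $t\le\tau^-$ and $u(x,t)\le u^{\varepsilon,+}(x,t)$ if $t\le\tau^+$. -/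

import Mathlib

open Set Filter Topology MeasureTheory ProbabilityTheory
open scoped NNReal Laplacian Gradient

noncomputable section

namespace AllenCahn

/-- The (negative derivative of the) double-well potential `F u = (u ^ 2 - 1) ^ 2 / 4`. -/
def f (u : ℝ) : ℝ := u - u ^ 3

/-! ### The noise -/

/-- A mollifying kernel: smooth, nonnegative, symmetric, supported in `[-1, 1]`, of mass one. -/
structure IsMollifier (ρ : ℝ → ℝ) : Prop where
  smooth : ContDiff ℝ (⊤ : ℕ∞) ρ
  nonneg : ∀ x, 0 ≤ ρ x
  symm : ∀ x, ρ (-x) = ρ x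
  support : ∀ x, x ∉ Icc (-1 : ℝ) 1 → ρ x = 0
  mass : ∫ x, ρ x = 1

/-- The two-sided process that equals `B t` for `t ≥ 0` and `B' (-t)` for `t < 0`. -/
def twoSided {Ω : Type*} (B B' : ℝ≥0 → Ω → ℝ) (t : ℝ) (ω : Ω) : ℝ :=
  if 0 ≤ t then B t.toNNReal ω else B' (-t).toNNReal ω

/-- `ρ^ε(x) = ε^{-γ} ρ(x / ε^γ)`. -/
def rescaledKernel (ρ : ℝ → ℝ) (γ ε x : ℝ) : ℝ := ε ^ (-γ) * ρ (x / ε ^ γ)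

/-- The mollified path `w ∗ ρ^ε`. -/
def mollifiedPath (ρ : ℝ → ℝ) (γ : ℝ) (w : ℝ → ℝ) (ε t : ℝ) : ℝ :=
  ∫ s, rescaledKernel ρ γ ε (t - s) * w s

/-- The noise `ξ^ε`: the time derivative of the mollified path. -/
def noise (ρ : ℝ → ℝ) (γ : ℝ) (w : ℝ → ℝ) (ε t : ℝ) : ℝ :=
  deriv (mollifiedPath ρ γ w ε) t

/-! ### Travelling waves -/

/-- `m (·, δ)` and `c δ`, `|δ| ≤ δ₀`, are increasing travelling waves and their speeds for the
reaction term `f + δ`; they connect the zeros `mMinus δ`, `mPlus δ` of `f + δ` which continue the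
stable zeros `-1`, `1` of `f`, and the profile is smooth in both variables. -/
structure IsTravellingWave (δ₀ : ℝ) (mMinus mPlus : ℝ → ℝ) (m : ℝ → ℝ → ℝ) (c : ℝ → ℝ) :
    Prop where
  pos : 0 < δ₀
  mMinus_cont : ContinuousOn mMinus (Icc (-δ₀) δ₀)
  mPlus_cont : ContinuousOn mPlus (Icc (-δ₀) δ₀)
  mMinus_zero : mMinus 0 = -1
  mPlus_zero : mPlus 0 = 1
  mMinus_root : ∀ δ ∈ Icc (-δ₀) δ₀, f (mMinus δ) + δ = 0
  mPlus_root : ∀ δ ∈ Icc (-δ₀) δ₀, f (mPlus δ) + δ = 0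
  smooth : ContDiffOn ℝ (⊤ : ℕ∞) (fun q : ℝ × ℝ => m q.1 q.2) (univ ×ˢ Icc (-δ₀) δ₀)
  increasing : ∀ δ ∈ Icc (-δ₀) δ₀, StrictMono fun x => m x δ
  ode : ∀ δ ∈ Icc (-δ₀) δ₀, ∀ x,
    deriv (deriv fun y => m y δ) x + c δ * deriv (fun y => m y δ) x + (f (m x δ) + δ) = 0
  tendsto_bot : ∀ δ ∈ Icc (-δ₀) δ₀, Tendsto (fun x => m x δ) atBot (𝓝 (mMinus δ))
  tendsto_top : ∀ δ ∈ Icc (-δ₀) δ₀, Tendsto (fun x => m x δ) atTop (𝓝 (mPlus δ))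

section Space

variable {n : ℕ}

/-! ### The domain and its outer normal -/

/-- `r` is a defining function of class `C²` of the open set `D`; a bounded open set has a boundary
of class `C²` exactly if it has such a function. -/
structure IsDefiningFunction (r : EuclideanSpace ℝ (Fin n) → ℝ)
    (D : Set (EuclideanSpace ℝ (Fin n))) : Prop where
  contDiff : ContDiff ℝ 2 r
  eq_neg : D = {x | r x < 0}
  gradient_ne : ∀ x, r x = 0 → ∇ r x ≠ 0

/-- The outer unit normal of `{r < 0}` at a boundary point. -/
def outerNormal (r : EuclideanSpace ℝ (Fin n) → ℝ) (x : EuclideanSpace ℝ (Fin n)) :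
    EuclideanSpace ℝ (Fin n) :=
  ‖∇ r x‖⁻¹ • ∇ r x

/-- At the boundary point `x` of `{r < 0}`, the function `v` on the closure of `{r < 0}` has the
outer normal derivative `q`. -/
def HasOuterNormalDeriv (r v : EuclideanSpace ℝ (Fin n) → ℝ) (x : EuclideanSpace ℝ (Fin n))
    (q : ℝ) : Prop :=
  HasDerivWithinAt (fun s : ℝ => v (x - s • outerNormal r x)) (-q) (Ici 0) 0

/-! ### Classical solutions, sub- and supersolutions of the Allen-Cahn equation -/

/-- `v` is continuous on `closure D × [0, τ]`, and on `D × (0, τ)` it is twice continuously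
differentiable in space and differentiable in time. -/
structure IsClassical (D : Set (EuclideanSpace ℝ (Fin n))) (τ : ℝ)
    (v : EuclideanSpace ℝ (Fin n) → ℝ → ℝ) : Prop where
  cont : ContinuousOn (fun q : EuclideanSpace ℝ (Fin n) × ℝ => v q.1 q.2)
    (closure D ×ˢ Icc 0 τ)
  space : ∀ t ∈ Ioo 0 τ, ContDiffOn ℝ 2 (fun x => v x t) D
  time : ∀ t ∈ Ioo 0 τ, ∀ x ∈ D, DifferentiableAt ℝ (fun s => v x s) t

/-- The residual `∂ₜ v - Δ v - ε⁻² f(v) - ε⁻¹ ξ(t)`. -/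
def residual (ε : ℝ) (ξ : ℝ → ℝ) (v : EuclideanSpace ℝ (Fin n) → ℝ → ℝ)
    (x : EuclideanSpace ℝ (Fin n)) (t : ℝ) : ℝ :=
  deriv (fun s => v x s) t - (Δ fun y => v y t) x - (ε ^ 2)⁻¹ * f (v x t) - ε⁻¹ * ξ t

/-- Classical solution on `[0, τ]`, with homogeneous Neumann boundary condition. -/
structure IsSolution (D : Set (EuclideanSpace ℝ (Fin n))) (r : EuclideanSpace ℝ (Fin n) → ℝ)
    (ε : ℝ) (ξ : ℝ → ℝ) (τ : ℝ) (v : EuclideanSpace ℝ (Fin n) → ℝ → ℝ) : Prop where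
  classical : IsClassical D τ v
  eqn : ∀ t ∈ Ioo 0 τ, ∀ x ∈ D, residual ε ξ v x t = 0
  neumann : ∀ t ∈ Ioo 0 τ, ∀ x ∈ frontier D, HasOuterNormalDeriv r (fun y => v y t) x 0

/-- Classical supersolution on `[0, τ]`. -/
structure IsSupersolution (D : Set (EuclideanSpace ℝ (Fin n)))
    (r : EuclideanSpace ℝ (Fin n) → ℝ)
    (ε : ℝ) (ξ : ℝ → ℝ) (τ : ℝ) (v : EuclideanSpace ℝ (Fin n) → ℝ → ℝ) : Prop where
  classical : IsClassical D τ v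
  ineq : ∀ t ∈ Ioo 0 τ, ∀ x ∈ D, 0 ≤ residual ε ξ v x t
  neumann : ∀ t ∈ Ioo 0 τ, ∀ x ∈ frontier D,
    ∃ q, HasOuterNormalDeriv r (fun y => v y t) x q ∧ 0 ≤ q

/-- Classical subsolution on `[0, τ]`. -/
structure IsSubsolution (D : Set (EuclideanSpace ℝ (Fin n)))
    (r : EuclideanSpace ℝ (Fin n) → ℝ)
    (ε : ℝ) (ξ : ℝ → ℝ) (τ : ℝ) (v : EuclideanSpace ℝ (Fin n) → ℝ → ℝ) : Prop where
  classical : IsClassical D τ v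
  ineq : ∀ t ∈ Ioo 0 τ, ∀ x ∈ D, residual ε ξ v x t ≤ 0
  neumann : ∀ t ∈ Ioo 0 τ, ∀ x ∈ frontier D,
    ∃ q, HasOuterNormalDeriv r (fun y => v y t) x q ∧ q ≤ 0

/-! ### Moving hypersurfaces -/

open Classical in
/-- Signed distance to the boundary of `A`, negative in `A`. -/
def signedDist (A : Set (EuclideanSpace ℝ (Fin n))) (x : EuclideanSpace ℝ (Fin n)) : ℝ :=
  if x ∈ A then -Metric.infDist x (frontier A) else Metric.infDist x (frontier A)

/-- Velocity, at `y` in the boundary of `U t`, of that boundary in the direction of its exterior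
normal (the signed distance decreases where the surface moves outwards). -/
def normalVelocity (U : ℝ → Set (EuclideanSpace ℝ (Fin n))) (t : ℝ)
    (y : EuclideanSpace ℝ (Fin n)) : ℝ :=
  -deriv (fun s => signedDist (U s) y) t

/-- Mean curvature (average of the principal curvatures) of the boundary of `A` at `y` with respect
to the exterior normal, with the sign that makes it negative for spheres bounding balls. The Hessian
of the signed distance `d` has the normal in its kernel and is, on the tangent space, minus the
second fundamental form; so the sum of the principal curvatures is `-Δ d`. -/
def meanCurvature (A : Set (EuclideanSpace ℝ (Fin n))) (y : EuclideanSpace ℝ (Fin n)) : ℝ :=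
  -(Δ (signedDist A)) y / ((n : ℝ) - 1)

/-- All principal curvatures of the boundary of `A` at `y` are at most `N` in absolute value:
the second fundamental form is bounded by `N` on the tangent space. -/
def PrincipalCurvaturesLE (A : Set (EuclideanSpace ℝ (Fin n))) (N : ℝ)
    (y : EuclideanSpace ℝ (Fin n)) : Prop :=
  ∀ v, fderiv ℝ (signedDist A) y v = 0 →
    |fderiv ℝ (fderiv ℝ (signedDist A)) y v v| ≤ N * ‖v‖ ^ 2

/-- The hypersurfaces `frontier (U t)`, `0 ≤ t ≤ τ`, evolve classically with normal velocity
`V = (n - 1) κ + g t`, their principal curvatures remain bounded by `N`, and their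
`η`-neighbourhoods remain in the open set `O ⊆ D`, in which the signed distance is regular. -/
structure IsForcedCurvatureFlow (D O : Set (EuclideanSpace ℝ (Fin n)))
    (U : ℝ → Set (EuclideanSpace ℝ (Fin n))) (g : ℝ → ℝ) (N η τ : ℝ) : Prop where
  isOpen : IsOpen O
  subset : O ⊆ D
  nonempty : ∀ t ∈ Icc 0 τ, (frontier (U t)).Nonempty
  nbhd : ∀ t ∈ Icc 0 τ, Metric.thickening η (frontier (U t)) ⊆ O
  cont : ContinuousOn (fun q : EuclideanSpace ℝ (Fin n) × ℝ => signedDist (U q.2) q.1)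
    (O ×ˢ Icc 0 τ)
  space : ∀ t ∈ Icc 0 τ, ContDiffOn ℝ 2 (signedDist (U t)) O
  time : ∀ t ∈ Ioo 0 τ, ∀ x ∈ O, DifferentiableAt ℝ (fun s => signedDist (U s) x) t
  velocity : ∀ t ∈ Ioo 0 τ, ∀ y ∈ frontier (U t),
    normalVelocity U t y = ((n : ℝ) - 1) * meanCurvature (U t) y + g t
  curvature : ∀ t ∈ Icc 0 τ, ∀ y ∈ frontier (U t), PrincipalCurvaturesLE (U t) N y

/-- `d` extends the signed distance functions of the surfaces `frontier (U t)` from `O` to `D`: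
it is at most `-η` in `U t` and at least `η` outside `U t` off `O`, its gradient has length at most
one, it is constant near each boundary point of `D`, and its time derivative and Laplacian are
bounded by `L`. -/
structure IsDistanceExtension (D O : Set (EuclideanSpace ℝ (Fin n)))
    (U : ℝ → Set (EuclideanSpace ℝ (Fin n))) (η L τ : ℝ)
    (d : EuclideanSpace ℝ (Fin n) → ℝ → ℝ) : Prop where
  classical : IsClassical D τ d
  eq_signedDist : ∀ t ∈ Icc 0 τ, ∀ x ∈ O, d x t = signedDist (U t) x
  inside : ∀ t ∈ Icc 0 τ, ∀ x ∈ D, x ∈ U t → x ∉ O → d x t ≤ -η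
  outside : ∀ t ∈ Icc 0 τ, ∀ x ∈ D, x ∉ U t → x ∉ O → η ≤ d x t
  gradient_le : ∀ t ∈ Ioo 0 τ, ∀ x ∈ D, ‖∇ (fun y => d y t) x‖ ≤ 1
  const_near : ∀ t ∈ Icc 0 τ, ∀ x ∈ frontier D, ∀ᶠ y in 𝓝[closure D] x, d y t = d x t
  time_le : ∀ t ∈ Ioo 0 τ, ∀ x ∈ D, |deriv (fun s => d x s) t| ≤ L
  laplacian_le : ∀ t ∈ Ioo 0 τ, ∀ x ∈ D, |(Δ fun y => d y t) x| ≤ L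

/-- `m ((d + σ ε^a e^{c₁ t}) / ε, ε ξ(t) + σ ε^β)`, the barrier `u^+` for `σ = 1` and `u^-` for
`σ = -1`. -/
def barrier (m : ℝ → ℝ → ℝ) (σ a c₁ β ε : ℝ) (ξ : ℝ → ℝ)
    (d : EuclideanSpace ℝ (Fin n) → ℝ → ℝ) (x : EuclideanSpace ℝ (Fin n)) (t : ℝ) : ℝ :=
  m ((d x t + σ * (ε ^ a * Real.exp (c₁ * t))) / ε) (ε * ξ t + σ * ε ^ β)

end Space

/-- The forcing `ε⁻¹ c (ε ξ(t) + σ ε^β)` of the surfaces, `σ = ±1`. -/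
def forcing (c : ℝ → ℝ) (σ β ε : ℝ) (ξ : ℝ → ℝ) (t : ℝ) : ℝ :=
  ε⁻¹ * c (ε * ξ t + σ * ε ^ β)

end AllenCahn

end

/-!
The Brownian path is Hölder continuous with any exponent `α < 1 / 2`, so that
`ε ξ^ε = O(ε^(1 - γ (1 - α)))` tends to zero, and `ε ∂ₜξ^ε = O(ε^(1 - γ (2 - α)))` stays bounded if
`α` is close to `1 / 2`, because `γ < 2 / 3`.
By the travelling wave equation the residual of the barrier `m (z, δ)` is the sum of `± ε^(β - 2)`,
a bounded term `ε ∂ₜξ^ε ∂_δ m`, the term `∂ₓm ε⁻¹ (∂ₜd - Δd + ε⁻¹ c(δ) ± c₁ ε^a e^{c₁ t})`, and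
a multiple of `1 - |∇d|²`. Near the surface `|∇d| = 1`, and the equation of motion with the
curvature bound gives `|∂ₜd - Δd + ε⁻¹ c(δ)| ≤ 2 n N² |d|`. This error is compensated by the shift
`c₁ ε^a e^{c₁ t}` up to `c₁ ε |z|`, and `|z| ∂ₓm` is bounded because the profile converges
exponentially. Away from the surface `∂ₓm` and `∂ₓ²m` are exponentially small in `1 / ε` while the
remaining factors are at most polynomial. As `β < 2`, the term `± ε^(β - 2)` dominates everything
else. The solutions are then trapped between the barriers by the comparison principle.
-/

namespace AllenCahn

/-! ### Hölder continuity of Brownian paths -/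

section Holder

variable {X E : Type*} [PseudoMetricSpace X] [PseudoMetricSpace E]

lemma holderOnWith_of_dist_le {C α : ℝ≥0} {w : X → E} {S : Set X}
    (H : ∀ s ∈ S, ∀ t ∈ S, dist (w s) (w t) ≤ C * dist s t ^ (α : ℝ)) : HolderOnWith C α w S := by
  intro s hs t ht
  have h : nndist (w s) (w t) ≤ C * nndist s t ^ (α : ℝ) := by
    rw [← NNReal.coe_le_coe]
    push_cast
    exact H s hs t ht
  rw [edist_nndist, edist_nndist, ← ENNReal.coe_rpow_of_nonneg _ α.coe_nonneg]
  exact_mod_cast h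

lemma holderOnWith_comp_of_lipschitzWith_one {Y : Type*} [PseudoMetricSpace Y] {C α : ℝ≥0}
    {w : X → E} {S : Set X} {g : Y → X} {S' : Set Y} (hw : HolderOnWith C α w S)
    (hg : LipschitzWith 1 g) (hmaps : MapsTo g S' S) : HolderOnWith C α (w ∘ g) S' :=
  fun s hs t ht => hw.edist_le_of_le (hmaps hs) (hmaps ht) <| by
    simpa only [ENNReal.coe_one, one_mul] using hg s t

lemma exists_holderOnWith_of_dist_lt {C h : ℝ} {α : ℝ≥0} {w : X → E} {S : Set X}
    (hS : Bornology.IsBounded (w '' S)) (hh : 0 < h)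
    (H : ∀ s ∈ S, ∀ t ∈ S, dist s t < h → dist (w s) (w t) ≤ C * dist s t ^ (α : ℝ)) :
    ∃ C', HolderOnWith C' α w S := by
  have : 0 < h ^ (α : ℝ) := Real.rpow_pos_of_pos hh _
  refine ⟨(max C (Metric.diam (w '' S) / h ^ (α : ℝ))).toNNReal,
    holderOnWith_of_dist_le fun s hs t ht => ?_⟩
  rw [Real.coe_toNNReal _ (le_max_of_le_right (by positivity))]
  rcases lt_or_ge (dist s t) h with hlt | hge
  · refine (H s hs t ht hlt).trans ?_
    gcongr
    exact le_max_left _ _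
  · calc dist (w s) (w t) ≤ Metric.diam (w '' S) :=
          Metric.dist_le_diam_of_mem hS (mem_image_of_mem w hs) (mem_image_of_mem w ht)
      _ = Metric.diam (w '' S) / h ^ (α : ℝ) * h ^ (α : ℝ) := by field_simp
      _ ≤ _ := by gcongr; exact le_max_right _ _

lemma holderOnWith_Icc_of_Icc_of_Icc {C C' α : ℝ≥0} {w : ℝ → E} {a b c : ℝ}
    (h : HolderOnWith C α w (Icc a b)) (h' : HolderOnWith C' α w (Icc b c)) :
    HolderOnWith (C + C') α w (Icc a c) := by
  have of_le : ∀ s ∈ Icc a c, ∀ t ∈ Icc a c, s ≤ t →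
      dist (w s) (w t) ≤ (C + C' : ℝ≥0) * dist s t ^ (α : ℝ) := by
    intro s hs t ht hst
    rw [NNReal.coe_add, add_mul]
    have hC : 0 ≤ C * dist s t ^ (α : ℝ) := by positivity
    have hC' : 0 ≤ C' * dist s t ^ (α : ℝ) := by positivity
    rcases le_total t b with htb | hbt
    · exact (h.dist_le ⟨hs.1, hst.trans htb⟩ ⟨ht.1, htb⟩).trans (le_add_of_nonneg_right hC')
    rcases le_total b s with hbs | hsb
    · exact (h'.dist_le ⟨hbs, hs.2⟩ ⟨hbt, ht.2⟩).trans (le_add_of_nonneg_left hC)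
    have hsb' : dist s b ≤ dist s t := by
      rw [dist_comm s, dist_comm s, Real.dist_eq, Real.dist_eq]
      gcongr
    have hbt' : dist b t ≤ dist s t := by
      rw [dist_comm b, dist_comm s, Real.dist_eq, Real.dist_eq]
      gcongr
    exact (dist_triangle _ (w b) _).trans (add_le_add
      (h.dist_le_of_le ⟨hs.1, hsb⟩ ⟨hs.1.trans hsb, le_rfl⟩ hsb')
      (h'.dist_le_of_le ⟨le_rfl, hbt.trans ht.2⟩ ⟨hbt, ht.2⟩ hbt'))
  refine holderOnWith_of_dist_le fun s hs t ht => ?_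
  rcases le_total s t with hst | hts
  · exact of_le s hs t ht hst
  · rw [dist_comm, dist_comm s]
    exact of_le t ht s hs hts

end Holder

/-- The largest multiple of `2⁻ʲ` that is at most `s`. -/
noncomputable def dyadicFloor (j : ℕ) (s : ℝ≥0) : ℝ≥0 := ⌊s * 2 ^ j⌋₊ / 2 ^ j

lemma dyadicFloor_le (j : ℕ) (s : ℝ≥0) : dyadicFloor j s ≤ s := by
  rw [dyadicFloor, div_le_iff₀ (by positivity)]
  exact Nat.floor_le zero_le

lemma lt_dyadicFloor_add (j : ℕ) (s : ℝ≥0) : s < dyadicFloor j s + (2 ^ j)⁻¹ := by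
  rw [dyadicFloor, ← one_div, ← add_div, lt_div_iff₀ (by positivity)]
  exact Nat.lt_floor_add_one _

lemma tendsto_dyadicFloor (s : ℝ≥0) : Tendsto (fun j => dyadicFloor j s) atTop (𝓝 s) := by
  have hpow : Tendsto (fun j : ℕ => (2 ^ j : ℝ≥0)⁻¹) atTop (𝓝 0) := by
    simpa only [inv_pow] using
      tendsto_pow_atTop_nhds_zero_of_lt_one (zero_le (a := (2⁻¹ : ℝ≥0)))
        (inv_lt_one_of_one_lt₀ one_lt_two)
  have hlower : Tendsto (fun j : ℕ => s - (2 ^ j : ℝ≥0)⁻¹) atTop (𝓝 s) := by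
    simpa only [tsub_zero] using tendsto_const_nhds.sub hpow
  exact tendsto_of_tendsto_of_tendsto_of_le_of_le hlower tendsto_const_nhds
    (fun j => tsub_le_iff_right.2 (lt_dyadicFloor_add j s).le) (fun j => dyadicFloor_le j s)

section Chaining

variable {E : Type*} [PseudoMetricSpace E] {w : ℝ≥0 → E} {M J : ℕ} {θ : ℝ} {s t : ℝ≥0} {j : ℕ}

lemma dist_dyadicFloor_succ_le
    (hinc : ∀ j ≥ J, ∀ k < M * 2 ^ j, dist (w ((k + 1 : ℕ) / 2 ^ j)) (w (k / 2 ^ j)) ≤ θ ^ j)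
    (hθ : 0 ≤ θ) (hs : s < M) (hj : J ≤ j) :
    dist (w (dyadicFloor (j + 1) s)) (w (dyadicFloor j s)) ≤ θ ^ (j + 1) := by
  have hfloor : ⌊s * 2 ^ j⌋₊ = ⌊s * 2 ^ (j + 1)⌋₊ / 2 := by
    rw [pow_succ, ← mul_assoc, ← Nat.floor_div_natCast, Nat.cast_two,
      mul_div_cancel_right₀ _ two_ne_zero]
  have hcoarse : dyadicFloor j s = (2 * ⌊s * 2 ^ j⌋₊ : ℕ) / 2 ^ (j + 1) := by
    rw [dyadicFloor, pow_succ']; push_cast; rw [mul_div_mul_left _ _ two_ne_zero]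
  have hk : 2 * ⌊s * 2 ^ j⌋₊ < M * 2 ^ (j + 1) := by
    have : ⌊s * 2 ^ j⌋₊ < M * 2 ^ j := by
      rw [Nat.floor_lt zero_le]; push_cast; gcongr
    rw [pow_succ, ← mul_assoc]; omega
  rw [hcoarse, dyadicFloor]
  rcases (by omega : ⌊s * 2 ^ (j + 1)⌋₊ = 2 * ⌊s * 2 ^ j⌋₊ ∨
    ⌊s * 2 ^ (j + 1)⌋₊ = 2 * ⌊s * 2 ^ j⌋₊ + 1) with h | h <;> rw [h]
  · rw [dist_self]; positivity
  · exact hinc (j + 1) (by omega) _ hk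

lemma dist_dyadicFloor_le (hw : Continuous w)
    (hinc : ∀ j ≥ J, ∀ k < M * 2 ^ j, dist (w ((k + 1 : ℕ) / 2 ^ j)) (w (k / 2 ^ j)) ≤ θ ^ j)
    (hθ : 0 ≤ θ) (hθ' : θ < 1) (hs : s < M) (hj : J ≤ j) :
    dist (w (dyadicFloor j s)) (w s) ≤ θ ^ j / (1 - θ) := by
  have hstep : ∀ i, dist (w (dyadicFloor (i + j) s)) (w (dyadicFloor (i + 1 + j) s))
      ≤ θ ^ j * θ ^ i := by
    intro i
    rw [dist_comm, add_right_comm]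
    refine (dist_dyadicFloor_succ_le hinc hθ hs (by omega)).trans ?_
    rw [← pow_add]
    exact pow_le_pow_of_le_one hθ hθ'.le (by omega)
  have hlim : Tendsto (fun i => w (dyadicFloor (i + j) s)) atTop (𝓝 (w s)) :=
    (hw.tendsto s).comp ((tendsto_add_atTop_iff_nat j).2 (tendsto_dyadicFloor s))
  simpa only [zero_add] using dist_le_of_le_geometric_of_tendsto₀ θ (θ ^ j) hθ' hstep hlim

lemma dist_dyadicFloor_dyadicFloor_le
    (hinc : ∀ j ≥ J, ∀ k < M * 2 ^ j, dist (w ((k + 1 : ℕ) / 2 ^ j)) (w (k / 2 ^ j)) ≤ θ ^ j)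
    (hθ : 0 ≤ θ) (hst : s ≤ t) (hts : t ≤ s + (2 ^ j)⁻¹) (hs : s < M) (hj : J ≤ j) :
    dist (w (dyadicFloor j t)) (w (dyadicFloor j s)) ≤ θ ^ j := by
  have hlower : ⌊s * 2 ^ j⌋₊ ≤ ⌊t * 2 ^ j⌋₊ := Nat.floor_mono (by gcongr)
  have hupper : ⌊t * 2 ^ j⌋₊ ≤ ⌊s * 2 ^ j⌋₊ + 1 := by
    rw [← Nat.floor_add_one zero_le]
    refine Nat.floor_mono ?_
    calc t * 2 ^ j ≤ (s + (2 ^ j)⁻¹) * 2 ^ j := by gcongr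
      _ = s * 2 ^ j + 1 := by rw [add_mul, inv_mul_cancel₀ (by positivity)]
  have hk : ⌊s * 2 ^ j⌋₊ < M * 2 ^ j := by
    rw [Nat.floor_lt zero_le]; push_cast; gcongr
  rw [dyadicFloor, dyadicFloor]
  rcases (by omega : ⌊t * 2 ^ j⌋₊ = ⌊s * 2 ^ j⌋₊ ∨ ⌊t * 2 ^ j⌋₊ = ⌊s * 2 ^ j⌋₊ + 1)
    with h | h <;> rw [h]
  · rw [dist_self]; positivity
  · exact hinc j hj _ hk

lemma dist_le_of_dyadic_increments (hw : Continuous w)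
    (hinc : ∀ j ≥ J, ∀ k < M * 2 ^ j, dist (w ((k + 1 : ℕ) / 2 ^ j)) (w (k / 2 ^ j)) ≤ θ ^ j)
    (hθ : 0 ≤ θ) (hθ' : θ < 1) (hst : s ≤ t) (hts : t ≤ s + (2 ^ j)⁻¹) (ht : t < M) (hj : J ≤ j) :
    dist (w t) (w s) ≤ (1 + 2 / (1 - θ)) * θ ^ j := by
  have hs : s < M := hst.trans_lt ht
  have ht_floor := dist_dyadicFloor_le hw hinc hθ hθ' ht hj
  have hs_floor := dist_dyadicFloor_le hw hinc hθ hθ' hs hj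
  have hfloors := dist_dyadicFloor_dyadicFloor_le hinc hθ hst hts hs hj
  have htriangle := dist_triangle4 (w t) (w (dyadicFloor j t)) (w (dyadicFloor j s)) (w s)
  rw [dist_comm (w t) (w (dyadicFloor j t))] at htriangle
  linear_combination htriangle + ht_floor + hfloors + hs_floor

lemma exists_holderOnWith_of_dyadic_increments (hw : Continuous w) {α : ℝ≥0} (hα : 0 < α)
    (hinc : ∀ j ≥ J, ∀ k < M * 2 ^ j,
      dist (w ((k + 1 : ℕ) / 2 ^ j)) (w (k / 2 ^ j)) ≤ ((2 : ℝ) ^ (-α : ℝ)) ^ j) :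
    ∃ C, HolderOnWith C α w (Iio M) := by
  set θ : ℝ := 2 ^ (-α : ℝ) with hθ_def
  have hθ : 0 < θ := by positivity
  have hθ' : θ < 1 := Real.rpow_lt_one_of_one_lt_of_neg one_lt_two (neg_lt_zero.2 hα)
  have hθ_pow : ∀ j : ℕ, θ ^ j = ((2⁻¹ : ℝ) ^ j) ^ (α : ℝ) := fun j => by
    rw [← Real.rpow_natCast, ← Real.rpow_natCast, hθ_def, Real.rpow_neg zero_le_two,
      ← Real.inv_rpow zero_le_two, ← Real.rpow_mul (by positivity), ← Real.rpow_mul (by positivity),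
      mul_comm]
  have of_lt : ∀ s t : ℝ≥0, s < t → t < M → dist t s < (2⁻¹ : ℝ) ^ J →
      dist (w t) (w s) ≤ (1 + 2 / (1 - θ)) / θ * dist t s ^ (α : ℝ) := by
    intro s t hst ht hd
    obtain ⟨j, hj, hj'⟩ := exists_nat_pow_near_of_lt_one (dist_pos.2 hst.ne')
      (hd.le.trans (pow_le_one₀ (by norm_num) (by norm_num)))
      (by norm_num : (0 : ℝ) < 2⁻¹) (by norm_num)
    have hJj : J ≤ j := Nat.lt_succ_iff.1 <|
      (pow_lt_pow_iff_right_of_lt_one₀ (by norm_num : (0 : ℝ) < 2⁻¹) (by norm_num)).1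
        (hj.trans hd)
    have hts : t ≤ s + (2 ^ j)⁻¹ := by
      rw [NNReal.dist_eq, inv_pow] at hj'
      rw [← NNReal.coe_le_coe]
      push_cast
      linarith [le_abs_self ((t : ℝ) - s)]
    calc dist (w t) (w s) ≤ (1 + 2 / (1 - θ)) * θ ^ j :=
          dist_le_of_dyadic_increments hw hinc hθ.le hθ' hst.le hts ht hJj
      _ = (1 + 2 / (1 - θ)) / θ * θ ^ (j + 1) := by field_simp; ring
      _ ≤ (1 + 2 / (1 - θ)) / θ * dist t s ^ (α : ℝ) := by
          have := sub_pos.2 hθ'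
          rw [hθ_pow]
          gcongr
  have hbounded : Bornology.IsBounded (w '' Iio (M : ℝ≥0)) :=
    ((isCompact_Icc (a := (0 : ℝ≥0)) (b := M)).image hw).isBounded.subset
      (image_mono fun s hs => ⟨zero_le, hs.le⟩)
  refine exists_holderOnWith_of_dist_lt hbounded (by positivity : (0 : ℝ) < 2⁻¹ ^ J)
    (C := (1 + 2 / (1 - θ)) / θ) fun s hs t ht hd => ?_
  rcases lt_trichotomy s t with h | rfl | h
  · rw [dist_comm s] at hd ⊢
    rw [dist_comm (w s)]
    exact of_lt s t h ht hd
  · rw [dist_self, dist_self, Real.zero_rpow (NNReal.coe_ne_zero.2 hα.ne'), mul_zero]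
  · exact of_lt t s h hs hd

end Chaining

open scoped ENNReal

section KolmogorovProcess

variable {Ω E : Type*} [MeasurableSpace Ω] {P : Measure Ω} {M : ℝ≥0} {p q : ℝ}

lemma measure_le_edist_le {T : Type*} [PseudoEMetricSpace T] [PseudoEMetricSpace E]
    {X : T → Ω → E} (hX : IsAEKolmogorovProcess X P p q M) (s t : T) {b : ℝ≥0∞} (hb : b ≠ 0)
    (hb' : b ≠ ∞) : P {ω | b ≤ edist (X s ω) (X t ω)} ≤ M * edist s t ^ q / b ^ p := by
  calc P {ω | b ≤ edist (X s ω) (X t ω)} = P {ω | b ^ p ≤ edist (X s ω) (X t ω) ^ p} := by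
        simp only [ENNReal.rpow_le_rpow_iff hX.p_pos]
    _ ≤ (∫⁻ ω, edist (X s ω) (X t ω) ^ p ∂P) / b ^ p :=
        meas_ge_le_lintegral_div (hX.aemeasurable_edist.pow_const p)
          (by simp [ENNReal.rpow_eq_zero_iff, hb, hb'])
          (ENNReal.rpow_ne_top_of_nonneg hX.p_pos.le hb')
    _ ≤ _ := by gcongr; exact hX.kolmogorovCondition s t

lemma edist_dyadic_succ (j k : ℕ) :
    edist ((k + 1 : ℕ) / 2 ^ j : ℝ≥0) (k / 2 ^ j) = (2 ^ j)⁻¹ := by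
  have : nndist ((k + 1 : ℕ) / 2 ^ j : ℝ≥0) (k / 2 ^ j) = (2 ^ j)⁻¹ := by
    rw [← NNReal.coe_inj, coe_nndist, NNReal.dist_eq]
    push_cast
    rw [← sub_div, add_sub_cancel_left, abs_of_pos (by positivity), one_div]
  rw [edist_nndist, this, ENNReal.coe_inv (by positivity)]
  push_cast
  rfl

variable [PseudoMetricSpace E] {X : ℝ≥0 → Ω → E}

lemma measure_exists_dyadic_increment_ge_le (hX : IsAEKolmogorovProcess X P p q M) (α : ℝ)
    (K j : ℕ) :
    P {ω | ∃ k < K * 2 ^ j, ((2 : ℝ≥0∞) ^ (-α)) ^ j ≤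
        edist (X ((k + 1 : ℕ) / 2 ^ j) ω) (X (k / 2 ^ j) ω)} ≤
      K * M * ((2 : ℝ≥0∞) ^ (1 + p * α - q)) ^ j := by
  set b : ℝ≥0∞ := ((2 : ℝ≥0∞) ^ (-α)) ^ j with hb_def
  have hb : b ≠ 0 := pow_ne_zero _ (by simp)
  have hb' : b ≠ ∞ := ENNReal.pow_ne_top (ENNReal.rpow_ne_top_of_ne_zero (by simp) (by simp))
  have hunion : {ω | ∃ k < K * 2 ^ j, b ≤ edist (X ((k + 1 : ℕ) / 2 ^ j) ω) (X (k / 2 ^ j) ω)} =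
      ⋃ k ∈ Finset.range (K * 2 ^ j),
        {ω | b ≤ edist (X ((k + 1 : ℕ) / 2 ^ j) ω) (X (k / 2 ^ j) ω)} := by
    ext ω
    simp only [mem_ofPred_eq, mem_iUnion, Finset.mem_range, exists_prop]
  have hscale : (2 : ℝ≥0∞) ^ j * (((2 : ℝ≥0∞) ^ j)⁻¹ ^ q / b ^ p) =
      ((2 : ℝ≥0∞) ^ (1 + p * α - q)) ^ j := by
    simp only [hb_def, div_eq_mul_inv, ← ENNReal.rpow_natCast, ← ENNReal.rpow_neg,
      ← ENNReal.rpow_mul, ← ENNReal.rpow_add _ _ two_ne_zero ENNReal.ofNat_ne_top]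
    congr 1
    ring
  rw [hunion]
  calc _ ≤ ∑ k ∈ Finset.range (K * 2 ^ j),
          P {ω | b ≤ edist (X ((k + 1 : ℕ) / 2 ^ j) ω) (X (k / 2 ^ j) ω)} :=
        measure_biUnion_finset_le _ _
    _ ≤ ∑ _k ∈ Finset.range (K * 2 ^ j), M * ((2 : ℝ≥0∞) ^ j)⁻¹ ^ q / b ^ p :=
        Finset.sum_le_sum fun k _ =>
          (measure_le_edist_le hX _ _ hb hb').trans_eq (by rw [edist_dyadic_succ])
    _ = K * M * (2 ^ j * (((2 : ℝ≥0∞) ^ j)⁻¹ ^ q / b ^ p)) := by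
        rw [Finset.sum_const, Finset.card_range, nsmul_eq_mul, mul_div_assoc]
        push_cast
        ring
    _ = _ := by rw [hscale]

theorem ae_exists_holderOnWith (hX : IsAEKolmogorovProcess X P p q M)
    (hcont : ∀ᵐ ω ∂P, Continuous (X · ω)) {α : ℝ≥0} (hα : 0 < α) (hαq : 1 + p * α < q) :
    ∀ᵐ ω ∂P, ∀ K : ℕ, ∃ C, HolderOnWith C α (X · ω) (Iio K) := by
  rw [ae_all_iff]
  intro K
  have hsum : ∑' j : ℕ, P {ω | ∃ k < K * 2 ^ j, ((2 : ℝ≥0∞) ^ (-α : ℝ)) ^ j ≤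
      edist (X ((k + 1 : ℕ) / 2 ^ j) ω) (X (k / 2 ^ j) ω)} ≠ ∞ := by
    refine ne_top_of_le_ne_top ?_
      (ENNReal.tsum_le_tsum fun j => measure_exists_dyadic_increment_ge_le hX α K j)
    rw [ENNReal.tsum_mul_left]
    refine ENNReal.mul_ne_top (by finiteness) (tsum_geometric_lt_top.2 ?_).ne
    exact ENNReal.rpow_lt_one_of_one_lt_of_neg ENNReal.one_lt_two (by linarith)
  filter_upwards [ae_eventually_notMem hsum, hcont] with ω hω hcont
  obtain ⟨J, hJ⟩ := eventually_atTop.1 hω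
  refine exists_holderOnWith_of_dyadic_increments hcont hα (J := J) fun j hj k hk => ?_
  have hlt := not_le.1 fun hle => hJ j hj ⟨k, hk, hle⟩
  have hpow : ((2 : ℝ≥0∞) ^ (-α : ℝ)) ^ j = ENNReal.ofReal (((2 : ℝ) ^ (-α : ℝ)) ^ j) := by
    rw [ENNReal.ofReal_pow (by positivity), ← ENNReal.ofReal_rpow_of_pos two_pos,
      ENNReal.ofReal_ofNat]
  rw [hpow, edist_dist] at hlt
  exact (ENNReal.ofReal_lt_ofReal_iff_of_nonneg dist_nonneg).1 hlt |>.le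

end KolmogorovProcess

section Brownian

variable {Ω : Type*} [MeasurableSpace Ω] {P : Measure Ω}

lemma gaussianReal_eq_map_sqrt_mul (v : ℝ≥0) :
    gaussianReal 0 v = (gaussianReal 0 1).map ((NNReal.sqrt v : ℝ) * ·) := by
  rw [gaussianReal_map_const_mul, mul_zero]
  congr 1
  ext
  simp

lemma lintegral_enorm_rpow_of_hasLaw_gaussianReal {X : Ω → ℝ} {v : ℝ≥0}
    (hX : HasLaw X (gaussianReal 0 v) P) {p : ℝ} (hp : 0 ≤ p) :
    ∫⁻ ω, ‖X ω‖ₑ ^ p ∂P = (v : ℝ≥0∞) ^ (p / 2) * ∫⁻ x, ‖x‖ₑ ^ p ∂gaussianReal 0 1 := by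
  have hmeas : Measurable fun x : ℝ => ‖x‖ₑ ^ p := by fun_prop
  rw [← lintegral_map' hmeas.aemeasurable hX.aemeasurable, hX.map_eq,
    gaussianReal_eq_map_sqrt_mul, lintegral_map hmeas (by fun_prop),
    ← lintegral_const_mul _ hmeas]
  congr 1 with x
  have hsqrt : ‖(NNReal.sqrt v : ℝ)‖ₑ = (v : ℝ≥0∞) ^ (1 / 2 : ℝ) := by
    rw [NNReal.enorm_eq, NNReal.sqrt_eq_rpow, ENNReal.coe_rpow_of_nonneg _ (by norm_num)]
  rw [enorm_mul, ENNReal.mul_rpow_of_nonneg _ _ hp, hsqrt, ← ENNReal.rpow_mul]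
  congr 2
  ring

lemma exists_isAEKolmogorovProcess {B : ℝ≥0 → Ω → ℝ} (hB : IsBrownianReal B P) {p : ℝ}
    (hp : 0 < p) : ∃ M, IsAEKolmogorovProcess B P p (p / 2) M := by
  have hfin : ∫⁻ x, ‖x‖ₑ ^ p ∂gaussianReal 0 1 ≠ ∞ := by
    have := lintegral_rpow_enorm_lt_top_of_eLpNorm_lt_top (p := ENNReal.ofReal p)
      (by simpa using hp) (by simp) (memLp_id_gaussianReal (μ := 0) (v := 1) p.toNNReal).2
    rw [ENNReal.toReal_ofReal hp.le] at this
    exact this.ne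
  refine ⟨(∫⁻ x, ‖x‖ₑ ^ p ∂gaussianReal 0 1).toNNReal, fun t => (hB.aemeasurable t).mk,
    .mk_of_secondCountableTopology (fun t => (hB.aemeasurable t).measurable_mk)
      (fun s t => ?_) hp (by positivity), fun t => (hB.aemeasurable t).ae_eq_mk⟩
  calc ∫⁻ ω, edist ((hB.aemeasurable s).mk _ ω) ((hB.aemeasurable t).mk _ ω) ^ p ∂P
      = ∫⁻ ω, ‖(B s - B t) ω‖ₑ ^ p ∂P := by
        refine lintegral_congr_ae ?_
        filter_upwards [(hB.aemeasurable s).ae_eq_mk, (hB.aemeasurable t).ae_eq_mk] with ω hs ht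
        rw [← hs, ← ht, edist_eq_enorm_sub, Pi.sub_apply]
    _ = edist s t ^ (p / 2) * ∫⁻ x, ‖x‖ₑ ^ p ∂gaussianReal 0 1 := by
        rw [edist_nndist]
        exact lintegral_enorm_rpow_of_hasLaw_gaussianReal (hB.hasLaw_sub s t) hp.le
    _ ≤ _ := by rw [ENNReal.coe_toNNReal hfin, mul_comm]

theorem ae_exists_holderOnWith_brownian {B : ℝ≥0 → Ω → ℝ} (hB : IsBrownianReal B P) {α : ℝ≥0}
    (hα : 0 < α) (hα' : (α : ℝ) < 1 / 2) :
    ∀ᵐ ω ∂P, ∀ K : ℕ, ∃ C, HolderOnWith C α (B · ω) (Iio K) := by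
  have hgap : 0 < 1 / 2 - (α : ℝ) := sub_pos.2 hα'
  obtain ⟨M, hM⟩ := exists_isAEKolmogorovProcess hB (p := 2 / (1 / 2 - α)) (by positivity)
  refine ae_exists_holderOnWith hM hB.cont hα ?_
  have : 2 / (1 / 2 - (α : ℝ)) * (1 / 2 - α) = 2 := div_mul_cancel₀ _ hgap.ne'
  linarith

theorem ae_continuous_and_exists_holderOnWith_twoSided {B B' : ℝ≥0 → Ω → ℝ}
    (hB : IsBrownianReal B P) (hB' : IsBrownianReal B' P) {α : ℝ≥0} (hα : 0 < α)
    (hα' : (α : ℝ) < 1 / 2) :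
    ∀ᵐ ω ∂P, Continuous (twoSided B B' · ω) ∧
      ∀ T : ℝ, ∃ C, HolderOnWith C α (twoSided B B' · ω) (Icc (-T) T) := by
  filter_upwards [ae_exists_holderOnWith_brownian hB hα hα',
    ae_exists_holderOnWith_brownian hB' hα hα', hB.cont, hB'.cont, hB.eval_zero_ae_eq_zero,
    hB'.eval_zero_ae_eq_zero] with ω hH hH' hc hc' h0 h0'
  have hzero : ∀ t ≤ (0 : ℝ), twoSided B B' t ω = B' (-t).toNNReal ω := fun t ht => by
    rcases ht.eq_or_lt with rfl | ht
    · simp only [twoSided, le_refl, if_true, neg_zero, Real.toNNReal_zero, h0, h0']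
    · exact if_neg ht.not_ge
  refine ⟨?_, fun T => ?_⟩
  · refine Continuous.if_le (by fun_prop) (by fun_prop) continuous_const continuous_id ?_
    rintro t rfl
    simp only [neg_zero, Real.toNNReal_zero, h0, h0']
  obtain ⟨K, hK⟩ := exists_nat_gt T
  obtain ⟨C, hC⟩ := hH K
  obtain ⟨C', hC'⟩ := hH' K
  have hneg : LipschitzWith 1 fun t : ℝ => (-t).toNNReal := fun s t =>
    (Real.lipschitzWith_toNNReal (-s) (-t)).trans_eq (by rw [edist_neg_neg])
  have hleft : HolderOnWith C' α ((B' · ω) ∘ fun t : ℝ => (-t).toNNReal) (Icc (-T) 0) :=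
    holderOnWith_comp_of_lipschitzWith_one hC' hneg fun t ht =>
      (Real.toNNReal_lt_iff_lt_coe (neg_nonneg.2 ht.2)).2 ((neg_le.1 ht.1).trans_lt hK)
  have hright : HolderOnWith C α ((B · ω) ∘ Real.toNNReal) (Icc 0 T) :=
    holderOnWith_comp_of_lipschitzWith_one hC Real.lipschitzWith_toNNReal fun t ht =>
      (Real.toNNReal_lt_iff_lt_coe ht.1).2 (ht.2.trans_lt hK)
  refine ⟨C' + C, holderOnWith_Icc_of_Icc_of_Icc (b := 0) (fun s hs t ht => ?_)
    fun s hs t ht => ?_⟩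
  · simpa only [hzero s hs.2, hzero t ht.2] using! hleft s hs t ht
  · simpa only [twoSided, if_pos hs.1, if_pos ht.1] using! hright s hs t ht

end Brownian

/-! ### Bounds for the noise -/

section Mollification

variable {k w : ℝ → ℝ} {γ ε K : ℝ}

lemma contDiff_rescaledKernel {n : ℕ∞} (hk : ContDiff ℝ n k) :
    ContDiff ℝ n (rescaledKernel k γ ε) :=
  contDiff_const.mul (hk.comp (contDiff_id.div_const _))

lemma deriv_rescaledKernel (k : ℝ → ℝ) (γ ε x : ℝ) :
    deriv (rescaledKernel k γ ε) x = (ε ^ γ)⁻¹ * rescaledKernel (deriv k) γ ε x := by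
  have hscale : rescaledKernel k γ ε = fun x => ε ^ (-γ) * k ((ε ^ γ)⁻¹ * x) := by
    funext x
    rw [rescaledKernel, div_eq_inv_mul]
  rw [hscale, deriv_const_mul_field, deriv_comp_mul_left, rescaledKernel, smul_eq_mul,
    div_eq_inv_mul, mul_left_comm]

lemma hasCompactSupport_rescaledKernel (hk : HasCompactSupport k) (hε : 0 < ε) :
    HasCompactSupport (rescaledKernel k γ ε) := by
  have hcomp := hk.comp_homeomorph
    (Homeomorph.mulRight₀ (ε ^ γ)⁻¹ (inv_ne_zero (Real.rpow_pos_of_pos hε γ).ne'))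
  exact hcomp.mul_left

lemma hasDerivAt_mollifiedPath (hk : ContDiff ℝ 1 k) (hks : HasCompactSupport k)
    (hw : Continuous w) (hε : 0 < ε) (t : ℝ) :
    HasDerivAt (mollifiedPath k γ w ε) ((ε ^ γ)⁻¹ * mollifiedPath (deriv k) γ w ε t) t := by
  have hconv : ∀ g : ℝ → ℝ, convolution g w (ContinuousLinearMap.mul ℝ ℝ) volume =
      fun t => ∫ s, g (t - s) * w s := fun g => funext fun t => convolution_eq_swap ..
  have hderiv := (hasCompactSupport_rescaledKernel (γ := γ) hks hε).hasDerivAt_convolution_left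
    (ContinuousLinearMap.mul ℝ ℝ) (μ := volume) (contDiff_rescaledKernel (n := 1) hk)
    hw.locallyIntegrable t
  rw [hconv, hconv] at hderiv
  refine hderiv.congr_deriv ?_
  simp only [mollifiedPath, deriv_rescaledKernel, mul_assoc, integral_const_mul]

lemma mollifiedPath_eq_integral (k w : ℝ → ℝ) (γ : ℝ) (hε : 0 < ε) (t : ℝ) :
    mollifiedPath k γ w ε t = ∫ s, k s * w (t - ε ^ γ * s) := by
  have hpos : 0 < ε ^ γ := Real.rpow_pos_of_pos hε γ
  calc mollifiedPath k γ w ε t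
      = ∫ s, rescaledKernel k γ ε s * w (t - s) := by
        simpa only [sub_sub_cancel] using!
          integral_sub_left_eq_self (fun s => rescaledKernel k γ ε s * w (t - s)) volume t
    _ = ∫ s, (ε ^ γ)⁻¹ * (k (s / ε ^ γ) * w (t - ε ^ γ * (s / ε ^ γ))) := by
        simp only [rescaledKernel, Real.rpow_neg hε.le, mul_div_cancel₀ _ hpos.ne', mul_assoc]
    _ = ∫ s, k s * w (t - ε ^ γ * s) := by
        rw [integral_const_mul,
          Measure.integral_comp_div (fun s => k s * w (t - ε ^ γ * s)) (ε ^ γ), smul_eq_mul,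
          abs_of_pos hpos, inv_mul_cancel_left₀ hpos.ne']

lemma abs_mollifiedPath_le_of_integral_eq_zero (hk : Continuous k)
    (hks : tsupport k ⊆ Icc (-1) 1) (hk0 : ∫ x, k x = 0) (hw : Continuous w)
    (hK : ∀ x, |k x| ≤ K) (hε : 0 < ε) {t H : ℝ}
    (hH : ∀ s, |s - t| ≤ ε ^ γ → |w s - w t| ≤ H) :
    |mollifiedPath k γ w ε t| ≤ 2 * K * H := by
  have hpos : 0 < ε ^ γ := Real.rpow_pos_of_pos hε γ
  have hcompact : HasCompactSupport k :=
    isCompact_Icc.of_isClosed_subset (isClosed_tsupport k) hks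
  have hsubtract : mollifiedPath k γ w ε t = ∫ s, k s * (w (t - ε ^ γ * s) - w t) := by
    rw [mollifiedPath_eq_integral k w γ hε]
    simp_rw [mul_sub]
    rw [integral_sub, integral_mul_const, hk0, zero_mul, sub_zero]
    · exact Continuous.integrable_of_hasCompactSupport (by fun_prop) hcompact.mul_right
    · exact (hk.integrable_of_hasCompactSupport hcompact).mul_const _
  have hbound : ∀ s ∈ Icc (-1 : ℝ) 1, ‖k s * (w (t - ε ^ γ * s) - w t)‖ ≤ K * H := fun s hs => by
    rw [norm_mul]
    refine mul_le_mul (hK s) (hH _ ?_) (norm_nonneg _) ((abs_nonneg _).trans (hK 0))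
    rw [sub_sub_cancel_left, abs_neg, abs_mul, abs_of_pos hpos]
    exact mul_le_of_le_one_right hpos.le (abs_le.2 hs)
  rw [hsubtract, ← setIntegral_eq_integral_of_forall_compl_eq_zero (s := Icc (-1) 1)
    fun s hs => by rw [image_eq_zero_of_notMem_tsupport fun h => hs (hks h), zero_mul]]
  have hint := norm_setIntegral_le_of_norm_le_const (μ := volume)
    (by rw [Real.volume_Icc]; exact ENNReal.ofReal_lt_top) hbound
  rw [measureReal_def, Real.volume_Icc, ENNReal.toReal_ofReal (by norm_num)] at hint
  exact hint.trans_eq (by ring)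

lemma integral_deriv_eq_zero (hk : ContDiff ℝ 1 k) (hks : HasCompactSupport k) :
    ∫ x, deriv k x = 0 :=
  integral_eq_zero_of_hasDerivAt_of_integrable
    (fun x => (hk.differentiable one_ne_zero x).hasDerivAt)
    ((hk.continuous_deriv le_rfl).integrable_of_hasCompactSupport hks.deriv)
    (hk.continuous.integrable_of_hasCompactSupport hks)

end Mollification

section Noise

variable {ρ w : ℝ → ℝ} {γ ε K t H : ℝ}

lemma IsMollifier.tsupport_subset (hρ : IsMollifier ρ) : tsupport ρ ⊆ Icc (-1) 1 :=
  closure_minimal (Function.support_subset_iff'.2 hρ.support) isClosed_Icc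

lemma IsMollifier.hasCompactSupport (hρ : IsMollifier ρ) : HasCompactSupport ρ :=
  isCompact_Icc.of_isClosed_subset (isClosed_tsupport ρ) hρ.tsupport_subset

lemma IsMollifier.contDiff_deriv (hρ : IsMollifier ρ) : ContDiff ℝ 1 (deriv ρ) :=
  ((contDiff_infty_iff_deriv.1 hρ.smooth).2).of_le (mod_cast le_top)

lemma IsMollifier.exists_deriv_bounds (hρ : IsMollifier ρ) :
    ∃ K, (∀ x, |deriv ρ x| ≤ K) ∧ ∀ x, |deriv (deriv ρ) x| ≤ K := by
  obtain ⟨K₁, hK₁⟩ := hρ.contDiff_deriv.continuous.bounded_above_of_compact_support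
    hρ.hasCompactSupport.deriv
  obtain ⟨K₂, hK₂⟩ := (hρ.contDiff_deriv.continuous_deriv le_rfl).bounded_above_of_compact_support
    hρ.hasCompactSupport.deriv.deriv
  exact ⟨max K₁ K₂, fun x => (hK₁ x).trans (le_max_left _ _),
    fun x => (hK₂ x).trans (le_max_right _ _)⟩

lemma noise_eq (hρ : IsMollifier ρ) (hw : Continuous w) (hε : 0 < ε) :
    noise ρ γ w ε = fun t => (ε ^ γ)⁻¹ * mollifiedPath (deriv ρ) γ w ε t :=
  funext fun t => (hasDerivAt_mollifiedPath (hρ.smooth.of_le (mod_cast le_top))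
    hρ.hasCompactSupport hw hε t).deriv

lemma hasDerivAt_noise (hρ : IsMollifier ρ) (hw : Continuous w) (hε : 0 < ε) (t : ℝ) :
    HasDerivAt (noise ρ γ w ε)
      ((ε ^ γ)⁻¹ * ((ε ^ γ)⁻¹ * mollifiedPath (deriv (deriv ρ)) γ w ε t)) t := by
  rw [noise_eq hρ hw hε]
  exact (hasDerivAt_mollifiedPath hρ.contDiff_deriv hρ.hasCompactSupport.deriv hw hε t).const_mul _

lemma abs_noise_le (hρ : IsMollifier ρ) (hw : Continuous w) (hK : ∀ x, |deriv ρ x| ≤ K)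
    (hε : 0 < ε) (hH : ∀ s, |s - t| ≤ ε ^ γ → |w s - w t| ≤ H) :
    |noise ρ γ w ε t| ≤ (ε ^ γ)⁻¹ * (2 * K * H) := by
  have hpos : 0 < (ε ^ γ)⁻¹ := inv_pos.2 (Real.rpow_pos_of_pos hε γ)
  rw [noise_eq hρ hw hε, abs_mul, abs_of_pos hpos]
  gcongr
  exact abs_mollifiedPath_le_of_integral_eq_zero hρ.contDiff_deriv.continuous
    (tsupport_deriv_subset.trans hρ.tsupport_subset)
    (integral_deriv_eq_zero (hρ.smooth.of_le (mod_cast le_top)) hρ.hasCompactSupport) hw hK hε hH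

lemma abs_deriv_noise_le (hρ : IsMollifier ρ) (hw : Continuous w)
    (hK : ∀ x, |deriv (deriv ρ) x| ≤ K) (hε : 0 < ε)
    (hH : ∀ s, |s - t| ≤ ε ^ γ → |w s - w t| ≤ H) :
    |deriv (noise ρ γ w ε) t| ≤ (ε ^ γ)⁻¹ * ((ε ^ γ)⁻¹ * (2 * K * H)) := by
  have hpos : 0 < (ε ^ γ)⁻¹ := inv_pos.2 (Real.rpow_pos_of_pos hε γ)
  rw [(hasDerivAt_noise hρ hw hε t).deriv, abs_mul, abs_mul, abs_of_pos hpos]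
  gcongr
  exact abs_mollifiedPath_le_of_integral_eq_zero (hρ.contDiff_deriv.continuous_deriv le_rfl)
    (tsupport_deriv_subset.trans (tsupport_deriv_subset.trans hρ.tsupport_subset))
    (integral_deriv_eq_zero hρ.contDiff_deriv hρ.hasCompactSupport.deriv) hw hK hε hH

/-- The bounds on a family of forcings `ξ ε` under which the barriers work: as `ε` tends to zero,
`ε ξ^ε` tends to zero and `ε ∂ₜ ξ^ε` stays bounded, uniformly on bounded time intervals. -/
structure IsSlowForcing (ξ : ℝ → ℝ → ℝ) : Prop where
  differentiable : ∀ᶠ ε in 𝓝[>] 0, Differentiable ℝ (ξ ε)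
  tendsto : ∀ T, TendstoUniformlyOn (fun ε t => ε * ξ ε t) 0 (𝓝[>] 0) (Icc 0 T)
  deriv_bounded : ∀ T, ∃ C, ∀ᶠ ε in 𝓝[>] 0, ∀ t ∈ Icc 0 T, |ε * deriv (ξ ε) t| ≤ C

lemma tendsto_rpow_nhdsGT_zero {p : ℝ} (hp : 0 < p) :
    Tendsto (fun ε : ℝ => ε ^ p) (𝓝[>] 0) (𝓝 0) := by
  have hcont := (Real.continuousAt_rpow_const 0 p (Or.inr hp.le)).tendsto
  rw [Real.zero_rpow hp.ne'] at hcont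
  exact hcont.mono_left nhdsWithin_le_nhds

lemma eventually_abs_sub_le_of_holderOnWith {C α : ℝ≥0} {T : ℝ}
    (hC : HolderOnWith C α w (Icc (-(T + 1)) (T + 1))) (hγ : 0 < γ) :
    ∀ᶠ ε in 𝓝[>] (0 : ℝ), ∀ t ∈ Icc 0 T, ∀ s, |s - t| ≤ ε ^ γ →
      |w s - w t| ≤ C * (ε ^ γ) ^ (α : ℝ) := by
  filter_upwards [(tendsto_rpow_nhdsGT_zero hγ).eventually (gt_mem_nhds one_pos)]
    with ε hε t ht s hs
  have hs' := abs_le.1 hs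
  exact hC.dist_le_of_le ⟨by linarith [ht.1, ht.2], by linarith [ht.2]⟩
    ⟨by linarith [ht.1, ht.2], by linarith [ht.2]⟩ hs

lemma mul_inv_rpow_mul_inv_rpow_mul_rpow_rpow (hε : 0 < ε) (γ α : ℝ) :
    ε * ((ε ^ γ)⁻¹ * ((ε ^ γ)⁻¹ * (ε ^ γ) ^ α)) = ε ^ (1 + γ * (α - 2)) := by
  rw [← Real.rpow_neg hε.le, ← Real.rpow_mul hε.le, ← Real.rpow_add hε, ← Real.rpow_add hε,
    mul_comm, ← Real.rpow_add_one hε.ne']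
  ring_nf

theorem isSlowForcing_noise (hρ : IsMollifier ρ) (hw : Continuous w) {α : ℝ≥0}
    (hHolder : ∀ T, ∃ C, HolderOnWith C α w (Icc (-T) T)) (hγ : 0 < γ)
    (hαγ : 0 ≤ 1 + γ * (α - 2)) : IsSlowForcing (noise ρ γ w) := by
  obtain ⟨K, hK₁, hK₂⟩ := hρ.exists_deriv_bounds
  have hK₀ : 0 ≤ K := (abs_nonneg _).trans (hK₁ 0)
  have hpow : ∀ᶠ ε in 𝓝[>] (0 : ℝ), ε * ((ε ^ γ)⁻¹ * ((ε ^ γ)⁻¹ * (ε ^ γ) ^ (α : ℝ))) ≤ 1 := by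
    filter_upwards [Ioc_mem_nhdsGT one_pos] with ε hε
    rw [mul_inv_rpow_mul_inv_rpow_mul_rpow_rpow hε.1]
    exact Real.rpow_le_one hε.1.le hε.2 hαγ
  refine ⟨?_, fun T => ?_, fun T => ?_⟩
  · filter_upwards [self_mem_nhdsWithin] with ε hε t
    exact (hasDerivAt_noise hρ hw hε t).differentiableAt
  · obtain ⟨C, hC⟩ := hHolder (T + 1)
    have hlim : Tendsto (fun ε : ℝ => 2 * K * C * ε ^ γ) (𝓝[>] 0) (𝓝 0) := by
      simpa only [mul_zero] using (tendsto_rpow_nhdsGT_zero hγ).const_mul (2 * K * C)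
    refine Metric.tendstoUniformlyOn_iff.2 fun b hb => ?_
    filter_upwards [self_mem_nhdsWithin, hpow, hlim.eventually (gt_mem_nhds hb),
      eventually_abs_sub_le_of_holderOnWith hC hγ] with ε (hε : 0 < ε) hle hlt hosc t ht
    have _hpos : 0 < ε ^ γ := Real.rpow_pos_of_pos hε γ
    rw [Pi.zero_apply, dist_zero_left, Real.norm_eq_abs, abs_mul, abs_of_pos hε]
    refine lt_of_le_of_lt ?_ hlt
    calc ε * |noise ρ γ w ε t|
        ≤ ε * ((ε ^ γ)⁻¹ * (2 * K * (C * (ε ^ γ) ^ (α : ℝ)))) := by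
          gcongr
          exact abs_noise_le hρ hw hK₁ hε (hosc t ht)
      _ = 2 * K * C * ε ^ γ * (ε * ((ε ^ γ)⁻¹ * ((ε ^ γ)⁻¹ * (ε ^ γ) ^ (α : ℝ)))) := by field_simp
      _ ≤ 2 * K * C * ε ^ γ := mul_le_of_le_one_right (by positivity) hle
  · obtain ⟨C, hC⟩ := hHolder (T + 1)
    refine ⟨2 * K * C, ?_⟩
    filter_upwards [self_mem_nhdsWithin, hpow, eventually_abs_sub_le_of_holderOnWith hC hγ]
      with ε (hε : 0 < ε) hle hosc t ht
    rw [abs_mul, abs_of_pos hε]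
    calc ε * |deriv (noise ρ γ w ε) t|
        ≤ ε * ((ε ^ γ)⁻¹ * ((ε ^ γ)⁻¹ * (2 * K * (C * (ε ^ γ) ^ (α : ℝ))))) := by
          gcongr
          exact abs_deriv_noise_le hρ hw hK₂ hε (hosc t ht)
      _ = 2 * K * C * (ε * ((ε ^ γ)⁻¹ * ((ε ^ γ)⁻¹ * (ε ^ γ) ^ (α : ℝ)))) := by ring
      _ ≤ 2 * K * C := mul_le_of_le_one_right (by positivity) hle

theorem ae_isSlowForcing_noise {Ω : Type*} [MeasurableSpace Ω] {P : Measure Ω}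
    {B B' : ℝ≥0 → Ω → ℝ} (hB : IsBrownianReal B P) (hB' : IsBrownianReal B' P)
    (hρ : IsMollifier ρ) (hγ : 0 < γ) (hγ' : γ < 2 / 3) :
    ∀ᵐ ω ∂P, IsSlowForcing (noise ρ γ (twoSided B B' · ω)) := by
  -- The time derivative costs `ε ^ (-2 γ)` and a Hölder exponent `α` gains `ε ^ (α γ)`:
  -- `α < 1 / 2` can compensate the excess over `ε⁻¹` exactly if `γ < 2 / 3`.
  obtain ⟨α, hα, hα', hαγ⟩ :
      ∃ α : ℝ≥0, 0 < α ∧ (α : ℝ) < 1 / 2 ∧ 0 ≤ 1 + γ * ((α : ℝ) - 2) := by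
    have hγinv : 3 / 2 < 1 / γ := by rw [lt_div_iff₀ hγ]; linarith
    refine ⟨NNReal.mk (max (1 / 4) (2 - 1 / γ)) (by positivity), ?_,
      max_lt (by norm_num) (by linarith), ?_⟩
    · exact NNReal.coe_pos.1 (lt_max_of_lt_left (by norm_num))
    · have hle : γ * (2 - 1 / γ) ≤ γ * max (1 / 4) (2 - 1 / γ) := by
        gcongr
        exact le_max_right _ _
      have hcancel : γ * (2 - 1 / γ) = 2 * γ - 1 := by field_simp
      rw [NNReal.coe_mk]
      linarith
  filter_upwards [ae_continuous_and_exists_holderOnWith_twoSided hB hB' hα hα'] with ω hω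
  exact isSlowForcing_noise hρ hω.1 hω.2 hγ hαγ

end Noise

/-! ### One-dimensional maximum principles -/

lemma deriv_deriv_nonpos_of_isLocalMax {w : ℝ → ℝ} {x : ℝ} (h : IsLocalMax w x)
    (hc : ContinuousAt w x) : deriv (deriv w) x ≤ 0 := by
  by_contra! hpos
  have hmin : IsLocalMin w x := isLocalMin_of_deriv_deriv_pos hpos h.deriv_eq_zero hc
  have hconst : w =ᶠ[𝓝 x] fun _ => w x := by
    filter_upwards [h, hmin] with y hle hge using le_antisymm hle hge
  have hzero := hconst.deriv.deriv_eq
  simp only [deriv_const'] at hzero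
  exact hpos.ne' hzero

lemma nonpos_of_tendsto_atTop {w w' w'' : ℝ → ℝ} {X l : ℝ} (hw : ∀ x, HasDerivAt w (w' x) x)
    (hw' : ∀ x, HasDerivAt w' (w'' x) x) (hlim : Tendsto w atTop (𝓝 l)) (hl : l ≤ 0)
    (hX : w X ≤ 0) (hpos : ∀ x > X, 0 < w x → w' x = 0 → 0 < w'' x) {x : ℝ} (hx : X ≤ x) :
    w x ≤ 0 := by
  by_contra! hwx
  have hcont : Continuous w := continuous_iff_continuousAt.2 fun y => (hw y).continuousAt
  obtain ⟨R, hR⟩ := eventually_atTop.1 (hlim.eventually (gt_mem_nhds (hl.trans_lt hwx)))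
  obtain ⟨z, hz, hmax⟩ := isCompact_Icc.exists_isMaxOn
    (nonempty_Icc.2 (le_max_left X (max R x))) hcont.continuousOn
  have hxz : w x ≤ w z := hmax ⟨hx, (le_max_right _ _).trans (le_max_right _ _)⟩
  have hXz : X < z := hz.1.lt_of_ne fun h => by linarith [h ▸ hxz]
  have hloc : IsLocalMax w z := by
    filter_upwards [lt_mem_nhds hXz] with y hy
    rcases le_or_gt y (max X (max R x)) with hyR | hyR
    · exact hmax ⟨hy.le, hyR⟩
    · exact (hR y (((le_max_left _ _).trans (le_max_right _ _)).trans hyR.le)).le.trans hxz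
  have hsecond := deriv_deriv_nonpos_of_isLocalMax hloc hcont.continuousAt
  rw [funext fun y => (hw y).deriv, (hw' z).deriv] at hsecond
  exact hsecond.not_gt (hpos z hXz (hwx.trans_le hxz) (hloc.hasDerivAt_eq_zero (hw z)))

/-! ### The tail of a travelling wave -/

lemma f_sub_f (a b : ℝ) : f a - f b = (b - a) * (a ^ 2 + a * b + b ^ 2 - 1) := by
  simp only [f]
  ring

lemma sub_le_f_sub_f {a b : ℝ} (ha : 9 / 10 ≤ a) (hab : a ≤ b) : b - a ≤ f a - f b := by
  rw [f_sub_f]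
  exact le_mul_of_one_le_right (sub_nonneg.2 hab) (by nlinarith)

lemma f_sub_f_le {a b : ℝ} (ha : 0 ≤ a) (hab : a ≤ b) (hb : b ≤ 11 / 10) :
    f a - f b ≤ 3 * (b - a) := by
  rw [f_sub_f, mul_comm]
  exact mul_le_mul_of_nonneg_right (by nlinarith) (sub_nonneg.2 hab)

/-- `μ` is an increasing travelling wave of speed `c` for the reaction term `f + δ`, with limit
`μtop` at `+∞`, which on `[X, ∞)` takes values in `[9 / 10, 11 / 10]`, where `-3 ≤ f' ≤ -1`. -/
structure IsWaveTail (c δ μtop X : ℝ) (μ : ℝ → ℝ) : Prop where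
  contDiff : ContDiff ℝ 2 μ
  monotone : Monotone μ
  ode : ∀ x, deriv (deriv μ) x + c * deriv μ x + (f (μ x) + δ) = 0
  tendsto : Tendsto μ atTop (𝓝 μtop)
  root : f μtop + δ = 0
  ge : 9 / 10 ≤ μ X
  limit_le : μtop ≤ 11 / 10

namespace IsWaveTail

variable {c c' δ δ' μtop νtop X C x : ℝ} {μ ν : ℝ → ℝ}

lemma hasDerivAt (hμ : IsWaveTail c δ μtop X μ) (x : ℝ) : HasDerivAt μ (deriv μ x) x :=
  (hμ.contDiff.differentiable two_ne_zero x).hasDerivAt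

lemma hasDerivAt_deriv (hμ : IsWaveTail c δ μtop X μ) (x : ℝ) :
    HasDerivAt (deriv μ) (deriv (deriv μ) x) x :=
  (hμ.contDiff.differentiable_deriv_two x).hasDerivAt

lemma le_limit (hμ : IsWaveTail c δ μtop X μ) (x : ℝ) : μ x ≤ μtop :=
  hμ.monotone.ge_of_tendsto hμ.tendsto x

lemma le_of_le (hμ : IsWaveTail c δ μtop X μ) (hx : X ≤ x) : 9 / 10 ≤ μ x :=
  hμ.ge.trans (hμ.monotone hx)

lemma reaction_bounds (hμ : IsWaveTail c δ μtop X μ) (hx : X ≤ x) :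
    μtop - μ x ≤ f (μ x) + δ ∧ f (μ x) + δ ≤ 3 * (μtop - μ x) := by
  have hlower := sub_le_f_sub_f (hμ.le_of_le hx) (hμ.le_limit x)
  have hupper := f_sub_f_le (by linarith [hμ.le_of_le hx]) (hμ.le_limit x) hμ.limit_le
  constructor <;> linarith [hμ.root]

-- `exp (-l (x - X))` is a supersolution of the equation of `μtop - μ` for such `l`.
lemma limit_sub_le (hμ : IsWaveTail c δ μtop X μ) {l : ℝ} (hl : 0 < l) (hl' : l ^ 2 ≤ 1 + c * l)
    (hx : X ≤ x) : μtop - μ x ≤ Real.exp (-l * (x - X)) := by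
  have hexp : ∀ y, HasDerivAt (fun y => Real.exp (-l * (y - X))) (-l * Real.exp (-l * (y - X))) y :=
    fun y => by
      simpa only [id, mul_one, mul_comm] using! (((hasDerivAt_id y).sub_const X).const_mul (-l)).exp
  have hexp_lim : Tendsto (fun y => Real.exp (-l * (y - X))) atTop (𝓝 0) :=
    Real.tendsto_exp_atBot.comp
      ((tendsto_atTop_add_const_right _ (-X) tendsto_id).const_mul_atTop_of_neg (neg_lt_zero.2 hl))
  refine sub_nonpos.1 (nonpos_of_tendsto_atTop
    (fun y => ((hμ.hasDerivAt y).const_sub μtop).sub (hexp y))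
    (fun y => (hμ.hasDerivAt_deriv y).neg.sub ((hexp y).const_mul (-l)))
    (by simpa only [sub_self] using! (hμ.tendsto.const_sub μtop).sub hexp_lim) le_rfl ?_ ?_ hx)
  · rw [Pi.sub_apply, sub_self, mul_zero, Real.exp_zero]
    linarith [hμ.ge, hμ.limit_le]
  · intro y hy hpos hcrit
    have hexp_pos := Real.exp_pos (-l * (y - X))
    have hreac := (hμ.reaction_bounds (le_of_lt hy)).1
    have hderiv : deriv μ y = l * Real.exp (-l * (y - X)) := by linarith
    have hode := hμ.ode y
    rw [hderiv] at hode
    rw [Pi.sub_apply, sub_pos] at hpos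
    nlinarith

lemma deriv_le (hμ : IsWaveTail c δ μtop X μ) (hx : X ≤ x) :
    deriv μ x ≤ (4 + |c|) * (μtop - μ x) := by
  obtain ⟨s, hs, hslope⟩ := exists_hasDerivAt_eq_slope μ _ (lt_add_one x)
    (fun y _ => (hμ.hasDerivAt y).continuousAt.continuousWithinAt) fun y _ => hμ.hasDerivAt y
  have hfirst : ∀ y, HasDerivAt (fun y => deriv μ y + c * μ y) (-(f (μ y) + δ)) y := fun y =>
    ((hμ.hasDerivAt_deriv y).add ((hμ.hasDerivAt y).const_mul c)).congr_deriv
      (by linarith [hμ.ode y])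
  obtain ⟨z, hz, hslope'⟩ := exists_hasDerivAt_eq_slope _ _ hs.1
    (fun y _ => (hfirst y).continuousAt.continuousWithinAt) fun y _ => hfirst y
  rw [eq_div_iff (sub_pos.2 hs.1).ne'] at hslope'
  have hsmall : deriv μ s ≤ μtop - μ x := by
    rw [hslope, add_sub_cancel_left, div_one]
    exact sub_le_sub_right (hμ.le_limit _) _
  have hdrift : c * (μ s - μ x) ≤ |c| * (μtop - μ x) :=
    mul_le_mul (le_abs_self c) (sub_le_sub_right (hμ.le_limit s) _)
      (sub_nonneg.2 (hμ.monotone hs.1.le)) (abs_nonneg c)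
  have hreac := hμ.reaction_bounds (hx.trans hz.1.le)
  have hreac_le : (f (μ z) + δ) * (s - x) ≤ 3 * (μtop - μ x) := by
    have hz_le : f (μ z) + δ ≤ 3 * (μtop - μ x) := by linarith [hμ.monotone hz.1.le]
    nlinarith [hs.1, hs.2, hreac.1, hμ.le_limit z]
  linarith

lemma abs_deriv_deriv_le (hμ : IsWaveTail c δ μtop X μ) (hx : X ≤ x) :
    |deriv (deriv μ) x| ≤ (2 + |c|) ^ 2 * (μtop - μ x) := by
  have hreac := hμ.reaction_bounds hx
  have hgap := sub_nonneg.2 (hμ.le_limit x)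
  calc |deriv (deriv μ) x| = |c * deriv μ x + (f (μ x) + δ)| := by
        rw [← abs_neg, eq_neg_of_add_eq_zero_right ((add_assoc _ _ _).symm.trans (hμ.ode x))]
    _ ≤ |c * deriv μ x| + |f (μ x) + δ| := abs_add_le _ _
    _ ≤ |c| * ((4 + |c|) * (μtop - μ x)) + 3 * (μtop - μ x) := by
        rw [abs_mul, abs_of_nonneg hμ.monotone.deriv_nonneg, abs_of_nonneg (hgap.trans hreac.1)]
        gcongr
        exacts [hμ.deriv_le hx, hreac.2]
    _ ≤ (2 + |c|) ^ 2 * (μtop - μ x) := by linarith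

lemma sub_le (hμ : IsWaveTail c δ μtop X μ) (hν : IsWaveTail c' δ' νtop X ν) {S b : ℝ}
    (hS : ∀ x ≥ X, deriv ν x ≤ S) (hb : |c' - c| * S + |δ' - δ| ≤ b) (hX : ν X - μ X ≤ b)
    (hx : X ≤ x) : ν x - μ x ≤ b := by
  have hS₀ : 0 ≤ S := hν.monotone.deriv_nonneg.trans (hS X le_rfl)
  have hδb : δ' - δ ≤ b := by linarith [le_abs_self (δ' - δ), mul_nonneg (abs_nonneg (c' - c)) hS₀]
  have hb₀ : 0 ≤ b := hb.trans' (by positivity)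
  have hlim : νtop - μtop ≤ b := by
    rcases le_total νtop μtop with h | h
    · linarith
    · linarith [sub_le_f_sub_f (hμ.ge.trans (hμ.le_limit X)) h, hμ.root, hν.root]
  refine sub_nonpos.1 (nonpos_of_tendsto_atTop
    (fun y => ((hν.hasDerivAt y).sub (hμ.hasDerivAt y)).sub_const b)
    (fun y => (hν.hasDerivAt_deriv y).sub (hμ.hasDerivAt_deriv y))
    ((hν.tendsto.sub hμ.tendsto).sub_const b) (sub_nonpos.2 hlim) (sub_nonpos.2 hX) ?_ hx)
  intro y hy hpos hcrit
  rw [Pi.sub_apply, sub_pos] at hpos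
  have hreac := sub_le_f_sub_f (hμ.le_of_le (le_of_lt hy)) (show μ y ≤ ν y by linarith)
  have hspeed : (c' - c) * deriv ν y ≤ |c' - c| * S :=
    mul_le_mul (le_abs_self _) (hS y (le_of_lt hy)) hν.monotone.deriv_nonneg (abs_nonneg _)
  have hμode := hμ.ode y
  rw [← sub_eq_zero.1 hcrit] at hμode
  linarith [hν.ode y, le_abs_self (δ' - δ)]

end IsWaveTail

/-! ### Uniform bounds for the travelling waves -/

open scoped ContDiff

lemma contDiffAt_deriv_of_uncurry {E : Type*} [NormedAddCommGroup E] [NormedSpace ℝ E]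
    {F : E → ℝ → ℝ} {g : E → ℝ} {p : E} {j k : WithTop ℕ∞}
    (hF : ContDiffAt ℝ k (Function.uncurry F) (p, g p)) (hg : ContDiffAt ℝ j g p)
    (hjk : j + 1 ≤ k) : ContDiffAt ℝ j (fun q => deriv (F q) (g q)) p :=
  (hF.fderiv hg hjk).clm_apply contDiffAt_const

lemma IsWaveTail.lipschitzOnWith {c μtop : ℝ → ℝ} {m : ℝ → ℝ → ℝ} {X : ℝ} {U : Set ℝ}
    {S Kc Km : ℝ≥0} (h : ∀ δ ∈ U, IsWaveTail (c δ) δ (μtop δ) X fun x => m x δ)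
    (hS : ∀ δ ∈ U, ∀ x ≥ X, deriv (fun y => m y δ) x ≤ S) (hc : LipschitzOnWith Kc c U)
    (hm : LipschitzOnWith Km (m X) U) {x : ℝ} (hx : X ≤ x) :
    LipschitzOnWith (Kc * S + 1 + Km) (m x) U := by
  refine LipschitzOnWith.of_le_add_mul _ fun δ hδ δ' hδ' => ?_
  have hspeed := mul_le_mul_of_nonneg_right (hc.dist_le_mul δ hδ δ' hδ') S.coe_nonneg
  have hstart := (le_abs_self _).trans (hm.dist_le_mul δ hδ δ' hδ')
  have hS_nonneg := mul_nonneg (mul_nonneg Kc.coe_nonneg (dist_nonneg (x := δ) (y := δ')))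
    S.coe_nonneg
  have hKm_nonneg := mul_nonneg Km.coe_nonneg (dist_nonneg (x := δ) (y := δ'))
  rw [Real.dist_eq (c δ)] at hspeed
  refine sub_le_iff_le_add'.1 ((h δ' hδ').sub_le (h δ hδ) (hS δ hδ) ?_ ?_ hx)
  · rw [← Real.dist_eq δ]
    push_cast
    linarith
  · push_cast
    linarith [dist_nonneg (x := δ) (y := δ')]

lemma IsWaveTail.eventually_abs_deriv_parameter_le {c μtop : ℝ → ℝ} {m : ℝ → ℝ → ℝ} {X δ₁ : ℝ}
    (h : ∀ᶠ δ in 𝓝 δ₁, IsWaveTail (c δ) δ (μtop δ) X fun x => m x δ) (hc : ContDiffAt ℝ 1 c δ₁)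
    (hm : ContDiffAt ℝ 1 (m X) δ₁) : ∃ K, ∀ᶠ δ in 𝓝 δ₁, ∀ x ≥ X, |deriv (m x) δ| ≤ K := by
  obtain ⟨Kc, s, hs, hclip⟩ := hc.exists_lipschitzOnWith
  obtain ⟨Km, s', hs', hmlip⟩ := hm.exists_lipschitzOnWith
  have hslope : ∀ᶠ δ in 𝓝 δ₁, ∀ x ≥ X, deriv (fun y => m y δ) x ≤ (5 + ‖c δ₁‖₊ : ℝ≥0) := by
    filter_upwards [h, hc.continuousAt.norm.eventually (gt_mem_nhds (lt_add_one ‖c δ₁‖))]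
      with δ hδ hcδ x hx
    have hgap : μtop δ - m x δ ≤ 1 := by linarith [hδ.limit_le, hδ.le_of_le hx]
    have hgap_le := mul_le_of_le_one_right (by positivity : 0 ≤ 4 + |c δ|) hgap
    simp only [Real.norm_eq_abs] at hcδ
    rw [NNReal.coe_add, coe_nnnorm, NNReal.coe_ofNat, Real.norm_eq_abs]
    linarith [hδ.deriv_le hx]
  obtain ⟨U, hU, hgood⟩ := ((h.and hslope).and (inter_mem hs hs')).exists_mem
  refine ⟨_, (eventually_mem_nhds_iff.2 hU).mono fun δ hδ x hx => norm_deriv_le_of_lipschitzOn hδ <|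
    lipschitzOnWith (fun δ' hδ' => (hgood δ' hδ').1.1) (fun δ' hδ' => (hgood δ' hδ').1.2)
      (hclip.mono fun δ' hδ' => (hgood δ' hδ').2.1)
      (hmlip.mono fun δ' hδ' => (hgood δ' hδ').2.2) hx⟩

/-- Bounds for the partial derivatives of the family of profiles `m` at the point `x` and the
parameter `δ`, with exponential decay of rate `l` for those in the space variable. -/
structure IsWaveBound (m : ℝ → ℝ → ℝ) (A l x δ : ℝ) : Prop where
  deriv_le : |deriv (fun y => m y δ) x| ≤ A * Real.exp (-l * |x|)
  deriv_deriv_le : |deriv (deriv fun y => m y δ) x| ≤ A * Real.exp (-l * |x|)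
  deriv_parameter_le : |deriv (m x) δ| ≤ A

lemma IsWaveBound.mono {m : ℝ → ℝ → ℝ} {A A' l l' x δ : ℝ} (h : IsWaveBound m A l x δ)
    (hA : A ≤ A') (hl : l' ≤ l) : IsWaveBound m A' l' x δ := by
  have hA₀ : 0 ≤ A := (abs_nonneg _).trans h.deriv_parameter_le
  have hexp : A * Real.exp (-l * |x|) ≤ A' * Real.exp (-l' * |x|) := by
    gcongr
    exact hA₀.trans hA
  exact ⟨h.deriv_le.trans hexp, h.deriv_deriv_le.trans hexp, h.deriv_parameter_le.trans hA⟩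

lemma IsWaveTail.isWaveBound {c δ μtop X C K x : ℝ} {m : ℝ → ℝ → ℝ}
    (hm : IsWaveTail c δ μtop X fun y => m y δ) (hc : |c| ≤ C) (hK : |deriv (m x) δ| ≤ K)
    (hX : X ≤ x) (hx : 0 ≤ x) :
    IsWaveBound m ((2 + C) ^ 2 * Real.exp ((1 + C)⁻¹ * X) + K) (1 + C)⁻¹ x δ := by
  have hC : 0 ≤ C := (abs_nonneg c).trans hc
  have hK₀ : 0 ≤ K := (abs_nonneg _).trans hK
  set l := (1 + C)⁻¹
  have hl₀ : 0 < l := by positivity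
  have hl₁ : l * (1 + C) = 1 := inv_mul_cancel₀ (by positivity)
  have hrate : l ^ 2 ≤ 1 + c * l := by nlinarith [neg_abs_le c]
  have hgap : μtop - m x δ ≤ Real.exp (l * X) * Real.exp (-l * |x|) := by
    rw [← Real.exp_add, abs_of_nonneg hx]
    exact (hm.limit_sub_le hl₀ hrate hX).trans_eq (congrArg Real.exp (by ring))
  have hgap_mul : (2 + C) ^ 2 * (μtop - m x δ) ≤
      ((2 + C) ^ 2 * Real.exp (l * X) + K) * Real.exp (-l * |x|) := by
    rw [add_mul, mul_assoc]
    exact le_add_of_le_of_nonneg (by gcongr) (by positivity)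
  have hgap₀ : 0 ≤ μtop - m x δ := sub_nonneg.2 (hm.le_limit x)
  refine ⟨?_, ?_, hK.trans (le_add_of_nonneg_left (by positivity))⟩
  · rw [abs_of_nonneg hm.monotone.deriv_nonneg]
    exact (hm.deriv_le hX).trans (hgap_mul.trans' (by gcongr; nlinarith))
  · exact (hm.abs_deriv_deriv_le hX).trans (hgap_mul.trans' (by gcongr))

namespace IsTravellingWave

variable {δ₀ δ : ℝ} {mMinus mPlus : ℝ → ℝ} {m : ℝ → ℝ → ℝ} {c : ℝ → ℝ}

lemma zero_mem (hm : IsTravellingWave δ₀ mMinus mPlus m c) : (0 : ℝ) ∈ Ioo (-δ₀) δ₀ :=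
  ⟨neg_lt_zero.2 hm.pos, hm.pos⟩

lemma contDiffAt (hm : IsTravellingWave δ₀ mMinus mPlus m c) (hδ : δ ∈ Ioo (-δ₀) δ₀) (x : ℝ) :
    ContDiffAt ℝ ∞ (fun q : ℝ × ℝ => m q.1 q.2) (x, δ) :=
  hm.smooth.contDiffAt (prod_mem_nhds univ_mem (Icc_mem_nhds hδ.1 hδ.2))

lemma contDiff_profile (hm : IsTravellingWave δ₀ mMinus mPlus m c) (hδ : δ ∈ Ioo (-δ₀) δ₀) :
    ContDiff ℝ ∞ fun x => m x δ :=
  contDiff_iff_contDiffAt.2 fun x =>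
    (hm.contDiffAt hδ x).comp x (contDiffAt_id.prodMk contDiffAt_const)

lemma contDiffAt_parameter (hm : IsTravellingWave δ₀ mMinus mPlus m c) (hδ : δ ∈ Ioo (-δ₀) δ₀)
    (x : ℝ) : ContDiffAt ℝ ∞ (m x) δ :=
  (hm.contDiffAt hδ x).comp δ (contDiffAt_const.prodMk contDiffAt_id)

lemma contDiffAt_deriv (hm : IsTravellingWave δ₀ mMinus mPlus m c) (hδ : δ ∈ Ioo (-δ₀) δ₀)
    (x : ℝ) : ContDiffAt ℝ ∞ (fun q : ℝ × ℝ => deriv (fun y => m y q.2) q.1) (x, δ) :=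
  contDiffAt_deriv_of_uncurry
    ((hm.contDiffAt hδ x).comp (((x, δ), x) : (ℝ × ℝ) × ℝ)
      (contDiffAt_snd.prodMk contDiffAt_fst.snd)) contDiffAt_fst le_rfl

lemma contDiffAt_deriv_deriv (hm : IsTravellingWave δ₀ mMinus mPlus m c) (hδ : δ ∈ Ioo (-δ₀) δ₀)
    (x : ℝ) : ContDiffAt ℝ ∞ (fun q : ℝ × ℝ => deriv (deriv fun y => m y q.2) q.1) (x, δ) :=
  contDiffAt_deriv_of_uncurry
    ((hm.contDiffAt_deriv hδ x).comp (((x, δ), x) : (ℝ × ℝ) × ℝ)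
      (contDiffAt_snd.prodMk contDiffAt_fst.snd)) contDiffAt_fst le_rfl

lemma contDiffAt_deriv_parameter (hm : IsTravellingWave δ₀ mMinus mPlus m c)
    (hδ : δ ∈ Ioo (-δ₀) δ₀) (x : ℝ) :
    ContDiffAt ℝ ∞ (fun q : ℝ × ℝ => deriv (m q.1) q.2) (x, δ) :=
  contDiffAt_deriv_of_uncurry
    ((hm.contDiffAt hδ x).comp (((x, δ), δ) : (ℝ × ℝ) × ℝ)
      (contDiffAt_fst.fst.prodMk contDiffAt_snd)) contDiffAt_snd le_rfl

lemma exists_deriv_pos (hm : IsTravellingWave δ₀ mMinus mPlus m c) (hδ : δ ∈ Ioo (-δ₀) δ₀) :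
    ∃ x, 0 < deriv (fun y => m y δ) x := by
  have hmono := hm.increasing δ (Ioo_subset_Icc_self hδ)
  by_contra! h
  have hconst := is_const_of_deriv_eq_zero
    ((hm.contDiff_profile hδ).differentiable (by decide))
    (fun x => le_antisymm (h x) hmono.monotone.deriv_nonneg) 0 1
  exact (hmono one_pos).ne hconst

-- Solving the equation of the wave for `c`, at a point where `∂ₓ m ≠ 0`.
lemma contDiffAt_speed (hm : IsTravellingWave δ₀ mMinus mPlus m c) (hδ : δ ∈ Ioo (-δ₀) δ₀) :
    ContDiffAt ℝ ∞ c δ := by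
  obtain ⟨x, hx⟩ := hm.exists_deriv_pos hδ
  have hpair : ContDiffAt ℝ ∞ (fun s : ℝ => (x, s)) δ := contDiffAt_const.prodMk contDiffAt_id
  have hderiv : ContDiffAt ℝ ∞ (fun s => deriv (fun y => m y s) x) δ :=
    (hm.contDiffAt_deriv hδ x).comp δ hpair
  have hderiv₂ : ContDiffAt ℝ ∞ (fun s => deriv (deriv fun y => m y s) x) δ :=
    (hm.contDiffAt_deriv_deriv hδ x).comp δ hpair
  have hreac : ContDiffAt ℝ ∞ (fun s => f (m x s) + s) δ :=
    ((contDiff_id.sub (contDiff_id.pow 3)).contDiffAt.comp δ (hm.contDiffAt_parameter hδ x)).add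
      contDiffAt_id
  refine ((hderiv₂.add hreac).neg.div hderiv hx.ne').congr_of_eventuallyEq ?_
  filter_upwards [Ioo_mem_nhds hδ.1 hδ.2, hderiv.continuousAt.eventually (lt_mem_nhds hx)]
    with s hs hpos
  refine eq_div_of_mul_eq hpos.ne' (eq_neg_of_add_eq_zero_right ?_)
  rw [← hm.ode s (Ioo_subset_Icc_self hs) x]
  exact add_right_comm _ _ _

lemma deriv_reflect (m : ℝ → ℝ → ℝ) (δ x : ℝ) :
    deriv (fun y => -m (-y) (-δ)) x = deriv (fun y => m y (-δ)) (-x) := by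
  rw [deriv.fun_neg, deriv_comp_neg (fun y => m y (-δ)), neg_neg]

lemma deriv_deriv_reflect (m : ℝ → ℝ → ℝ) (δ x : ℝ) :
    deriv (deriv fun y => -m (-y) (-δ)) x = -deriv (deriv fun y => m y (-δ)) (-x) := by
  rw [funext (deriv_reflect m δ), deriv_comp_neg (deriv fun y => m y (-δ))]

lemma reflect (hm : IsTravellingWave δ₀ mMinus mPlus m c) :
    IsTravellingWave δ₀ (fun δ => -mPlus (-δ)) (fun δ => -mMinus (-δ))
      (fun x δ => -m (-x) (-δ)) (fun δ => -c (-δ)) := by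
  have hneg : ∀ δ ∈ Icc (-δ₀) δ₀, -δ ∈ Icc (-δ₀) δ₀ := fun δ hδ =>
    ⟨neg_le_neg hδ.2, neg_le.1 hδ.1⟩
  have hodd : ∀ u δ, f (-u) + δ = -(f u + -δ) := fun u δ => by simp only [f]; ring
  exact
    { pos := hm.pos
      mMinus_cont := (hm.mPlus_cont.comp continuous_neg.continuousOn hneg).neg
      mPlus_cont := (hm.mMinus_cont.comp continuous_neg.continuousOn hneg).neg
      mMinus_zero := by rw [neg_zero, hm.mPlus_zero]
      mPlus_zero := by rw [neg_zero, hm.mMinus_zero, neg_neg]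
      mMinus_root := fun δ hδ => by rw [hodd, hm.mPlus_root _ (hneg δ hδ), neg_zero]
      mPlus_root := fun δ hδ => by rw [hodd, hm.mMinus_root _ (hneg δ hδ), neg_zero]
      smooth := (hm.smooth.comp (contDiff_fst.neg.prodMk contDiff_snd.neg).contDiffOn
        fun q hq => ⟨mem_univ _, hneg _ hq.2⟩).neg
      increasing := fun δ hδ x y hxy => neg_lt_neg (hm.increasing _ (hneg δ hδ) (neg_lt_neg hxy))
      ode := fun δ hδ x => by
        rw [deriv_deriv_reflect, deriv_reflect, hodd]
        linarith [hm.ode _ (hneg δ hδ) (-x)]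
      tendsto_bot := fun δ hδ =>
        ((hm.tendsto_top _ (hneg δ hδ)).comp tendsto_neg_atBot_atTop).neg
      tendsto_top := fun δ hδ =>
        ((hm.tendsto_bot _ (hneg δ hδ)).comp tendsto_neg_atTop_atBot).neg }

end IsTravellingWave

lemma IsWaveBound.of_reflect {m : ℝ → ℝ → ℝ} {A l x δ : ℝ}
    (h : IsWaveBound (fun x δ => -m (-x) (-δ)) A l (-x) (-δ)) : IsWaveBound m A l x δ where
  deriv_le := by
    have hle := h.deriv_le
    rwa [IsTravellingWave.deriv_reflect, neg_neg, neg_neg, abs_neg] at hle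
  deriv_deriv_le := by
    have hle := h.deriv_deriv_le
    rwa [IsTravellingWave.deriv_deriv_reflect, neg_neg, neg_neg, abs_neg, abs_neg] at hle
  deriv_parameter_le := by
    have hderiv : deriv (fun s => -m x (-s)) (-δ) = deriv (m x) δ := by
      rw [deriv.fun_neg, deriv_comp_neg, neg_neg, neg_neg]
    simpa only [neg_neg, hderiv] using h.deriv_parameter_le

namespace IsTravellingWave

variable {δ₀ δ : ℝ} {mMinus mPlus : ℝ → ℝ} {m : ℝ → ℝ → ℝ} {c : ℝ → ℝ}

lemma eventually_isWaveTail (hm : IsTravellingWave δ₀ mMinus mPlus m c) :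
    ∃ X, ∀ᶠ δ in 𝓝 0, IsWaveTail (c δ) δ (mPlus δ) X fun x => m x δ := by
  have hnhds : Icc (-δ₀) δ₀ ∈ 𝓝 0 := Icc_mem_nhds hm.zero_mem.1 hm.zero_mem.2
  have hlim := hm.mPlus_zero ▸ hm.tendsto_top 0 (Ioo_subset_Icc_self hm.zero_mem)
  obtain ⟨X, hX⟩ := (hlim.eventually (lt_mem_nhds (by norm_num : (9 / 10 : ℝ) < 1))).exists
  have hplus : mPlus 0 < 11 / 10 := by rw [hm.mPlus_zero]; norm_num
  refine ⟨X, ?_⟩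
  filter_upwards [hnhds, Ioo_mem_nhds hm.zero_mem.1 hm.zero_mem.2,
    (hm.contDiffAt_parameter hm.zero_mem X).continuousAt.eventually (lt_mem_nhds hX),
    (hm.mPlus_cont.continuousAt hnhds).eventually (gt_mem_nhds hplus)] with δ hδ hδ' hge hle
  exact ⟨contDiff_infty.1 (hm.contDiff_profile hδ') 2, (hm.increasing δ hδ).monotone,
    hm.ode δ hδ, hm.tendsto_top δ hδ, hm.mPlus_root δ hδ, hge.le, hle.le⟩

lemma exists_isWaveBound_atTop (hm : IsTravellingWave δ₀ mMinus mPlus m c) :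
    ∃ A, ∃ l > 0, ∀ᶠ q in atTop ×ˢ 𝓝 0, IsWaveBound m A l q.1 q.2 := by
  have hspeed := hm.contDiffAt_speed hm.zero_mem
  obtain ⟨X, htail⟩ := hm.eventually_isWaveTail
  obtain ⟨K, hK⟩ := IsWaveTail.eventually_abs_deriv_parameter_le htail
    (hspeed.of_le (mod_cast le_top))
    ((hm.contDiffAt_parameter hm.zero_mem X).of_le (mod_cast le_top))
  have hc : ∀ᶠ δ in 𝓝 0, |c δ| ≤ |c 0| + 1 :=
    (hspeed.continuousAt.abs.eventually (gt_mem_nhds (lt_add_one |c 0|))).mono fun _ => le_of_lt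
  refine ⟨(2 + (|c 0| + 1)) ^ 2 * Real.exp ((1 + (|c 0| + 1))⁻¹ * X) + K, (1 + (|c 0| + 1))⁻¹,
    by positivity, ?_⟩
  filter_upwards [(eventually_ge_atTop (max X 0)).prod_mk (htail.and (hK.and hc))]
    with ⟨x, δ⟩ ⟨hx, hδ, hKδ, hcδ⟩
  exact hδ.isWaveBound hcδ (hKδ x (le_of_max_le_left hx)) (le_of_max_le_left hx)
    (le_of_max_le_right hx)

lemma exists_isWaveBound_cocompact (hm : IsTravellingWave δ₀ mMinus mPlus m c) :
    ∃ A, ∃ l > 0, ∀ᶠ q in cocompact ℝ ×ˢ 𝓝 0, IsWaveBound m A l q.1 q.2 := by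
  obtain ⟨A, l, hl, hright⟩ := hm.exists_isWaveBound_atTop
  obtain ⟨A', l', hl', hleft⟩ := hm.reflect.exists_isWaveBound_atTop
  refine ⟨max A A', min l l', lt_min hl hl', ?_⟩
  rw [cocompact_eq_atBot_atTop, sup_prod, eventually_sup]
  constructor
  · have hneg : Tendsto (fun δ : ℝ => -δ) (𝓝 0) (𝓝 0) := by
      simpa only [neg_zero] using (continuous_neg (G := ℝ)).tendsto 0
    exact ((tendsto_neg_atBot_atTop.prodMap hneg).eventually hleft).mono fun q hq =>
      hq.of_reflect.mono (le_max_right _ _) (min_le_right _ _)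
  · exact hright.mono fun q hq => hq.mono (le_max_left _ _) (min_le_left _ _)

lemma exists_isWaveBound_of_isCompact (hm : IsTravellingWave δ₀ mMinus mPlus m c) (l : ℝ)
    {K : Set ℝ} (hK : IsCompact K) : ∃ A, ∀ᶠ δ in 𝓝 0, ∀ x ∈ K, IsWaveBound m A l x δ := by
  have hδ₀ : 0 < δ₀ / 2 := half_pos hm.pos
  have hmem : ∀ δ ∈ Icc (-(δ₀ / 2)) (δ₀ / 2), δ ∈ Ioo (-δ₀) δ₀ := fun δ hδ =>
    ⟨by linarith [hδ.1], by linarith [hδ.2]⟩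
  have hexp : Continuous fun q : ℝ × ℝ => Real.exp (l * |q.1|) := by fun_prop
  obtain ⟨A, hA⟩ := (hK.prod isCompact_Icc).exists_bound_of_continuousOn
    (f := fun q : ℝ × ℝ => (Real.exp (l * |q.1|) * deriv (fun y => m y q.2) q.1,
      Real.exp (l * |q.1|) * deriv (deriv fun y => m y q.2) q.1, deriv (m q.1) q.2))
    fun q hq => ((hexp.continuousAt.mul (hm.contDiffAt_deriv (hmem _ hq.2) q.1).continuousAt).prodMk
      ((hexp.continuousAt.mul (hm.contDiffAt_deriv_deriv (hmem _ hq.2) q.1).continuousAt).prodMk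
        (hm.contDiffAt_deriv_parameter (hmem _ hq.2) q.1).continuousAt)).continuousWithinAt
  refine ⟨A, ?_⟩
  filter_upwards [Icc_mem_nhds (neg_lt_zero.2 hδ₀) hδ₀] with δ hδ x hx
  have hbound := hA (x, δ) ⟨hx, hδ⟩
  simp only [Prod.norm_def, max_le_iff, norm_mul, Real.norm_eq_abs, Real.abs_exp] at hbound
  refine ⟨?_, ?_, hbound.2.2⟩ <;>
    rw [neg_mul, Real.exp_neg, ← div_eq_mul_inv, le_div_iff₀' (Real.exp_pos _)]
  exacts [hbound.1, hbound.2.1]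

lemma exists_isWaveBound (hm : IsTravellingWave δ₀ mMinus mPlus m c) :
    ∃ A, ∃ l > 0, ∀ᶠ δ in 𝓝 0, |c δ| ≤ A ∧ ∀ x, IsWaveBound m A l x δ := by
  obtain ⟨A, l, hl, htail⟩ := hm.exists_isWaveBound_cocompact
  obtain ⟨s, hs, U, hU, hsU⟩ := mem_prod_iff.1 htail
  obtain ⟨K, hK, hKs⟩ := mem_cocompact.1 hs
  obtain ⟨A', hcompact⟩ := hm.exists_isWaveBound_of_isCompact l hK
  have hc := (hm.contDiffAt_speed hm.zero_mem).continuousAt.abs.eventually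
    (gt_mem_nhds (lt_add_one |c 0|))
  refine ⟨max (|c 0| + 1) (max A A'), l, hl, ?_⟩
  filter_upwards [hU, hcompact, hc] with δ hδU hδ hcδ
  refine ⟨hcδ.le.trans (le_max_left _ _), fun x => ?_⟩
  by_cases hx : x ∈ K
  · exact (hδ x hx).mono ((le_max_right _ _).trans (le_max_right _ _)) le_rfl
  · exact (hsU (mk_mem_prod (hKs hx) hδU)).mono ((le_max_left _ _).trans (le_max_right _ _)) le_rfl

end IsTravellingWave

/-! ### The signed distance -/

lemma inter_frontier_nonempty_of_isPreconnected {X : Type*} [TopologicalSpace X] {s A : Set X}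
    (hs : IsPreconnected s) {x y : X} (hxs : x ∈ s) (hxA : x ∈ A) (hys : y ∈ s) (hyA : y ∉ A) :
    (s ∩ frontier A).Nonempty := by
  by_contra! hdisj
  have hcover : s ⊆ interior A ∪ (closure A)ᶜ := fun z hz => by
    by_contra hz'
    rw [mem_union, not_or, notMem_compl_iff] at hz'
    exact hdisj.subset ⟨hz, hz'.2, hz'.1⟩
  have hxi : x ∈ interior A := (hcover hxs).resolve_right fun h => h (subset_closure hxA)
  have hye : y ∈ (closure A)ᶜ := (hcover hys).resolve_left fun h => hyA (interior_subset h)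
  obtain ⟨z, -, hzi, hze⟩ := hs _ _ isOpen_interior isClosed_closure.isOpen_compl hcover
    ⟨x, hxs, hxi⟩ ⟨y, hys, hye⟩
  exact hze (subset_closure (interior_subset hzi))

lemma infDist_frontier_add_infDist_frontier_le {E : Type*} [SeminormedAddCommGroup E]
    [NormedSpace ℝ E] {A : Set E} {x y : E} (hx : x ∈ A) (hy : y ∉ A) :
    Metric.infDist x (frontier A) + Metric.infDist y (frontier A) ≤ dist x y := by
  obtain ⟨z, hz, hzA⟩ := inter_frontier_nonempty_of_isPreconnected
    (convex_segment x y).isPreconnected (left_mem_segment ℝ x y) hx (right_mem_segment ℝ x y) hy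
  calc Metric.infDist x (frontier A) + Metric.infDist y (frontier A)
      ≤ dist x z + dist y z :=
        add_le_add (Metric.infDist_le_dist_of_mem hzA) (Metric.infDist_le_dist_of_mem hzA)
    _ = dist x y := by rw [dist_comm y z, dist_add_dist_of_mem_segment hz]

lemma contDiffAt_gradient {E : Type*} [NormedAddCommGroup E] [InnerProductSpace ℝ E]
    [CompleteSpace E] {g : E → ℝ} {x : E} {k l : WithTop ℕ∞} (hg : ContDiffAt ℝ l g x)
    (hkl : k + 1 ≤ l) : ContDiffAt ℝ k (∇ g) x :=
  (InnerProductSpace.toDual ℝ E).symm.contDiff.contDiffAt.comp x (hg.fderiv_right hkl)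

section SignedDist

variable {n : ℕ} {A : Set (EuclideanSpace ℝ (Fin n))} {x y : EuclideanSpace ℝ (Fin n)}

lemma abs_signedDist (A : Set (EuclideanSpace ℝ (Fin n))) (x : EuclideanSpace ℝ (Fin n)) :
    |signedDist A x| = Metric.infDist x (frontier A) := by
  rw [signedDist]
  split_ifs <;> simp only [abs_neg, abs_of_nonneg Metric.infDist_nonneg]

lemma lipschitzWith_signedDist (A : Set (EuclideanSpace ℝ (Fin n))) :
    LipschitzWith 1 (signedDist A) := by
  refine LipschitzWith.of_le_add fun x y => ?_
  have hxy : Metric.infDist x (frontier A) ≤ Metric.infDist y (frontier A) + dist x y :=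
    Metric.infDist_le_infDist_add_dist
  have hyx : Metric.infDist y (frontier A) ≤ Metric.infDist x (frontier A) + dist x y :=
    dist_comm x y ▸ Metric.infDist_le_infDist_add_dist
  have := Metric.infDist_nonneg (x := x) (s := frontier A)
  have := Metric.infDist_nonneg (x := y) (s := frontier A)
  simp only [signedDist]
  split_ifs with hx hy hy
  · linarith
  · linarith [dist_nonneg (x := x) (y := y)]
  · linarith [infDist_frontier_add_infDist_frontier_le hy hx, dist_comm x y]
  · linarith

lemma signedDist_of_mem_frontier (hy : y ∈ frontier A) : signedDist A y = 0 := by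
  rw [← abs_eq_zero, abs_signedDist, Metric.infDist_zero_of_mem hy]

lemma signedDist_eq_zero_iff (hA : (frontier A).Nonempty) :
    signedDist A x = 0 ↔ x ∈ frontier A := by
  rw [isClosed_frontier.mem_iff_infDist_zero hA, ← abs_signedDist, abs_eq_zero]

lemma exists_mem_frontier_norm_sub_eq (hA : (frontier A).Nonempty)
    (x : EuclideanSpace ℝ (Fin n)) : ∃ y ∈ frontier A, ‖x - y‖ = |signedDist A x| := by
  obtain ⟨y, hy, hxy⟩ := isClosed_frontier.exists_infDist_eq_dist hA x
  exact ⟨y, hy, by rw [abs_signedDist, hxy, dist_eq_norm]⟩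

lemma signedDist_add_smul_sub (hy : y ∈ frontier A) (hxy : ‖x - y‖ = |signedDist A x|) {s : ℝ}
    (hs : s ∈ Icc (0 : ℝ) 1) : signedDist A (y + s • (x - y)) = s * signedDist A x := by
  set z := y + s • (x - y) with hz
  have hzy : ‖z - y‖ = s * |signedDist A x| := by
    rw [hz, add_sub_cancel_left, norm_smul, hxy, Real.norm_of_nonneg hs.1]
  have hzx : ‖z - x‖ = (1 - s) * |signedDist A x| := by
    rw [hz, show y + s • (x - y) - x = -((1 - s) • (x - y)) by module, norm_neg, norm_smul, hxy,
      Real.norm_of_nonneg (sub_nonneg.2 hs.2)]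
  have hdzy := (lipschitzWith_signedDist A).norm_sub_le z y
  have hdzx := (lipschitzWith_signedDist A).norm_sub_le z x
  rw [NNReal.coe_one, one_mul, Real.norm_eq_abs, abs_le] at hdzy hdzx
  rw [hzy, signedDist_of_mem_frontier hy] at hdzy
  rw [hzx] at hdzx
  rcases abs_cases (signedDist A x) with ⟨habs, -⟩ | ⟨habs, -⟩ <;> rw [habs] at hdzy hdzx <;>
    linarith

lemma norm_gradient_signedDist_le (A : Set (EuclideanSpace ℝ (Fin n)))
    (x : EuclideanSpace ℝ (Fin n)) : ‖∇ (signedDist A) x‖ ≤ 1 := by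
  rw [← (InnerProductSpace.toDual ℝ _).norm_map, toDual_gradient]
  exact norm_fderiv_le_of_lipschitz ℝ (lipschitzWith_signedDist A)

lemma inner_gradient_signedDist (hy : y ∈ frontier A) (hxy : ‖x - y‖ = |signedDist A x|) {s : ℝ}
    (hs : s ∈ Icc (0 : ℝ) 1) (hd : DifferentiableAt ℝ (signedDist A) (y + s • (x - y))) :
    inner ℝ (∇ (signedDist A) (y + s • (x - y))) (x - y) = signedDist A x := by
  have hline : HasDerivAt (fun s : ℝ => y + s • (x - y)) (x - y) s := by
    simpa using ((hasDerivAt_id s).smul_const (x - y)).const_add y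
  have hlinear : HasDerivWithinAt (fun s : ℝ => signedDist A (y + s • (x - y)))
      (signedDist A x) (Icc 0 1) s :=
    ((hasDerivAt_mul_const (signedDist A x)).hasDerivWithinAt).congr
      (fun u hu => signedDist_add_smul_sub hy hxy hu) (signedDist_add_smul_sub hy hxy hs)
  have hchain : HasDerivAt (fun s : ℝ => signedDist A (y + s • (x - y)))
      (fderiv ℝ (signedDist A) (y + s • (x - y)) (x - y)) s :=
    HasFDerivAt.comp_hasDerivAt (l := signedDist A) s hd.hasFDerivAt hline
  rw [inner_gradient_left]
  exact (uniqueDiffOn_Icc_zero_one s hs).eq_deriv _ hchain.hasDerivWithinAt hlinear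

lemma signedDist_smul_gradient (hy : y ∈ frontier A) (hxy : ‖x - y‖ = |signedDist A x|) {s : ℝ}
    (hs : s ∈ Icc (0 : ℝ) 1) (hd : DifferentiableAt ℝ (signedDist A) (y + s • (x - y))) :
    signedDist A x • ∇ (signedDist A) (y + s • (x - y)) = x - y := by
  have hinner := inner_gradient_signedDist hy hxy hs hd
  have hle := norm_gradient_signedDist_le A (y + s • (x - y))
  set ν := ∇ (signedDist A) (y + s • (x - y))
  set l := signedDist A x
  -- equality in Cauchy–Schwarz
  have hsq : ‖l • ν - (x - y)‖ ^ 2 = l ^ 2 * (‖ν‖ ^ 2 - 1) := by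
    rw [@norm_sub_sq_real, real_inner_smul_left, hinner, norm_smul, hxy, mul_pow,
      Real.norm_eq_abs, sq_abs]
    ring
  have hnonpos : ‖l • ν - (x - y)‖ ^ 2 ≤ 0 := hsq.trans_le <|
    mul_nonpos_of_nonneg_of_nonpos (sq_nonneg l) (sub_nonpos.2 (pow_le_one₀ (norm_nonneg _) hle))
  exact sub_eq_zero.1 (norm_eq_zero.1 (pow_eq_zero_iff two_ne_zero |>.1
    (hnonpos.antisymm (sq_nonneg _))))

lemma sub_signedDist_smul_gradient (hy : y ∈ frontier A) (hxy : ‖x - y‖ = |signedDist A x|)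
    (hd : DifferentiableAt ℝ (signedDist A) x) :
    x - signedDist A x • ∇ (signedDist A) x = y := by
  have h := signedDist_smul_gradient hy hxy (s := 1) ⟨zero_le_one, le_rfl⟩ (by simpa using hd)
  rw [one_smul, add_sub_cancel] at h
  rw [h, sub_sub_cancel]

lemma gradient_signedDist_eq (hy : y ∈ frontier A) (hxy : ‖x - y‖ = |signedDist A x|)
    (hx : signedDist A x ≠ 0) (hdx : DifferentiableAt ℝ (signedDist A) x)
    (hdy : DifferentiableAt ℝ (signedDist A) y) :
    ∇ (signedDist A) y = ∇ (signedDist A) x := by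
  have h := signedDist_smul_gradient hy hxy (s := 0) ⟨le_rfl, zero_le_one⟩ (by simpa using hdy)
  rw [zero_smul, add_zero, ← sub_signedDist_smul_gradient hy hxy hdx, sub_sub_cancel] at h
  rw [← sub_signedDist_smul_gradient hy hxy hdx]
  exact smul_right_injective _ hx h

lemma norm_gradient_signedDist_of_notMem (hA : (frontier A).Nonempty) (hx : x ∉ frontier A)
    (hd : DifferentiableAt ℝ (signedDist A) x) : ‖∇ (signedDist A) x‖ = 1 := by
  obtain ⟨y, hy, hxy⟩ := exists_mem_frontier_norm_sub_eq hA x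
  have hsmul : signedDist A x • ∇ (signedDist A) x = x - y := by
    rw [← sub_signedDist_smul_gradient hy hxy hd, sub_sub_cancel]
  have hnorm : |signedDist A x| * ‖∇ (signedDist A) x‖ = |signedDist A x| * 1 := by
    rw [← Real.norm_eq_abs, ← norm_smul, hsmul, hxy, mul_one, Real.norm_eq_abs]
  exact mul_left_cancel₀ (abs_ne_zero.2 ((signedDist_eq_zero_iff hA).not.2 hx)) hnorm

lemma norm_gradient_signedDist_of_notMem_interior (hA : (frontier A).Nonempty)
    (hx : x ∉ interior (frontier A)) (hd : ContDiffAt ℝ 1 (signedDist A) x) :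
    ‖∇ (signedDist A) x‖ = 1 := by
  have hcont : ContinuousAt (fun z => ‖∇ (signedDist A) z‖) x :=
    (contDiffAt_gradient (k := 0) hd (by norm_num)).continuousAt.norm
  have hfreq : ∃ᶠ z in 𝓝 x, ‖∇ (signedDist A) z‖ = 1 := by
    have hout : ∃ᶠ z in 𝓝 x, z ∉ frontier A :=
      not_eventually.1 (mem_interior_iff_mem_nhds.not.1 hx)
    exact (hout.and_eventually (hd.eventually (by simp))).mono fun z hz =>
      norm_gradient_signedDist_of_notMem hA hz.1 (hz.2.differentiableAt one_ne_zero)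
  by_contra hne
  exact hfreq.and_eventually (hcont.eventually_ne hne) |>.exists.elim fun z hz => hz.2 hz.1

lemma interior_frontier_eq_empty_of_contDiffAt (hA : (frontier A).Nonempty)
    (hne : frontier A ≠ univ) (hd : ∀ y ∈ frontier A, ContDiffAt ℝ 1 (signedDist A) y) :
    interior (frontier A) = ∅ := by
  have hgrad : ∀ z ∈ interior (frontier A), ∇ (signedDist A) z = 0 := fun z hz => by
    have hzero : signedDist A =ᶠ[𝓝 z] fun _ => 0 := by
      filter_upwards [isOpen_interior.mem_nhds hz] with w hw
      exact signedDist_of_mem_frontier (interior_subset hw)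
    rw [hzero.gradient_eq, gradient_fun_const]
  -- the gradient has length zero inside and length one outside, so the interior is also closed
  have hclosed : IsClosed (interior (frontier A)) := isClosed_of_closure_subset fun y hy => by
    have hdy := hd y (closure_minimal interior_subset isClosed_frontier hy)
    by_contra hyI
    have hcont : ContinuousAt (∇ (signedDist A)) y :=
      (contDiffAt_gradient (k := 0) hdy (by norm_num)).continuousAt
    have hy₀ : ∇ (signedDist A) y ≠ 0 := norm_ne_zero_iff.1 <| by
      rw [norm_gradient_signedDist_of_notMem_interior hA hyI hdy]
      exact one_ne_zero
    obtain ⟨z, hz, hzI⟩ := mem_closure_iff_nhds.1 hy _ (hcont.eventually_ne hy₀)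
    exact hz (hgrad z hzI)
  refine (isClopen_iff.1 ⟨hclosed, isOpen_interior⟩).resolve_right fun h => hne ?_
  exact univ_subset_iff.1 (h ▸ interior_subset)

lemma norm_gradient_signedDist (hA : (frontier A).Nonempty) (hne : frontier A ≠ univ)
    (hd : ∀ y ∈ frontier A, ContDiffAt ℝ 1 (signedDist A) y)
    (hx : ContDiffAt ℝ 1 (signedDist A) x) : ‖∇ (signedDist A) x‖ = 1 :=
  norm_gradient_signedDist_of_notMem_interior hA
    (interior_frontier_eq_empty_of_contDiffAt hA hne hd ▸ notMem_empty x) hx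

end SignedDist

/-! ### Curvature of parallel surfaces -/

section Hessian

variable {E : Type*} [NormedAddCommGroup E] [InnerProductSpace ℝ E]

lemma norm_le_of_abs_inner_self_le {S : E →L[ℝ] E} (hS : (S : E →ₗ[ℝ] E).IsSymmetric) {N : ℝ}
    (hN : 0 ≤ N) (hbound : ∀ v, |inner ℝ (S v) v| ≤ N * ‖v‖ ^ 2) : ‖S‖ ≤ N := by
  rw [S.norm_eq_iSup_rayleighQuotient hS]
  refine ciSup_le fun v => ?_
  rw [ContinuousLinearMap.rayleighQuotient, abs_div, abs_sq]
  exact div_le_of_le_mul₀ (sq_nonneg _) hN (hbound v)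

variable [CompleteSpace E] {g : E → ℝ} {x : E}

lemma inner_fderiv_gradient (hg : ContDiffAt ℝ 2 g x) (u v : E) :
    inner ℝ (fderiv ℝ (∇ g) x u) v = fderiv ℝ (fderiv ℝ g) x u v := by
  have hgrad : DifferentiableAt ℝ (∇ g) x :=
    (contDiffAt_gradient (k := 1) hg (by norm_num)).differentiableAt one_ne_zero
  have hfderiv : DifferentiableAt ℝ (fderiv ℝ g) x :=
    (hg.fderiv_right (m := 1) (by norm_num)).differentiableAt one_ne_zero
  calc inner ℝ (fderiv ℝ (∇ g) x u) v = fderiv ℝ (fun z => inner ℝ (∇ g z) v) x u := by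
        rw [fderiv_inner_apply ℝ hgrad (differentiableAt_const v)]
        simp
    _ = fderiv ℝ (fun z => fderiv ℝ g z v) x u := by simp only [inner_gradient_left]
    _ = fderiv ℝ (fderiv ℝ g) x u v := by
        simp [fderiv_clm_apply hfderiv (differentiableAt_const v)]

lemma isSymmetric_fderiv_gradient (hg : ContDiffAt ℝ 2 g x) :
    (fderiv ℝ (∇ g) x : E →ₗ[ℝ] E).IsSymmetric := fun u v => by
  rw [ContinuousLinearMap.coe_coe, real_inner_comm _ u, inner_fderiv_gradient hg,
    inner_fderiv_gradient hg]
  exact hg.isSymmSndFDerivAt (by simp) u v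

lemma fderiv_gradient_gradient (hg : ContDiffAt ℝ 2 g x)
    (hnorm : ∀ᶠ z in 𝓝 x, ‖∇ g z‖ = 1) : fderiv ℝ (∇ g) x (∇ g x) = 0 := by
  have hgrad : DifferentiableAt ℝ (∇ g) x :=
    (contDiffAt_gradient (k := 1) hg (by norm_num)).differentiableAt one_ne_zero
  have hconst : (fun z => inner ℝ (∇ g z) (∇ g z)) =ᶠ[𝓝 x] fun _ => (1 : ℝ) := by
    filter_upwards [hnorm] with z hz
    rw [real_inner_self_eq_norm_sq, hz, one_pow]
  refine ext_inner_right ℝ fun v => ?_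
  have hv : inner ℝ (∇ g x) (fderiv ℝ (∇ g) x v) + inner ℝ (fderiv ℝ (∇ g) x v) (∇ g x) = 0 := by
    rw [← fderiv_inner_apply ℝ hgrad hgrad, hconst.fderiv_eq, fderiv_fun_const]
    rfl
  have hsymm : inner ℝ (fderiv ℝ (∇ g) x (∇ g x)) v = inner ℝ (∇ g x) (fderiv ℝ (∇ g) x v) :=
    isSymmetric_fderiv_gradient hg (∇ g x) v
  rw [inner_zero_left, hsymm]
  linarith [real_inner_comm (∇ g x) (fderiv ℝ (∇ g) x v)]

end Hessian

section Laplacian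

variable {E : Type*} [NormedAddCommGroup E] [InnerProductSpace ℝ E] [FiniteDimensional ℝ E]

lemma laplacian_eq_sum_fderiv {ι : Type*} [Fintype ι] (e : OrthonormalBasis ι ℝ E) (g : E → ℝ)
    (x : E) : (Δ g) x = ∑ i, fderiv ℝ (fderiv ℝ g) x (e i) (e i) := by
  simp [InnerProductSpace.laplacian_eq_iteratedFDeriv_orthonormalBasis g e,
    iteratedFDeriv_two_apply]

lemma abs_laplacian_sub_laplacian_le {g : E → ℝ} {x y : E} (hx : ContDiffAt ℝ 2 g x)
    (hy : ContDiffAt ℝ 2 g y) :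
    |(Δ g) x - (Δ g) y| ≤ Module.finrank ℝ E * ‖fderiv ℝ (∇ g) x - fderiv ℝ (∇ g) y‖ := by
  set e := stdOrthonormalBasis ℝ E
  set T := fderiv ℝ (∇ g) x - fderiv ℝ (∇ g) y
  have htrace : (Δ g) x - (Δ g) y = ∑ i, inner ℝ (T (e i)) (e i) := by
    simp only [laplacian_eq_sum_fderiv e, ← inner_fderiv_gradient hx, ← inner_fderiv_gradient hy,
      ← Finset.sum_sub_distrib, ← inner_sub_left, T, _root_.sub_apply]
  have hentry (i) : |inner ℝ (T (e i)) (e i)| ≤ ‖T‖ := by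
    simpa [e.norm_eq_one] using
      (abs_real_inner_le_norm (T (e i)) (e i)).trans
        (mul_le_mul_of_nonneg_right (T.le_opNorm (e i)) (norm_nonneg _))
  calc |(Δ g) x - (Δ g) y| ≤ ∑ i, |inner ℝ (T (e i)) (e i)| :=
        htrace ▸ Finset.abs_sum_le_sum_abs _ _
    _ ≤ ∑ _i : Fin (Module.finrank ℝ E), ‖T‖ := Finset.sum_le_sum fun i _ => hentry i
    _ = Module.finrank ℝ E * ‖T‖ := by
        rw [Finset.sum_const, Finset.card_univ, Fintype.card_fin, nsmul_eq_mul]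

end Laplacian

section ParallelSurfaces

variable {n : ℕ} {A : Set (EuclideanSpace ℝ (Fin n))} {x y : EuclideanSpace ℝ (Fin n)} {N : ℝ}

lemma fderiv_gradient_signedDist_gradient (hA : (frontier A).Nonempty) (hne : frontier A ≠ univ)
    (hd : ∀ y ∈ frontier A, ContDiffAt ℝ 1 (signedDist A) y)
    (hx : ContDiffAt ℝ 2 (signedDist A) x) :
    fderiv ℝ (∇ (signedDist A)) x (∇ (signedDist A) x) = 0 := by
  refine fderiv_gradient_gradient hx ?_
  filter_upwards [hx.eventually (by simp)] with z hz
  exact norm_gradient_signedDist hA hne hd (hz.of_le one_le_two)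

lemma fderiv_gradient_signedDist_eq (hA : (frontier A).Nonempty) (hne : frontier A ≠ univ)
    (hd : ∀ y ∈ frontier A, ContDiffAt ℝ 2 (signedDist A) y)
    (hx : ContDiffAt ℝ 2 (signedDist A) x) (hxA : x ∉ frontier A) (hy : y ∈ frontier A)
    (hxy : ‖x - y‖ = |signedDist A x|) :
    fderiv ℝ (∇ (signedDist A)) x = fderiv ℝ (∇ (signedDist A)) y -
      signedDist A x • fderiv ℝ (∇ (signedDist A)) y ∘L fderiv ℝ (∇ (signedDist A)) x := by
  have hd₁ : ∀ z ∈ frontier A, ContDiffAt ℝ 1 (signedDist A) z :=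
    fun z hz => (hd z hz).of_le one_le_two
  have hdx := hx.differentiableAt two_ne_zero
  have hl : signedDist A x ≠ 0 := (signedDist_eq_zero_iff hA).not.2 hxA
  have hyx : ∇ (signedDist A) y = ∇ (signedDist A) x :=
    gradient_signedDist_eq hy hxy hl hdx ((hd y hy).differentiableAt two_ne_zero)
  -- the gradient is constant along normals, so differentiate `∇ d (z - d z • ∇ d z) = ∇ d z`
  have hconst : (fun z => ∇ (signedDist A) (z - signedDist A z • ∇ (signedDist A) z))
      =ᶠ[𝓝 x] ∇ (signedDist A) := by
    filter_upwards [hx.eventually (by simp), hdx.continuousAt.eventually_ne hl] with z hz hz₀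
    obtain ⟨w, hw, hzw⟩ := exists_mem_frontier_norm_sub_eq hA z
    have hdz := hz.differentiableAt two_ne_zero
    rw [sub_signedDist_smul_gradient hw hzw hdz]
    exact gradient_signedDist_eq hw hzw hz₀ hdz ((hd w hw).differentiableAt two_ne_zero)
  have hgrad {z} (hz : ContDiffAt ℝ 2 (signedDist A) z) :
      HasFDerivAt (∇ (signedDist A)) (fderiv ℝ (∇ (signedDist A)) z) z :=
    ((contDiffAt_gradient (k := 1) hz (by norm_num)).differentiableAt one_ne_zero).hasFDerivAt
  have hchain := ((sub_signedDist_smul_gradient hy hxy hdx).symm ▸ hgrad (hd y hy)).comp x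
    ((hasFDerivAt_id x).sub (hdx.hasFDerivAt.smul (hgrad hx)))
  have hker := hyx ▸ fderiv_gradient_signedDist_gradient hA hne hd₁ (hd y hy)
  conv_lhs => rw [← hconst.fderiv_eq]
  refine (HasFDerivAt.fderiv hchain).trans ?_
  ext1 v
  simp [sub_signedDist_smul_gradient hy hxy hdx, hker]

lemma norm_fderiv_gradient_signedDist_le (hA : (frontier A).Nonempty) (hne : frontier A ≠ univ)
    (hd : ∀ y ∈ frontier A, ContDiffAt ℝ 1 (signedDist A) y)
    (hy : ContDiffAt ℝ 2 (signedDist A) y) (hN : 0 ≤ N) (hcurv : PrincipalCurvaturesLE A N y) :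
    ‖fderiv ℝ (∇ (signedDist A)) y‖ ≤ N := by
  have hsymm := isSymmetric_fderiv_gradient hy
  refine norm_le_of_abs_inner_self_le hsymm hN fun v => ?_
  have hker := fderiv_gradient_signedDist_gradient hA hne hd hy
  have hν := norm_gradient_signedDist hA hne hd (hy.of_le one_le_two)
  set S := fderiv ℝ (∇ (signedDist A)) y
  set ν := ∇ (signedDist A) y
  set b := inner ℝ ν v with hb
  -- only the tangential part `v - b • ν` contributes to the quadratic form
  have htangent : inner ℝ ν (v - b • ν) = 0 := by
    rw [inner_sub_right, real_inner_smul_right, real_inner_self_eq_norm_sq, hν, ← hb]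
    ring
  have hform : inner ℝ (S v) v = inner ℝ (S (v - b • ν)) (v - b • ν) := by
    have hSν : inner ℝ (S v) ν = 0 := (hsymm v ν).trans (by simp [hker])
    rw [map_sub, map_smul, hker, smul_zero, sub_zero, inner_sub_right, real_inner_smul_right, hSν,
      mul_zero, sub_zero]
  have hnorm : ‖v - b • ν‖ ^ 2 = ‖v‖ ^ 2 - b ^ 2 := by
    rw [@norm_sub_sq_real, real_inner_smul_right, real_inner_comm, ← hb, norm_smul, hν,
      Real.norm_eq_abs, mul_one, sq_abs]
    ring
  have hbound := hcurv (v - b • ν) (by rw [← inner_gradient_left, htangent])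
  rw [← inner_fderiv_gradient hy, ← hform, hnorm] at hbound
  exact hbound.trans (mul_le_mul_of_nonneg_left (sub_le_self _ (sq_nonneg b)) hN)

lemma abs_laplacian_signedDist_sub_le (hA : (frontier A).Nonempty) (hne : frontier A ≠ univ)
    (hd : ∀ y ∈ frontier A, ContDiffAt ℝ 2 (signedDist A) y)
    (hx : ContDiffAt ℝ 2 (signedDist A) x) (hy : y ∈ frontier A)
    (hxy : ‖x - y‖ = |signedDist A x|) (hN : 0 ≤ N) (hcurv : PrincipalCurvaturesLE A N y)
    (hl : N * |signedDist A x| ≤ 1 / 2) :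
    |(Δ (signedDist A)) x - (Δ (signedDist A)) y| ≤ 2 * n * N ^ 2 * |signedDist A x| := by
  by_cases hxA : x ∈ frontier A
  · rw [signedDist_of_mem_frontier hxA, abs_zero, norm_eq_zero, sub_eq_zero] at hxy
    rw [hxy, sub_self, abs_zero]
    positivity
  have hparallel := fderiv_gradient_signedDist_eq hA hne hd hx hxA hy hxy
  have hS := norm_fderiv_gradient_signedDist_le hA hne
    (fun z hz => (hd z hz).of_le one_le_two) (hd y hy) hN hcurv
  have hlap := abs_laplacian_sub_laplacian_le hx (hd y hy)
  rw [finrank_euclideanSpace_fin] at hlap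
  set S := fderiv ℝ (∇ (signedDist A)) y
  set R := fderiv ℝ (∇ (signedDist A)) x
  set l := signedDist A x
  have hdiff : ‖R - S‖ ≤ |l| * (N * ‖R‖) := by
    rw [show R - S = -(l • S ∘L R) by rwa [sub_eq_iff_eq_add, neg_add_eq_sub], norm_neg,
      norm_smul, Real.norm_eq_abs]
    gcongr
    exact (ContinuousLinearMap.opNorm_comp_le S R).trans (by gcongr)
  have hR : ‖R‖ ≤ 2 * N := by
    have htri : ‖R‖ ≤ ‖R - S‖ + ‖S‖ := by simpa using norm_add_le (R - S) S
    have hsmall : |l| * (N * ‖R‖) ≤ 1 / 2 * ‖R‖ := by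
      rw [← mul_assoc, mul_comm |l|]
      gcongr
    linarith
  calc |(Δ (signedDist A)) x - (Δ (signedDist A)) y| ≤ n * ‖R - S‖ := hlap
    _ ≤ n * (|l| * (N * (2 * N))) := by gcongr; exact hdiff.trans (by gcongr)
    _ = 2 * n * N ^ 2 * |l| := by ring

end ParallelSurfaces

/-! ### Forced curvature flows -/

section Flow

variable {n : ℕ} {D O : Set (EuclideanSpace ℝ (Fin n))} {U : ℝ → Set (EuclideanSpace ℝ (Fin n))}
  {g : ℝ → ℝ} {N η τ t : ℝ} {x y : EuclideanSpace ℝ (Fin n)}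

lemma deriv_signedDist_eq_of_mem_frontier (hx : DifferentiableAt ℝ (fun s => signedDist (U s) x) t)
    (hy : DifferentiableAt ℝ (fun s => signedDist (U s) y) t) (hyU : y ∈ frontier (U t))
    (hxy : ‖x - y‖ = |signedDist (U t) x|) :
    deriv (fun s => signedDist (U s) x) t = deriv (fun s => signedDist (U s) y) t := by
  have hy0 : signedDist (U t) y = 0 := signedDist_of_mem_frontier hyU
  -- By the Lipschitz bound, `|d(x, s) - d(y, s)| ≤ ‖x - y‖`, with equality at `s = t`.
  have hlip (s : ℝ) : |signedDist (U s) x - signedDist (U s) y| ≤ |signedDist (U t) x| := by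
    simpa [hxy] using (lipschitzWith_signedDist (U s)).norm_sub_le x y
  have hext : IsLocalExtr (fun s => signedDist (U s) x - signedDist (U s) y) t := by
    rcases le_total 0 (signedDist (U t) x) with h | h
    · refine .inr (.of_forall fun s => ?_)
      simpa only [hy0, sub_zero, abs_of_nonneg h] using (le_abs_self _).trans (hlip s)
    · refine .inl (.of_forall fun s => ?_)
      simpa only [hy0, sub_zero, abs_of_nonpos h, neg_neg] using (abs_le.1 (hlip s)).1
  exact sub_eq_zero.1 (deriv_fun_sub hx hy ▸ hext.deriv_eq_zero)

namespace IsForcedCurvatureFlow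

lemma frontier_subset (hU : IsForcedCurvatureFlow D O U g N η τ) (hη : 0 < η)
    (ht : t ∈ Icc 0 τ) : frontier (U t) ⊆ O :=
  (Metric.self_subset_thickening hη _).trans (hU.nbhd t ht)

lemma contDiffAt (hU : IsForcedCurvatureFlow D O U g N η τ) (ht : t ∈ Icc 0 τ) (hx : x ∈ O) :
    ContDiffAt ℝ 2 (signedDist (U t)) x :=
  (hU.space t ht).contDiffAt (hU.isOpen.mem_nhds hx)

lemma frontier_ne_univ [NeZero n] (hU : IsForcedCurvatureFlow D O U g N η τ)
    (hD : Bornology.IsBounded D) (hη : 0 < η) (ht : t ∈ Icc 0 τ) : frontier (U t) ≠ univ :=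
  fun h => NormedSpace.unbounded_univ ℝ (EuclideanSpace ℝ (Fin n))
    (hD.subset (h ▸ (hU.frontier_subset hη ht).trans hU.subset))

lemma norm_gradient [NeZero n] (hU : IsForcedCurvatureFlow D O U g N η τ)
    (hD : Bornology.IsBounded D) (hη : 0 < η) (ht : t ∈ Icc 0 τ) (hx : x ∈ O) :
    ‖∇ (signedDist (U t)) x‖ = 1 :=
  norm_gradient_signedDist (hU.nonempty t ht) (hU.frontier_ne_univ hD hη ht)
    (fun _ hy => (hU.contDiffAt ht (hU.frontier_subset hη ht hy)).of_le one_le_two)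
    ((hU.contDiffAt ht hx).of_le one_le_two)

lemma deriv_signedDist_of_mem_frontier (hU : IsForcedCurvatureFlow D O U g N η τ) (hn : 2 ≤ n)
    (ht : t ∈ Ioo 0 τ) (hy : y ∈ frontier (U t)) :
    deriv (fun s => signedDist (U s) y) t = (Δ (signedDist (U t))) y - g t := by
  have hn1 : (n : ℝ) - 1 ≠ 0 := sub_ne_zero.2 (mod_cast (show n ≠ 1 by lia))
  have hvel := hU.velocity t ht y hy
  rw [normalVelocity, meanCurvature, mul_div_cancel₀ _ hn1] at hvel
  linarith

lemma abs_deriv_sub_laplacian_le (hU : IsForcedCurvatureFlow D O U g N η τ) (hn : 2 ≤ n)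
    (hD : Bornology.IsBounded D) (hη : 0 < η) (hN : 0 ≤ N) (ht : t ∈ Ioo 0 τ) (hx : x ∈ O)
    (hl : N * |signedDist (U t) x| ≤ 1 / 2) :
    |deriv (fun s => signedDist (U s) x) t - (Δ (signedDist (U t))) x + g t|
      ≤ 2 * n * N ^ 2 * |signedDist (U t) x| := by
  have : NeZero n := ⟨by lia⟩
  have ht' := Ioo_subset_Icc_self ht
  obtain ⟨y, hy, hxy⟩ := exists_mem_frontier_norm_sub_eq (hU.nonempty t ht') x
  have hfO := hU.frontier_subset hη ht'
  rw [deriv_signedDist_eq_of_mem_frontier (hU.time t ht x hx) (hU.time t ht y (hfO hy)) hy hxy,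
    hU.deriv_signedDist_of_mem_frontier hn ht hy, sub_right_comm, sub_add_cancel, abs_sub_comm]
  exact abs_laplacian_signedDist_sub_le (hU.nonempty t ht') (hU.frontier_ne_univ hD hη ht')
    (fun z hz => hU.contDiffAt ht' (hfO hz)) (hU.contDiffAt ht' hx) hy hxy hN
    (hU.curvature t ht' y hy) hl

end IsForcedCurvatureFlow

end Flow

/-! ### The comparison principle -/

lemma nonpos_of_eventually_nhdsGT_le {h : ℝ → ℝ} {h' b : ℝ} (hle : ∀ᶠ s in 𝓝[>] b, h s ≤ h b)
    (hd : HasDerivWithinAt h h' (Ici b) b) : h' ≤ 0 := by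
  have hmax : IsLocalMaxOn h (Ici b) b := by
    rw [IsLocalMaxOn, ← Ioi_insert, nhdsWithin_insert]
    exact eventually_sup.2 ⟨eventually_pure.2 le_rfl, hle⟩
  have hcone : (1 : ℝ) ∈ posTangentConeAt (Ici b) b :=
    mem_posTangentConeAt_of_segment_subset
      ((convex_Ici b).segment_subset self_mem_Ici (by simp))
  simpa using hmax.hasFDerivWithinAt_nonpos hd.hasFDerivWithinAt hcone

lemma nonneg_of_isLocalMaxOn_Iic {h : ℝ → ℝ} {h' b : ℝ} (hmax : IsLocalMaxOn h (Iic b) b)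
    (hd : HasDerivWithinAt h h' (Iic b) b) : 0 ≤ h' := by
  have hcone : (-1 : ℝ) ∈ posTangentConeAt (Iic b) b :=
    mem_posTangentConeAt_of_segment_subset
      ((convex_Iic b).segment_subset self_mem_Iic (by simp))
  simpa using hmax.hasFDerivWithinAt_nonpos hd.hasFDerivWithinAt hcone

section Laplacian

variable {E : Type*} [NormedAddCommGroup E] [NormedSpace ℝ E]

lemma deriv_deriv_comp_line {g : E → ℝ} {x : E} (hg : ContDiffAt ℝ 2 g x) (e : E) :
    deriv (deriv fun s : ℝ => g (x + s • e)) 0 = fderiv ℝ (fderiv ℝ g) x e e := by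
  have hline (s : ℝ) : HasDerivAt (fun s : ℝ => x + s • e) e s := by
    simpa using ((hasDerivAt_id s).smul_const e).const_add x
  have hlim : Tendsto (fun s : ℝ => x + s • e) (𝓝 0) (𝓝 x) := by
    simpa using (hline 0).continuousAt.tendsto
  have hfirst : deriv (fun s : ℝ => g (x + s • e)) =ᶠ[𝓝 0]
      fun s => fderiv ℝ g (x + s • e) e := by
    filter_upwards [hlim.eventually (hg.eventually (by simp))] with s hs
    exact ((hs.differentiableAt two_ne_zero).hasFDerivAt.comp_hasDerivAt s (hline s)).deriv
  have hsecond : HasFDerivAt (fderiv ℝ g) (fderiv ℝ (fderiv ℝ g) x) (x + (0 : ℝ) • e) := by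
    rw [zero_smul, add_zero]
    exact ((hg.fderiv_right one_add_one_eq_two.le).differentiableAt one_ne_zero).hasFDerivAt
  rw [hfirst.deriv_eq]
  have hcomp : HasDerivAt (fun s : ℝ => fderiv ℝ g (x + s • e)) (fderiv ℝ (fderiv ℝ g) x e) 0 :=
    hsecond.comp_hasDerivAt (0 : ℝ) (hline 0)
  exact ((ContinuousLinearMap.apply ℝ ℝ e).hasFDerivAt.comp_hasDerivAt (0 : ℝ) hcomp).deriv

end Laplacian

section Laplacian

variable {E : Type*} [NormedAddCommGroup E] [InnerProductSpace ℝ E] [FiniteDimensional ℝ E]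
  {g : E → ℝ} {x : E}

lemma laplacian_nonpos_of_isLocalMax (hg : ContDiffAt ℝ 2 g x) (hmax : IsLocalMax g x) :
    (Δ g) x ≤ 0 := by
  rw [laplacian_eq_sum_fderiv (stdOrthonormalBasis ℝ E)]
  refine Finset.sum_nonpos fun i _ => ?_
  rw [← deriv_deriv_comp_line hg]
  set line := fun s : ℝ => x + s • stdOrthonormalBasis ℝ E i
  have hx : line 0 = x := by simp [line]
  have hline : ContinuousAt line 0 := by fun_prop
  refine deriv_deriv_nonpos_of_isLocalMax (w := g ∘ line) ?_
    (ContinuousAt.comp (hx.symm ▸ hg.continuousAt) hline)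
  filter_upwards [hline.tendsto.eventually (hx.symm ▸ hmax)] with s hs
  exact hs.trans_eq rfl

lemma continuous_laplacian (hg : ContDiff ℝ 2 g) : Continuous (Δ g) := by
  rw [InnerProductSpace.laplacian_eq_iteratedFDeriv_stdOrthonormalBasis]
  have := hg.continuous_iteratedFDeriv le_rfl
  fun_prop

end Laplacian

namespace IsDefiningFunction

variable {n : ℕ} {D : Set (EuclideanSpace ℝ (Fin n))} {r : EuclideanSpace ℝ (Fin n) → ℝ}
  {x : EuclideanSpace ℝ (Fin n)}

lemma isOpen (hr : IsDefiningFunction r D) : IsOpen D :=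
  hr.eq_neg ▸ isOpen_lt hr.contDiff.continuous continuous_const

lemma eq_zero_of_mem_frontier (hr : IsDefiningFunction r D) (hx : x ∈ frontier D) : r x = 0 :=
  frontier_lt_subset_eq hr.contDiff.continuous continuous_const (hr.eq_neg ▸ hx)

lemma norm_gradient_pos (hr : IsDefiningFunction r D) (hx : x ∈ frontier D) : 0 < ‖∇ r x‖ :=
  norm_pos_iff.2 (hr.gradient_ne x (hr.eq_zero_of_mem_frontier hx))

lemma hasDerivAt_outerNormal (hr : IsDefiningFunction r D) (hx : x ∈ frontier D) :
    HasDerivAt (fun s : ℝ => r (x - s • outerNormal r x)) (-‖∇ r x‖) 0 := by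
  have hline : HasDerivAt (fun s : ℝ => x - s • outerNormal r x) (-outerNormal r x) 0 := by
    simpa using ((hasDerivAt_id (0 : ℝ)).smul_const (outerNormal r x)).const_sub x
  have hdiff : HasFDerivAt r (fderiv ℝ r x) (x - (0 : ℝ) • outerNormal r x) := by
    rw [zero_smul, sub_zero]
    exact (hr.contDiff.differentiable two_ne_zero x).hasFDerivAt
  refine (hdiff.comp_hasDerivAt (0 : ℝ) hline).congr_deriv ?_
  rw [map_neg, outerNormal, map_smul, ← inner_gradient_left, real_inner_self_eq_norm_sq,
    smul_eq_mul, sq, inv_mul_cancel_left₀ (hr.norm_gradient_pos hx).ne']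

lemma eventually_sub_smul_outerNormal_mem (hr : IsDefiningFunction r D) (hx : x ∈ frontier D) :
    ∀ᶠ s in 𝓝[>] (0 : ℝ), x - s • outerNormal r x ∈ D := by
  have hderiv := hr.hasDerivAt_outerNormal hx
  have hsign := eventually_nhdsWithin_sign_eq_of_deriv_neg
    (hderiv.deriv.trans_lt (neg_neg_of_pos (hr.norm_gradient_pos hx)))
    (by simpa using hr.eq_zero_of_mem_frontier hx)
  filter_upwards [nhdsWithin_le_nhds hsign, self_mem_nhdsWithin] with s hs hs0
  rw [hr.eq_neg]
  rwa [zero_sub, sign_neg (neg_neg_of_pos hs0), sign_eq_neg_one_iff] at hs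

end IsDefiningFunction

lemma f_sub_f_le_sub {a b : ℝ} (h : b ≤ a) : f a - f b ≤ a - b := by
  have hquad : 0 ≤ a ^ 2 + a * b + b ^ 2 := by
    nlinarith [sq_nonneg (a + b), sq_nonneg a, sq_nonneg b]
  rw [f_sub_f]
  linarith [mul_nonneg (sub_nonneg.2 h) hquad]

section Restriction

variable {n : ℕ} {D : Set (EuclideanSpace ℝ (Fin n))} {r : EuclideanSpace ℝ (Fin n) → ℝ}
  {ε τ τ' t : ℝ} {ξ : ℝ → ℝ} {v : EuclideanSpace ℝ (Fin n) → ℝ → ℝ} {x : EuclideanSpace ℝ (Fin n)}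

namespace IsClassical

lemma continuousOn_time (hv : IsClassical D τ v) (hx : x ∈ closure D) :
    ContinuousOn (fun s => v x s) (Icc 0 τ) :=
  hv.cont.comp (f := fun s : ℝ => (x, s)) (by fun_prop) fun _ hs => ⟨hx, hs⟩

lemma continuousOn_space (hv : IsClassical D τ v) (ht : t ∈ Icc 0 τ) :
    ContinuousOn (fun x => v x t) (closure D) :=
  hv.cont.comp (f := fun x => (x, t)) (by fun_prop) fun _ hx => ⟨hx, ht⟩

lemma mono (hv : IsClassical D τ v) (h : τ' ≤ τ) : IsClassical D τ' v where
  cont := hv.cont.mono (prod_mono_right (Icc_subset_Icc_right h))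
  space t ht := hv.space t (Ioo_subset_Ioo_right h ht)
  time t ht := hv.time t (Ioo_subset_Ioo_right h ht)

end IsClassical

lemma IsSubsolution.mono (hv : IsSubsolution D r ε ξ τ v) (h : τ' ≤ τ) :
    IsSubsolution D r ε ξ τ' v where
  classical := hv.classical.mono h
  ineq t ht := hv.ineq t (Ioo_subset_Ioo_right h ht)
  neumann t ht := hv.neumann t (Ioo_subset_Ioo_right h ht)

lemma IsSupersolution.mono (hv : IsSupersolution D r ε ξ τ v) (h : τ' ≤ τ) :
    IsSupersolution D r ε ξ τ' v where
  classical := hv.classical.mono h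
  ineq t ht := hv.ineq t (Ioo_subset_Ioo_right h ht)
  neumann t ht := hv.neumann t (Ioo_subset_Ioo_right h ht)

namespace IsSolution

lemma isSubsolution (hv : IsSolution D r ε ξ τ v) : IsSubsolution D r ε ξ τ v where
  classical := hv.classical
  ineq t ht x hx := (hv.eqn t ht x hx).le
  neumann t ht x hx := ⟨0, hv.neumann t ht x hx, le_rfl⟩

lemma isSupersolution (hv : IsSolution D r ε ξ τ v) : IsSupersolution D r ε ξ τ v where
  classical := hv.classical
  ineq t ht x hx := (hv.eqn t ht x hx).ge
  neumann t ht x hx := ⟨0, hv.neumann t ht x hx, le_rfl⟩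

end IsSolution

end Restriction

section Comparison

variable {n : ℕ} {D : Set (EuclideanSpace ℝ (Fin n))} {r : EuclideanSpace ℝ (Fin n) → ℝ}
  {ε τ t₀ κ lam b k : ℝ} {ξ : ℝ → ℝ} {v w : EuclideanSpace ℝ (Fin n) → ℝ → ℝ}
  {x₀ : EuclideanSpace ℝ (Fin n)}

/-- The difference `v - w`, discounted at the rate `lam` that compensates the growth of the
reaction term, minus `κ` times the function `r + b + k t`. For a defining function `r` and large
`k` the latter is a strict supersolution of the Neumann heat equation, which rules out a positive
maximum when `v` is a subsolution and `w` a supersolution. -/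
noncomputable def penalizedDiff (r : EuclideanSpace ℝ (Fin n) → ℝ) (lam κ b k : ℝ)
    (v w : EuclideanSpace ℝ (Fin n) → ℝ → ℝ) (x : EuclideanSpace ℝ (Fin n)) (t : ℝ) : ℝ :=
  Real.exp (-lam * t) * (v x t - w x t) - κ * (r x + b + k * t)

lemma laplacian_penalizedDiff (hv : ContDiffAt ℝ 2 (fun x => v x t₀) x₀)
    (hw : ContDiffAt ℝ 2 (fun x => w x t₀) x₀) (hr : ContDiffAt ℝ 2 r x₀) :
    (Δ fun x => penalizedDiff r lam κ b k v w x t₀) x₀ =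
      Real.exp (-lam * t₀) * ((Δ fun x => v x t₀) x₀ - (Δ fun x => w x t₀) x₀) - κ * (Δ r) x₀ := by
  have hsplit : (fun x => penalizedDiff r lam κ b k v w x t₀) =
      Real.exp (-lam * t₀) • ((fun x => v x t₀) - fun x => w x t₀) -
        (κ • r + fun _ => κ * (b + k * t₀)) := by
    ext x
    simp only [penalizedDiff, Pi.sub_apply, Pi.add_apply, Pi.smul_apply, smul_eq_mul]
    ring
  have hvw : ContDiffAt ℝ 2 ((fun x => v x t₀) - fun x => w x t₀) x₀ := hv.sub hw
  have hexp : ContDiffAt ℝ 2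
      (Real.exp (-lam * t₀) • ((fun x => v x t₀) - fun x => w x t₀)) x₀ :=
    hvw.const_smul (Real.exp (-lam * t₀))
  have hκ : ContDiffAt ℝ 2 (κ • r) x₀ := hr.const_smul κ
  have hpen : ContDiffAt ℝ 2 (κ • r + fun _ => κ * (b + k * t₀)) x₀ := hκ.add contDiffAt_const
  rw [hsplit, ContDiffAt.laplacian_sub hexp hpen,
    ContDiffAt.laplacian_add hκ contDiffAt_const, InnerProductSpace.laplacian_smul _ hvw,
    InnerProductSpace.laplacian_smul _ hr, ContDiffAt.laplacian_sub hv hw,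
    InnerProductSpace.laplacian_const]
  simp

lemma hasDerivAt_penalizedDiff (hv : DifferentiableAt ℝ (fun s => v x₀ s) t₀)
    (hw : DifferentiableAt ℝ (fun s => w x₀ s) t₀) :
    HasDerivAt (fun s => penalizedDiff r lam κ b k v w x₀ s)
      (Real.exp (-lam * t₀) * (deriv (fun s => v x₀ s) t₀ - deriv (fun s => w x₀ s) t₀
        - lam * (v x₀ t₀ - w x₀ t₀)) - κ * k) t₀ := by
  have hexp := ((hasDerivAt_id t₀).const_mul (-lam)).exp
  have hlin := (((hasDerivAt_id t₀).const_mul k).const_add (r x₀ + b)).const_mul κ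
  refine ((hexp.mul (hv.hasDerivAt.sub hw.hasDerivAt)).sub hlin).congr_deriv ?_
  simp only [id_eq, Pi.sub_apply]
  ring

lemma hasDerivWithinAt_penalizedDiff_outerNormal {p q : ℝ} (hr : IsDefiningFunction r D)
    (hx₀ : x₀ ∈ frontier D) (hv : HasOuterNormalDeriv r (fun x => v x t₀) x₀ q)
    (hw : HasOuterNormalDeriv r (fun x => w x t₀) x₀ p) :
    HasDerivWithinAt
      (fun s : ℝ => penalizedDiff r lam κ b k v w (x₀ - s • outerNormal r x₀) t₀)
      (κ * ‖∇ r x₀‖ - Real.exp (-lam * t₀) * (q - p)) (Ici 0) 0 := by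
  have hr' := (hr.hasDerivAt_outerNormal hx₀).hasDerivWithinAt (s := Ici 0)
  refine (((hv.sub hw).const_mul (Real.exp (-lam * t₀))).sub
    (((hr'.add_const b).add_const (k * t₀)).const_mul κ)).congr_deriv ?_
  ring

/-- No touching in the interior, since the penalty strictly dominates its Laplacian there. -/
lemma not_isMaxOn_penalizedDiff_of_mem (hr : IsDefiningFunction r D)
    (hv : IsSubsolution D r ε ξ τ v) (hw : IsSupersolution D r ε ξ τ w) (ht₀ : t₀ ∈ Ioo 0 τ)
    (hx₀ : x₀ ∈ D) (hκ : 0 < κ) (hk : (Δ r) x₀ < k) (hwv : w x₀ t₀ ≤ v x₀ t₀) :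
    ¬ IsMaxOn (fun q => penalizedDiff r (ε ^ 2)⁻¹ κ b k v w q.1 q.2) (D ×ˢ Icc 0 t₀) (x₀, t₀) := by
  intro hmax
  have hDx : D ∈ 𝓝 x₀ := hr.isOpen.mem_nhds hx₀
  have hcv : ContDiffAt ℝ 2 (fun x => v x t₀) x₀ := (hv.classical.space t₀ ht₀).contDiffAt hDx
  have hcw : ContDiffAt ℝ 2 (fun x => w x t₀) x₀ := (hw.classical.space t₀ ht₀).contDiffAt hDx
  have hcr : ContDiffAt ℝ 2 r x₀ := hr.contDiff.contDiffAt
  have hspace : (Δ fun x => penalizedDiff r (ε ^ 2)⁻¹ κ b k v w x t₀) x₀ ≤ 0 := by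
    refine laplacian_nonpos_of_isLocalMax (by unfold penalizedDiff; fun_prop) ?_
    filter_upwards [hDx] with x hx
    exact hmax (show (x, t₀) ∈ D ×ˢ Icc 0 t₀ from ⟨hx, ht₀.1.le, le_rfl⟩)
  have htime := nonneg_of_isLocalMaxOn_Iic
    (by
      filter_upwards [Icc_mem_nhdsLE ht₀.1] with s hs
      exact hmax (show (x₀, s) ∈ D ×ˢ Icc 0 t₀ from ⟨hx₀, hs⟩))
    (hasDerivAt_penalizedDiff (hv.classical.time t₀ ht₀ x₀ hx₀)
      (hw.classical.time t₀ ht₀ x₀ hx₀)).hasDerivWithinAt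
  rw [laplacian_penalizedDiff hcv hcw hcr] at hspace
  have hreaction := mul_le_mul_of_nonneg_left (f_sub_f_le_sub hwv)
    (show 0 ≤ (ε ^ 2)⁻¹ by positivity)
  have hdiff : deriv (fun s => v x₀ s) t₀ - deriv (fun s => w x₀ s) t₀
      - (ε ^ 2)⁻¹ * (v x₀ t₀ - w x₀ t₀) ≤ (Δ fun x => v x t₀) x₀ - (Δ fun x => w x t₀) x₀ := by
    have hvres := hv.ineq t₀ ht₀ x₀ hx₀
    have hwres := hw.ineq t₀ ht₀ x₀ hx₀
    simp only [residual] at hvres hwres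
    linarith
  have hdiff' := mul_le_mul_of_nonneg_left hdiff (Real.exp_nonneg (-(ε ^ 2)⁻¹ * t₀))
  linarith [mul_lt_mul_of_pos_left hk hκ]

/-- No touching on the boundary, since the penalty has positive outer normal derivative there. -/
lemma not_isMaxOn_penalizedDiff_of_mem_frontier (hr : IsDefiningFunction r D)
    (hv : IsSubsolution D r ε ξ τ v) (hw : IsSupersolution D r ε ξ τ w) (ht₀ : t₀ ∈ Ioo 0 τ)
    (hx₀ : x₀ ∈ frontier D) (hκ : 0 < κ) :
    ¬ IsMaxOn (fun q => penalizedDiff r lam κ b k v w q.1 q.2) (closure D ×ˢ Icc 0 t₀)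
      (x₀, t₀) := by
  intro hmax
  obtain ⟨q, hq, hq0⟩ := hv.neumann t₀ ht₀ x₀ hx₀
  obtain ⟨p, hp, hp0⟩ := hw.neumann t₀ ht₀ x₀ hx₀
  have hderiv := nonpos_of_eventually_nhdsGT_le
    (by
      filter_upwards [hr.eventually_sub_smul_outerNormal_mem hx₀] with s hs
      simpa using! hmax (show (x₀ - s • outerNormal r x₀, t₀) ∈ closure D ×ˢ Icc 0 t₀ from
        ⟨subset_closure hs, ht₀.1.le, le_rfl⟩))
    (hasDerivWithinAt_penalizedDiff_outerNormal (lam := lam) (κ := κ) (b := b) (k := k)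
      hr hx₀ hq hp)
  have hpen := mul_pos hκ (hr.norm_gradient_pos hx₀)
  have hjump := mul_nonneg (Real.exp_nonneg (-lam * t₀)) (sub_nonneg.2 (hq0.trans hp0))
  linarith

lemma IsClassical.continuousOn_penalizedDiff (hr : Continuous r) (hv : IsClassical D τ v)
    (hw : IsClassical D τ w) :
    ContinuousOn (fun q : EuclideanSpace ℝ (Fin n) × ℝ => penalizedDiff r lam κ b k v w q.1 q.2)
      (closure D ×ˢ Icc 0 τ) := by
  have hvw := hv.cont.sub hw.cont
  exact (ContinuousOn.mul (by fun_prop) hvw).sub (by fun_prop)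

/-- If the penalized difference were positive somewhere, it would have a maximum at a positive
time, where `v > w` because the penalty is nonnegative. -/
lemma penalizedDiff_nonpos (hD : Bornology.IsBounded D) (hr : IsDefiningFunction r D)
    (hv : IsSubsolution D r ε ξ τ v) (hw : IsSupersolution D r ε ξ τ w)
    (h0 : ∀ x ∈ closure D, v x 0 ≤ w x 0) (hb : ∀ x ∈ closure D, 0 ≤ r x + b) (hk0 : 0 ≤ k)
    (hk : ∀ x ∈ D, (Δ r) x < k) (hκ : 0 < κ) {x : EuclideanSpace ℝ (Fin n)} {t : ℝ}
    (hx : x ∈ closure D) (ht : t ∈ Ico 0 τ) :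
    penalizedDiff r (ε ^ 2)⁻¹ κ b k v w x t ≤ 0 := by
  obtain ⟨⟨x₀, t₀⟩, ⟨hx₀, ht₀⟩, hmax⟩ := (hD.isCompact_closure.prod isCompact_Icc).exists_isMaxOn
    ⟨(x, t), hx, ht.1, le_rfl⟩ (IsClassical.continuousOn_penalizedDiff (lam := (ε ^ 2)⁻¹) (κ := κ)
      (b := b) (k := k) hr.contDiff.continuous (hv.classical.mono ht.2.le)
      (hw.classical.mono ht.2.le))
  dsimp only at hx₀ ht₀
  by_contra! hpos
  have hpos₀ : 0 < penalizedDiff r (ε ^ 2)⁻¹ κ b k v w x₀ t₀ :=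
    hpos.trans_le (hmax (show (x, t) ∈ closure D ×ˢ Icc 0 t from ⟨hx, ht.1, le_rfl⟩))
  have hwv : w x₀ t₀ < v x₀ t₀ := by
    have hpen : 0 ≤ κ * (r x₀ + b + k * t₀) :=
      mul_nonneg hκ.le (add_nonneg (hb x₀ hx₀) (mul_nonneg hk0 ht₀.1))
    have hdiff : 0 < Real.exp (-(ε ^ 2)⁻¹ * t₀) * (v x₀ t₀ - w x₀ t₀) :=
      hpen.trans_lt (sub_pos.1 hpos₀)
    exact sub_pos.1 (pos_of_mul_pos_right hdiff (Real.exp_nonneg _))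
  have ht₀' : t₀ ∈ Ioo 0 τ := by
    refine ⟨ht₀.1.lt_of_ne ?_, ht₀.2.trans_lt ht.2⟩
    rintro rfl
    exact hwv.not_ge (h0 x₀ hx₀)
  have hmax₀ := hmax.on_subset (prod_mono_right (s := closure D) (Icc_subset_Icc_right ht₀.2))
  by_cases hxD : x₀ ∈ D
  · exact not_isMaxOn_penalizedDiff_of_mem hr hv hw ht₀' hxD hκ (hk x₀ hxD) hwv.le
      (hmax₀.on_subset (prod_mono_left subset_closure))
  · exact not_isMaxOn_penalizedDiff_of_mem_frontier hr hv hw ht₀'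
      ⟨hx₀, by rwa [hr.isOpen.interior_eq]⟩ hκ hmax₀

lemma comparison_of_lt (hD : Bornology.IsBounded D) (hr : IsDefiningFunction r D)
    (hv : IsSubsolution D r ε ξ τ v) (hw : IsSupersolution D r ε ξ τ w)
    (h0 : ∀ x ∈ D, v x 0 ≤ w x 0) {x : EuclideanSpace ℝ (Fin n)} {t : ℝ} (hx : x ∈ D)
    (ht : t ∈ Ico 0 τ) : v x t ≤ w x t := by
  have h0' (y) (hy : y ∈ closure D) : v y 0 ≤ w y 0 := by
    have hτ : (0 : ℝ) ∈ Icc 0 τ := ⟨le_rfl, ht.1.trans ht.2.le⟩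
    exact ContinuousWithinAt.closure_le (f := fun x => v x 0) (g := fun x => w x 0) hy
      ((hv.classical.continuousOn_space hτ y hy).mono subset_closure)
      ((hw.classical.continuousOn_space hτ y hy).mono subset_closure) h0
  obtain ⟨M, hM⟩ :=
    hD.isCompact_closure.exists_bound_of_continuousOn hr.contDiff.continuous.continuousOn
  obtain ⟨K, hK⟩ := hD.isCompact_closure.exists_bound_of_continuousOn
    (continuous_laplacian hr.contDiff).continuousOn
  have hK0 : 0 ≤ K := (norm_nonneg _).trans (hK x (subset_closure hx))
  have hpen (κ : ℝ) (hκ : 0 < κ) : penalizedDiff r (ε ^ 2)⁻¹ κ M (K + 1) v w x t ≤ 0 :=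
    penalizedDiff_nonpos hD hr hv hw h0'
      (fun y hy => by linarith [neg_abs_le (r y), hM y hy, Real.norm_eq_abs (r y)])
      (by linarith)
      (fun y hy => by linarith [le_abs_self ((Δ r) y), hK y (subset_closure hy),
        Real.norm_eq_abs ((Δ r) y)]) hκ (subset_closure hx) ht
  have hlim : Tendsto (fun κ => penalizedDiff r (ε ^ 2)⁻¹ κ M (K + 1) v w x t) (𝓝[>] 0)
      (𝓝 (penalizedDiff r (ε ^ 2)⁻¹ 0 M (K + 1) v w x t)) := by
    refine (Continuous.tendsto ?_ 0).mono_left nhdsWithin_le_nhds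
    unfold penalizedDiff
    fun_prop
  have hnonpos := le_of_tendsto hlim (eventually_nhdsWithin_of_forall hpen)
  rw [penalizedDiff, zero_mul, sub_zero] at hnonpos
  exact sub_nonpos.1 (nonpos_of_mul_nonpos_right hnonpos (Real.exp_pos _))

theorem IsSubsolution.le_isSupersolution (hD : Bornology.IsBounded D) (hr : IsDefiningFunction r D)
    (hv : IsSubsolution D r ε ξ τ v) (hw : IsSupersolution D r ε ξ τ w)
    (h0 : ∀ x ∈ D, v x 0 ≤ w x 0) {x : EuclideanSpace ℝ (Fin n)} {t : ℝ} (hx : x ∈ D)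
    (ht : t ∈ Icc 0 τ) : v x t ≤ w x t := by
  rcases ht.2.lt_or_eq with hlt | rfl
  · exact comparison_of_lt hD hr hv hw h0 hx ⟨ht.1, hlt⟩
  rcases ht.1.eq_or_lt with rfl | hpos
  · exact h0 x hx
  refine ContinuousWithinAt.closure_le (closure_Ico hpos.ne ▸ ht)
    ((hv.classical.continuousOn_time (subset_closure hx) t ht).mono Ico_subset_Icc_self)
    ((hw.classical.continuousOn_time (subset_closure hx) t ht).mono Ico_subset_Icc_self)
    fun s hs => comparison_of_lt hD hr hv hw h0 hx hs

end Comparison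

/-! ### The residual of the barriers -/

lemma fderiv_fderiv_comp {E : Type*} [NormedAddCommGroup E] [NormedSpace ℝ E] {φ : ℝ → ℝ}
    {h : E → ℝ} {x : E} (hφ : ContDiffAt ℝ 2 φ (h x)) (hh : ContDiffAt ℝ 2 h x) :
    fderiv ℝ (fderiv ℝ fun y => φ (h y)) x = deriv φ (h x) • fderiv ℝ (fderiv ℝ h) x
      + (deriv (deriv φ) (h x) • fderiv ℝ h x).smulRight (fderiv ℝ h x) := by
  have hfirst : fderiv ℝ (fun y => φ (h y)) =ᶠ[𝓝 x] fun y => deriv φ (h y) • fderiv ℝ h y := by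
    filter_upwards [hh.eventually (by simp),
      hh.continuousAt.eventually (hφ.eventually (by simp))] with y hy hφy
    exact ((hφy.differentiableAt two_ne_zero).hasDerivAt.comp_hasFDerivAt y
      (hy.differentiableAt two_ne_zero).hasFDerivAt).fderiv
  have hφ' : DifferentiableAt ℝ (deriv φ) (h x) :=
    ((hφ.fderiv_right one_add_one_eq_two.le).differentiableAt one_ne_zero).clm_apply
      (differentiableAt_const 1)
  have hh' : DifferentiableAt ℝ (fderiv ℝ h) x :=
    (hh.fderiv_right one_add_one_eq_two.le).differentiableAt one_ne_zero
  rw [hfirst.fderiv_eq]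
  exact ((hφ'.hasDerivAt.comp_hasFDerivAt x
    (hh.differentiableAt two_ne_zero).hasFDerivAt).smul hh'.hasFDerivAt).fderiv

lemma laplacian_comp {E : Type*} [NormedAddCommGroup E] [InnerProductSpace ℝ E]
    [FiniteDimensional ℝ E] {φ : ℝ → ℝ} {h : E → ℝ} {x : E} (hφ : ContDiffAt ℝ 2 φ (h x))
    (hh : ContDiffAt ℝ 2 h x) :
    (Δ fun y => φ (h y)) x
      = deriv (deriv φ) (h x) * ‖∇ h x‖ ^ 2 + deriv φ (h x) * (Δ h) x := by
  set e := stdOrthonormalBasis ℝ E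
  have hgrad : ‖∇ h x‖ ^ 2 = ∑ i, fderiv ℝ h x (e i) ^ 2 := by
    simp only [← e.sum_sq_inner_left, inner_gradient_left]
  rw [laplacian_eq_sum_fderiv e, laplacian_eq_sum_fderiv e, fderiv_fderiv_comp hφ hh, hgrad,
    Finset.mul_sum, Finset.mul_sum, ← Finset.sum_add_distrib]
  refine Finset.sum_congr rfl fun i _ => ?_
  simp only [_root_.add_apply, _root_.smul_apply, ContinuousLinearMap.smulRight_apply, smul_eq_mul]
  ring

lemma hasDerivAt_comp_prodMk {F : Type*} [NormedAddCommGroup F] [NormedSpace ℝ F] {G : ℝ × ℝ → F}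
    {p q : ℝ → ℝ} {p' q' t : ℝ} (hG : DifferentiableAt ℝ G (p t, q t)) (hp : HasDerivAt p p' t)
    (hq : HasDerivAt q q' t) :
    HasDerivAt (fun s => G (p s, q s))
      (p' • deriv (fun y => G (y, q t)) (p t) + q' • deriv (fun s => G (p t, s)) (q t)) t := by
  have hfst : deriv (fun y => G (y, q t)) (p t) = fderiv ℝ G (p t, q t) (1, 0) :=
    (hG.hasFDerivAt.comp_hasDerivAt (p t)
      ((hasDerivAt_id (p t)).prodMk (hasDerivAt_const (p t) (q t)))).deriv
  have hsnd : deriv (fun s => G (p t, s)) (q t) = fderiv ℝ G (p t, q t) (0, 1) :=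
    (hG.hasFDerivAt.comp_hasDerivAt (q t)
      ((hasDerivAt_const (q t) (p t)).prodMk (hasDerivAt_id (q t)))).deriv
  refine (hG.hasFDerivAt.comp_hasDerivAt t (hp.prodMk hq)).congr_deriv ?_
  rw [hfst, hsnd, ← map_smul, ← map_smul, ← map_add]
  simp

section Barrier

variable {n : ℕ} {δ₀ : ℝ} {mMinus mPlus : ℝ → ℝ} {m : ℝ → ℝ → ℝ} {c : ℝ → ℝ}
  {D : Set (EuclideanSpace ℝ (Fin n))} {r : EuclideanSpace ℝ (Fin n) → ℝ}
  {d : EuclideanSpace ℝ (Fin n) → ℝ → ℝ} {σ a c₁ β ε τ t : ℝ} {ξ : ℝ → ℝ}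
  {x : EuclideanSpace ℝ (Fin n)}

/-- The point `(d + σ ε^a e^{c₁ t}) / ε` at which the barrier evaluates the wave profile. -/
noncomputable def barrierPhase (σ a c₁ ε : ℝ) (d : EuclideanSpace ℝ (Fin n) → ℝ → ℝ)
    (x : EuclideanSpace ℝ (Fin n)) (t : ℝ) : ℝ :=
  (d x t + σ * (ε ^ a * Real.exp (c₁ * t))) / ε

/-- The parameter `ε ξ(t) + σ ε^β` of the wave profile in the barrier. -/
noncomputable def barrierParameter (σ β ε : ℝ) (ξ : ℝ → ℝ) (t : ℝ) : ℝ :=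
  ε * ξ t + σ * ε ^ β

lemma barrier_eq : barrier m σ a c₁ β ε ξ d x t =
    m (barrierPhase σ a c₁ ε d x t) (barrierParameter σ β ε ξ t) := rfl

lemma hasDerivAt_barrierPhase (hd : DifferentiableAt ℝ (fun s => d x s) t) :
    HasDerivAt (fun s => barrierPhase σ a c₁ ε d x s)
      (ε⁻¹ * (deriv (fun s => d x s) t + σ * (c₁ * (ε ^ a * Real.exp (c₁ * t))))) t := by
  have hexp := (((hasDerivAt_id t).const_mul c₁).exp.const_mul (ε ^ a)).const_mul σ
  refine ((hd.hasDerivAt.add hexp).div_const ε).congr_deriv ?_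
  simp only [id_eq]
  ring

lemma contDiffAt_barrierPhase {k : WithTop ℕ∞} (hd : ContDiffAt ℝ k (fun y => d y t) x) :
    ContDiffAt ℝ k (fun y => barrierPhase σ a c₁ ε d y t) x :=
  (hd.add contDiffAt_const).div_const ε

lemma laplacian_barrierPhase (hd : ContDiffAt ℝ 2 (fun y => d y t) x) :
    (Δ fun y => barrierPhase σ a c₁ ε d y t) x = ε⁻¹ * (Δ fun y => d y t) x := by
  have hsplit : (fun y => barrierPhase σ a c₁ ε d y t) =
      ε⁻¹ • ((fun y => d y t) + fun _ => σ * (ε ^ a * Real.exp (c₁ * t))) := by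
    ext y
    exact div_eq_inv_mul _ _
  have hadd : ContDiffAt ℝ 2
      ((fun y => d y t) + fun _ => σ * (ε ^ a * Real.exp (c₁ * t))) x := hd.add contDiffAt_const
  rw [hsplit, InnerProductSpace.laplacian_smul _ hadd,
    ContDiffAt.laplacian_add hd contDiffAt_const, InnerProductSpace.laplacian_const]
  simp

lemma gradient_barrierPhase (hd : DifferentiableAt ℝ (fun y => d y t) x) :
    ∇ (fun y => barrierPhase σ a c₁ ε d y t) x = ε⁻¹ • ∇ (fun y => d y t) x := by
  have hderiv : HasFDerivAt (fun y => barrierPhase σ a c₁ ε d y t)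
      (ε⁻¹ • fderiv ℝ (fun y => d y t) x) x := by
    simpa only [barrierPhase, div_eq_inv_mul] using (hd.hasFDerivAt.add_const _).const_mul ε⁻¹
  rw [gradient, hderiv.fderiv, map_smul, gradient]

lemma hasDerivAt_barrier (hm : IsTravellingWave δ₀ mMinus mPlus m c) {z δ : ℝ}
    (hz : barrierPhase σ a c₁ ε d x t = z) (hδ : barrierParameter σ β ε ξ t = δ)
    (hδ₀ : δ ∈ Ioo (-δ₀) δ₀) (hξ : DifferentiableAt ℝ ξ t)
    (hd : DifferentiableAt ℝ (fun s => d x s) t) :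
    HasDerivAt (fun s => barrier m σ a c₁ β ε ξ d x s)
      (ε⁻¹ * (deriv (fun s => d x s) t + σ * (c₁ * (ε ^ a * Real.exp (c₁ * t)))) *
        deriv (fun y => m y δ) z + ε * deriv ξ t * deriv (m z) δ) t := by
  subst hz hδ
  exact hasDerivAt_comp_prodMk (G := fun q => m q.1 q.2) (q := barrierParameter σ β ε ξ)
    ((hm.contDiffAt hδ₀ _).differentiableAt (by simp)) (hasDerivAt_barrierPhase hd)
    ((hξ.hasDerivAt.const_mul ε).add_const _)

lemma laplacian_barrier (hm : IsTravellingWave δ₀ mMinus mPlus m c) {z δ : ℝ}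
    (hz : barrierPhase σ a c₁ ε d x t = z) (hδ : barrierParameter σ β ε ξ t = δ)
    (hδ₀ : δ ∈ Ioo (-δ₀) δ₀) (hd : ContDiffAt ℝ 2 (fun y => d y t) x) :
    (Δ fun y => barrier m σ a c₁ β ε ξ d y t) x =
      deriv (deriv fun y => m y δ) z * ((ε ^ 2)⁻¹ * ‖∇ (fun y => d y t) x‖ ^ 2) +
        deriv (fun y => m y δ) z * (ε⁻¹ * (Δ fun y => d y t) x) := by
  subst hz hδ
  have hprofile := contDiff_infty.1 (hm.contDiff_profile hδ₀) 2
  simp only [barrier_eq]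
  rw [laplacian_comp (φ := fun y => m y (barrierParameter σ β ε ξ t)) hprofile.contDiffAt
      (contDiffAt_barrierPhase hd), laplacian_barrierPhase hd,
    gradient_barrierPhase (hd.differentiableAt two_ne_zero), norm_smul, mul_pow, Real.norm_eq_abs,
    sq_abs, inv_pow]

lemma residual_barrier (hm : IsTravellingWave δ₀ mMinus mPlus m c) (hε : ε ≠ 0) {z δ : ℝ}
    (hz : barrierPhase σ a c₁ ε d x t = z) (hδ : barrierParameter σ β ε ξ t = δ)
    (hδ₀ : δ ∈ Ioo (-δ₀) δ₀) (hξ : DifferentiableAt ℝ ξ t)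
    (hdt : DifferentiableAt ℝ (fun s => d x s) t) (hdx : ContDiffAt ℝ 2 (fun y => d y t) x) :
    residual ε ξ (barrier m σ a c₁ β ε ξ d) x t =
      σ * (ε ^ β * (ε ^ 2)⁻¹) + ε * deriv ξ t * deriv (m z) δ
      + deriv (fun y => m y δ) z * (ε⁻¹ * (deriv (fun s => d x s) t - (Δ fun y => d y t) x
        + forcing c σ β ε ξ t + σ * (c₁ * (ε ^ a * Real.exp (c₁ * t)))))
      + deriv (deriv fun y => m y δ) z * ((ε ^ 2)⁻¹ * (1 - ‖∇ (fun y => d y t) x‖ ^ 2)) := by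
  have hforcing : forcing c σ β ε ξ t = ε⁻¹ * c δ := hδ ▸ rfl
  have hwave : f (m z δ) =
      -(deriv (deriv fun y => m y δ) z) - c δ * deriv (fun y => m y δ) z - δ := by
    linarith [hm.ode δ (Ioo_subset_Icc_self hδ₀) z]
  have hnoise : ε⁻¹ * ξ t = (ε ^ 2)⁻¹ * (δ - σ * ε ^ β) := by
    rw [← hδ, barrierParameter]
    field_simp
    ring
  rw [residual, (hasDerivAt_barrier hm hz hδ hδ₀ hξ hdt).deriv, laplacian_barrier hm hz hδ hδ₀ hdx,
    barrier_eq, hz, hδ, hwave, hnoise, hforcing]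
  field_simp
  ring

lemma isClassical_barrier (hm : IsTravellingWave δ₀ mMinus mPlus m c) (hD : IsOpen D)
    (hd : IsClassical D τ d) (hξ : Differentiable ℝ ξ)
    (hδ : ∀ t ∈ Icc 0 τ, barrierParameter σ β ε ξ t ∈ Ioo (-δ₀) δ₀) :
    IsClassical D τ (barrier m σ a c₁ β ε ξ d) where
  cont := by
    have hphase : ContinuousOn (fun q : EuclideanSpace ℝ (Fin n) × ℝ =>
        barrierPhase σ a c₁ ε d q.1 q.2) (closure D ×ˢ Icc 0 τ) :=
      (hd.cont.add (by fun_prop)).div_const ε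
    have hparameter : Continuous (barrierParameter σ β ε ξ) :=
      (hξ.continuous.const_mul ε).add continuous_const
    exact hm.smooth.continuousOn.comp
      (hphase.prodMk (hparameter.comp continuous_snd).continuousOn)
      fun q hq => ⟨mem_univ _, Ioo_subset_Icc_self (hδ q.2 hq.2)⟩
  space t ht x hx := by
    have hprofile := contDiff_infty.1 (hm.contDiff_profile (hδ t (Ioo_subset_Icc_self ht))) 2
    exact (hprofile.contDiffAt.comp x (contDiffAt_barrierPhase
      ((hd.space t ht).contDiffAt (hD.mem_nhds hx)))).contDiffWithinAt
  time t ht x hx := (hasDerivAt_barrier hm rfl rfl (hδ t (Ioo_subset_Icc_self ht)) (hξ t)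
    (hd.time t ht x hx)).differentiableAt

lemma hasOuterNormalDeriv_zero_of_eventually_eq {v : EuclideanSpace ℝ (Fin n) → ℝ}
    (hr : IsDefiningFunction r D) (hx : x ∈ frontier D)
    (hv : ∀ᶠ y in 𝓝[closure D] x, v y = v x) : HasOuterNormalDeriv r v x 0 := by
  have hline : Tendsto (fun s : ℝ => x - s • outerNormal r x) (𝓝[>] 0) (𝓝[closure D] x) := by
    refine tendsto_nhdsWithin_iff.2 ⟨?_,
      (hr.eventually_sub_smul_outerNormal_mem hx).mono fun _ hs => subset_closure hs⟩
    have hcont : Continuous fun s : ℝ => x - s • outerNormal r x := by fun_prop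
    simpa only [zero_smul, sub_zero] using (hcont.tendsto 0).mono_left nhdsWithin_le_nhds
  rw [HasOuterNormalDeriv, neg_zero, ← hasDerivWithinAt_Ioi_iff_Ici]
  exact (hasDerivWithinAt_const (0 : ℝ) (Ioi 0) (v x)).congr_of_eventuallyEq
    (hline.eventually hv) (by rw [zero_smul, sub_zero])

lemma hasOuterNormalDeriv_barrier (hr : IsDefiningFunction r D) (hx : x ∈ frontier D)
    (hd : ∀ᶠ y in 𝓝[closure D] x, d y t = d x t) :
    HasOuterNormalDeriv r (fun y => barrier m σ a c₁ β ε ξ d y t) x 0 :=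
  hasOuterNormalDeriv_zero_of_eventually_eq hr hx
    (hd.mono fun y hy => by simp only [barrier, hy])

end Barrier

/-! ### The sign of the residual -/

section Sign

variable {n : ℕ} {δ₀ : ℝ} {mMinus mPlus : ℝ → ℝ} {m : ℝ → ℝ → ℝ} {c : ℝ → ℝ}
  {D O : Set (EuclideanSpace ℝ (Fin n))} {U : ℝ → Set (EuclideanSpace ℝ (Fin n))}
  {d : EuclideanSpace ℝ (Fin n) → ℝ → ℝ} {A l C L N R η σ a c₁ β ε τ t z δ : ℝ} {ξ : ℝ → ℝ}
  {x : EuclideanSpace ℝ (Fin n)}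

lemma mul_exp_neg_le (hl : 0 < l) (y : ℝ) : y * Real.exp (-l * y) ≤ 1 / l := by
  rw [neg_mul, Real.exp_neg, ← div_eq_mul_inv, div_le_div_iff₀ (Real.exp_pos _) hl, one_mul]
  linarith [Real.add_one_le_exp (l * y)]

lemma neg_abs_le_mul_of_abs_eq_one (hσ : |σ| = 1) (y : ℝ) : -|y| ≤ σ * y := by
  simpa only [abs_mul, hσ, one_mul] using neg_abs_le (σ * y)

lemma abs_le_mul_abs_barrierPhase_add (hσ : |σ| = 1) (hε : 0 < ε) :
    |d x t| ≤ ε * |barrierPhase σ a c₁ ε d x t| + ε ^ a * Real.exp (c₁ * t) := by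
  have hshift : 0 ≤ ε ^ a * Real.exp (c₁ * t) := by positivity
  have hd : d x t = ε * barrierPhase σ a c₁ ε d x t - σ * (ε ^ a * Real.exp (c₁ * t)) := by
    rw [barrierPhase]
    field_simp
    ring
  calc |d x t|
      ≤ |ε * barrierPhase σ a c₁ ε d x t| + |σ * (ε ^ a * Real.exp (c₁ * t))| :=
        hd ▸ abs_sub _ _
    _ = ε * |barrierPhase σ a c₁ ε d x t| + ε ^ a * Real.exp (c₁ * t) := by
        rw [abs_mul, abs_mul, hσ, abs_of_pos hε, abs_of_nonneg hshift, one_mul]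

lemma le_mul_residual_barrier (hm : IsTravellingWave δ₀ mMinus mPlus m c) (hσ : |σ| = 1)
    (hε : 0 < ε) (hz : barrierPhase σ a c₁ ε d x t = z) (hδ : barrierParameter σ β ε ξ t = δ)
    (hδ₀ : δ ∈ Ioo (-δ₀) δ₀) (hξ : DifferentiableAt ℝ ξ t) (hξC : |ε * deriv ξ t| ≤ C)
    (hdt : DifferentiableAt ℝ (fun s => d x s) t) (hdx : ContDiffAt ℝ 2 (fun y => d y t) x)
    (hwave : IsWaveBound m A l z δ) :
    ε ^ β * (ε ^ 2)⁻¹ - A * C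
      + deriv (fun y => m y δ) z * (ε⁻¹ * (σ * (deriv (fun s => d x s) t - (Δ fun y => d y t) x
        + forcing c σ β ε ξ t) + c₁ * (ε ^ a * Real.exp (c₁ * t))))
      - |deriv (deriv fun y => m y δ) z| * ((ε ^ 2)⁻¹ * |1 - ‖∇ (fun y => d y t) x‖ ^ 2|)
      ≤ σ * residual ε ξ (barrier m σ a c₁ β ε ξ d) x t := by
  have hσσ : σ * σ = 1 := by rw [← abs_mul_abs_self, hσ, one_mul]
  have hnoise : -(A * C) ≤ σ * (ε * deriv ξ t * deriv (m z) δ) := by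
    refine le_trans (neg_le_neg ?_) (neg_abs_le_mul_of_abs_eq_one hσ _)
    rw [abs_mul, mul_comm]
    exact mul_le_mul hwave.deriv_parameter_le hξC (abs_nonneg _)
      ((abs_nonneg _).trans hwave.deriv_parameter_le)
  have hgradient := neg_abs_le_mul_of_abs_eq_one hσ
    (deriv (deriv fun y => m y δ) z * ((ε ^ 2)⁻¹ * (1 - ‖∇ (fun y => d y t) x‖ ^ 2)))
  rw [abs_mul, abs_mul, abs_of_pos (show 0 < (ε ^ 2)⁻¹ by positivity)] at hgradient
  rw [residual_barrier hm hε.ne' hz hδ hδ₀ hξ hdt hdx]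
  linear_combination hnoise + hgradient - (ε ^ β * (ε ^ 2)⁻¹
    + deriv (fun y => m y δ) z * (ε⁻¹ * (c₁ * (ε ^ a * Real.exp (c₁ * t))))) * hσσ

lemma IsTravellingWave.deriv_nonneg (hm : IsTravellingWave δ₀ mMinus mPlus m c)
    (hδ₀ : δ ∈ Ioo (-δ₀) δ₀) (y : ℝ) : 0 ≤ deriv (fun y => m y δ) y :=
  (hm.increasing δ (Ioo_subset_Icc_self hδ₀)).monotone.deriv_nonneg

/-- The error `c₁ |d|` exceeds the gain `c₁ ε^a e^{c₁ t}` of the shift by at most `c₁ ε |z|`, and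
the wave profile absorbs the factor `|z|`. -/
lemma mul_residual_barrier_nonneg_of_norm_gradient_eq_one
    (hm : IsTravellingWave δ₀ mMinus mPlus m c) (hσ : |σ| = 1)
    (hε : 0 < ε) (hz : barrierPhase σ a c₁ ε d x t = z) (hδ : barrierParameter σ β ε ξ t = δ)
    (hδ₀ : δ ∈ Ioo (-δ₀) δ₀) (hξ : DifferentiableAt ℝ ξ t) (hξC : |ε * deriv ξ t| ≤ C)
    (hdt : DifferentiableAt ℝ (fun s => d x s) t) (hdx : ContDiffAt ℝ 2 (fun y => d y t) x)
    (hl : 0 < l) (hwave : IsWaveBound m A l z δ) (hc₁ : 0 ≤ c₁)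
    (hgradient : ‖∇ (fun y => d y t) x‖ = 1)
    (hheat : |deriv (fun s => d x s) t - (Δ fun y => d y t) x + forcing c σ β ε ξ t|
      ≤ c₁ * |d x t|)
    (hsmall : A * C + c₁ * (A / l) ≤ ε ^ β * (ε ^ 2)⁻¹) :
    0 ≤ σ * residual ε ξ (barrier m σ a c₁ β ε ξ d) x t := by
  have hprofile := hm.deriv_nonneg hδ₀ z
  have hle := le_mul_residual_barrier hm hσ hε hz hδ hδ₀ hξ hξC hdt hdx hwave
  rw [hgradient, one_pow, sub_self, abs_zero, mul_zero, mul_zero, sub_zero] at hle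
  have hexp : deriv (fun y => m y δ) z * |z| ≤ A / l := by
    have hA : 0 ≤ A := (abs_nonneg _).trans hwave.deriv_parameter_le
    calc deriv (fun y => m y δ) z * |z|
        ≤ A * Real.exp (-l * |z|) * |z| := by
          gcongr
          exact (le_abs_self _).trans hwave.deriv_le
      _ = A * (|z| * Real.exp (-l * |z|)) := by ring
      _ ≤ A * (1 / l) := by
          gcongr
          exact mul_exp_neg_le hl _
      _ = A / l := mul_one_div A l
  have hdist : c₁ * |d x t| ≤ c₁ * (ε * |z| + ε ^ a * Real.exp (c₁ * t)) := by
    rw [← hz]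
    gcongr
    exact abs_le_mul_abs_barrierPhase_add hσ hε
  have hbracket : -(c₁ * (ε * |z|)) ≤ σ * (deriv (fun s => d x s) t - (Δ fun y => d y t) x
      + forcing c σ β ε ξ t) + c₁ * (ε ^ a * Real.exp (c₁ * t)) := by
    linarith [neg_abs_le_mul_of_abs_eq_one hσ (deriv (fun s => d x s) t - (Δ fun y => d y t) x
      + forcing c σ β ε ξ t)]
  have hmain : -(c₁ * (A / l)) ≤ deriv (fun y => m y δ) z * (ε⁻¹ * -(c₁ * (ε * |z|))) := by
    have hcancel : deriv (fun y => m y δ) z * (ε⁻¹ * -(c₁ * (ε * |z|)))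
        = -(c₁ * (deriv (fun y => m y δ) z * |z|)) := by field_simp
    rw [hcancel]
    gcongr
  have hmono := mul_le_mul_of_nonneg_left
    (mul_le_mul_of_nonneg_left hbracket (inv_nonneg.2 hε.le)) hprofile
  linarith

lemma mul_residual_barrier_nonneg_of_le_abs_barrierPhase
    (hm : IsTravellingWave δ₀ mMinus mPlus m c) (hσ : |σ| = 1)
    (hε : 0 < ε) (hz : barrierPhase σ a c₁ ε d x t = z) (hδ : barrierParameter σ β ε ξ t = δ)
    (hδ₀ : δ ∈ Ioo (-δ₀) δ₀) (hξ : DifferentiableAt ℝ ξ t) (hξC : |ε * deriv ξ t| ≤ C)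
    (hdt : DifferentiableAt ℝ (fun s => d x s) t) (hdx : ContDiffAt ℝ 2 (fun y => d y t) x)
    (hl : 0 < l) (hwave : IsWaveBound m A l z δ) (hc₁ : 0 ≤ c₁)
    (hgradient : ‖∇ (fun y => d y t) x‖ ≤ 1)
    (hheat : |deriv (fun s => d x s) t - (Δ fun y => d y t) x + forcing c σ β ε ξ t| ≤ L)
    (hR : R ≤ |z|)
    (hsmall : A * C + A * Real.exp (-l * R) * (ε⁻¹ * L + (ε ^ 2)⁻¹) ≤ ε ^ β * (ε ^ 2)⁻¹) :
    0 ≤ σ * residual ε ξ (barrier m σ a c₁ β ε ξ d) x t := by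
  have hL : 0 ≤ L := (abs_nonneg _).trans hheat
  have hA : 0 ≤ A := (abs_nonneg _).trans hwave.deriv_parameter_le
  have hexp : A * Real.exp (-l * |z|) ≤ A * Real.exp (-l * R) := by
    gcongr A * Real.exp ?_
    rw [neg_mul, neg_mul]
    gcongr
  have hle := le_mul_residual_barrier hm hσ hε hz hδ hδ₀ hξ hξC hdt hdx hwave
  have hbracket : -L ≤ σ * (deriv (fun s => d x s) t - (Δ fun y => d y t) x
      + forcing c σ β ε ξ t) + c₁ * (ε ^ a * Real.exp (c₁ * t)) := by
    have hshift : 0 ≤ c₁ * (ε ^ a * Real.exp (c₁ * t)) := by positivity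
    linarith [neg_abs_le_mul_of_abs_eq_one hσ (deriv (fun s => d x s) t - (Δ fun y => d y t) x
      + forcing c σ β ε ξ t)]
  have hmain : deriv (fun y => m y δ) z * (ε⁻¹ * L) ≤ A * Real.exp (-l * R) * (ε⁻¹ * L) := by
    gcongr
    exact (le_abs_self _).trans (hwave.deriv_le.trans hexp)
  have hremainder : |deriv (deriv fun y => m y δ) z|
      * ((ε ^ 2)⁻¹ * |1 - ‖∇ (fun y => d y t) x‖ ^ 2|)
      ≤ A * Real.exp (-l * R) * ((ε ^ 2)⁻¹ * 1) := by
    gcongr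
    · exact hwave.deriv_deriv_le.trans hexp
    · have hsq := pow_le_one₀ (n := 2) (norm_nonneg _) hgradient
      exact abs_le.2 ⟨by linarith, by linarith [sq_nonneg ‖∇ (fun y => d y t) x‖]⟩
  have hmono := mul_le_mul_of_nonneg_left
    (mul_le_mul_of_nonneg_left hbracket (inv_nonneg.2 hε.le)) (hm.deriv_nonneg hδ₀ z)
  linarith

lemma abs_forcing_le (hε : 0 < ε) (hc : |c (barrierParameter σ β ε ξ t)| ≤ A) :
    |forcing c σ β ε ξ t| ≤ ε⁻¹ * A := by
  rw [forcing, abs_mul, abs_of_pos (inv_pos.2 hε)]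
  exact mul_le_mul_of_nonneg_left hc (inv_nonneg.2 hε.le)

namespace IsDistanceExtension

lemma mem_of_abs_lt (hext : IsDistanceExtension D O U η L τ d) (ht : t ∈ Icc 0 τ) (hx : x ∈ D)
    (hlt : |d x t| < η) : x ∈ O := by
  by_contra hxO
  by_cases hxU : x ∈ U t
  · linarith [hext.inside t ht x hx hxU hxO, (abs_lt.1 hlt).1]
  · linarith [hext.outside t ht x hx hxU hxO, (abs_lt.1 hlt).2]

lemma eventuallyEq_signedDist (hext : IsDistanceExtension D O U η L τ d) (hO : IsOpen O)
    (ht : t ∈ Icc 0 τ) (hx : x ∈ O) : (fun y => d y t) =ᶠ[𝓝 x] signedDist (U t) :=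
  mem_of_superset (hO.mem_nhds hx) (hext.eq_signedDist t ht)

lemma norm_gradient_eq_one [NeZero n] {g : ℝ → ℝ} (hext : IsDistanceExtension D O U η L τ d)
    (hflow : IsForcedCurvatureFlow D O U g N η τ) (hD : Bornology.IsBounded D) (hη : 0 < η)
    (ht : t ∈ Icc 0 τ) (hx : x ∈ O) : ‖∇ (fun y => d y t) x‖ = 1 := by
  rw [(hext.eventuallyEq_signedDist hflow.isOpen ht hx).gradient_eq]
  exact hflow.norm_gradient hD hη ht hx

lemma abs_deriv_sub_laplacian_le {g : ℝ → ℝ} (hext : IsDistanceExtension D O U η L τ d)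
    (hflow : IsForcedCurvatureFlow D O U g N η τ) (hn : 2 ≤ n) (hD : Bornology.IsBounded D)
    (hη : 0 < η) (hN : 0 ≤ N) (ht : t ∈ Ioo 0 τ) (hx : x ∈ O) (hle : N * |d x t| ≤ 1 / 2) :
    |deriv (fun s => d x s) t - (Δ fun y => d y t) x + g t| ≤ 2 * n * N ^ 2 * |d x t| := by
  have ht' : t ∈ Icc 0 τ := Ioo_subset_Icc_self ht
  have htime : (fun s => d x s) =ᶠ[𝓝 t] fun s => signedDist (U s) x :=
    mem_of_superset (Icc_mem_nhds ht.1 ht.2) fun s hs => hext.eq_signedDist s hs x hx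
  rw [hext.eq_signedDist t ht' x hx] at hle ⊢
  rw [htime.deriv_eq, (InnerProductSpace.laplacian_congr_nhds
    (hext.eventuallyEq_signedDist hflow.isOpen ht' hx)).eq_of_nhds]
  exact hflow.abs_deriv_sub_laplacian_le hn hD hη hN ht hx hle

lemma abs_deriv_sub_laplacian_add_le {g B : ℝ} (hext : IsDistanceExtension D O U η L τ d)
    (ht : t ∈ Ioo 0 τ) (hx : x ∈ D) (hg : |g| ≤ B) :
    |deriv (fun s => d x s) t - (Δ fun y => d y t) x + g| ≤ 2 * L + B := by
  linarith [abs_add_le (deriv (fun s => d x s) t - (Δ fun y => d y t) x) g,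
    abs_sub (deriv (fun s => d x s) t) ((Δ fun y => d y t) x), hext.time_le t ht x hx,
    hext.laplacian_le t ht x hx]

theorem mul_residual_barrier_nonneg (hext : IsDistanceExtension D O U η L τ d)
    (hflow : IsForcedCurvatureFlow D O U (forcing c σ β ε ξ) N η τ) (hn : 2 ≤ n)
    (hD : Bornology.IsBounded D) (hDo : IsOpen D) (hη : 0 < η) (hN : 0 ≤ N)
    (hm : IsTravellingWave δ₀ mMinus mPlus m c) (hσ : |σ| = 1) (hε : 0 < ε)
    (hδ : barrierParameter σ β ε ξ t = δ) (hδ₀ : δ ∈ Ioo (-δ₀) δ₀) (hξ : DifferentiableAt ℝ ξ t)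
    (hξC : |ε * deriv ξ t| ≤ C) (hl : 0 < l) (hc : |c δ| ≤ A)
    (hwave : ∀ z, IsWaveBound m A l z δ) (hc₁ : 2 * n * N ^ 2 ≤ c₁) (hRη : 2 * R ≤ η)
    (hRN : N * (2 * R) ≤ 1 / 2) (ht : t ∈ Ioo 0 τ) (hx : x ∈ D)
    (hshift : ε ^ a * Real.exp (c₁ * t) ≤ R)
    (hnear : A * C + c₁ * (A / l) ≤ ε ^ β * (ε ^ 2)⁻¹)
    (hfar : A * C + A * Real.exp (-l * (R / ε)) * (ε⁻¹ * (2 * L + ε⁻¹ * A) + (ε ^ 2)⁻¹)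
      ≤ ε ^ β * (ε ^ 2)⁻¹) :
    0 ≤ σ * residual ε ξ (barrier m σ a c₁ β ε ξ d) x t := by
  have ht' : t ∈ Icc 0 τ := Ioo_subset_Icc_self ht
  have hc₁' : 0 ≤ c₁ := hc₁.trans' (by positivity)
  have hdt := hext.classical.time t ht x hx
  have hdx : ContDiffAt ℝ 2 (fun y => d y t) x :=
    (hext.classical.space t ht).contDiffAt (hDo.mem_nhds hx)
  rcases lt_or_ge |d x t| (2 * R) with hlt | hge
  · have : NeZero n := ⟨by lia⟩
    have hxO := hext.mem_of_abs_lt ht' hx (hlt.trans_le hRη)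
    have hheat := hext.abs_deriv_sub_laplacian_le hflow hn hD hη hN ht hxO
      ((mul_le_mul_of_nonneg_left hlt.le hN).trans hRN)
    exact mul_residual_barrier_nonneg_of_norm_gradient_eq_one hm hσ hε rfl hδ hδ₀ hξ hξC hdt hdx
      hl (hwave _) hc₁' (hext.norm_gradient_eq_one hflow hD hη ht' hxO)
      (hheat.trans (mul_le_mul_of_nonneg_right hc₁ (abs_nonneg _))) hnear
  · have hz : R / ε ≤ |barrierPhase σ a c₁ ε d x t| := by
      rw [div_le_iff₀' hε]
      linarith [abs_le_mul_abs_barrierPhase_add (a := a) (c₁ := c₁) (d := d) (x := x) (t := t)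
        hσ hε]
    exact mul_residual_barrier_nonneg_of_le_abs_barrierPhase hm hσ hε rfl hδ hδ₀ hξ hξC hdt hdx
      hl (hwave _) hc₁' (hext.gradient_le t ht x hx)
      (hext.abs_deriv_sub_laplacian_add_le ht hx (abs_forcing_le hε (hδ ▸ hc))) hz hfar

end IsDistanceExtension

end Sign

/-! ### The barriers for small `ε` -/

lemma tendsto_rpow_mul_inv_sq_atTop {β : ℝ} (hβ : β < 2) :
    Tendsto (fun ε : ℝ => ε ^ β * (ε ^ 2)⁻¹) (𝓝[>] 0) atTop := by
  refine ((tendsto_rpow_atTop (sub_pos.2 hβ)).comp tendsto_inv_nhdsGT_zero).congr' ?_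
  filter_upwards [self_mem_nhdsWithin] with ε (hε : 0 < ε)
  rw [Function.comp_apply, Real.inv_rpow hε.le, ← Real.rpow_neg hε.le, neg_sub,
    Real.rpow_sub hε, Real.rpow_two, div_eq_mul_inv]

lemma tendsto_inv_pow_mul_exp_neg_mul_div {l R : ℝ} (hl : 0 < l) (hR : 0 < R) (k : ℕ) :
    Tendsto (fun ε : ℝ => ε⁻¹ ^ k * Real.exp (-l * (R / ε))) (𝓝[>] 0) (𝓝 0) := by
  refine ((tendsto_rpow_mul_exp_neg_mul_atTop_nhds_zero k (l * R) (by positivity)).comp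
    tendsto_inv_nhdsGT_zero).congr fun ε => ?_
  rw [Function.comp_apply, Real.rpow_natCast, div_eq_mul_inv, neg_mul, neg_mul, mul_assoc]

lemma eventually_add_exp_neg_mul_le {β l R : ℝ} (hβ : β < 2) (hl : 0 < l) (hR : 0 < R)
    (A C K : ℝ) (p : ℕ) : ∀ᶠ ε : ℝ in 𝓝[>] 0,
      A * C + A * Real.exp (-l * (R / ε)) *
        (ε⁻¹ * (2 * (K * (ε ^ p)⁻¹) + ε⁻¹ * A) + (ε ^ 2)⁻¹) ≤ ε ^ β * (ε ^ 2)⁻¹ := by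
  have hlim : Tendsto (fun ε : ℝ => A * C + A * Real.exp (-l * (R / ε)) *
      (ε⁻¹ * (2 * (K * (ε ^ p)⁻¹) + ε⁻¹ * A) + (ε ^ 2)⁻¹)) (𝓝[>] 0) (𝓝 (A * C)) := by
    have hsum := (((tendsto_inv_pow_mul_exp_neg_mul_div hl hR (p + 1)).const_mul (A * (2 * K))).add
      ((tendsto_inv_pow_mul_exp_neg_mul_div hl hR 2).const_mul (A * (A + 1)))).const_add (A * C)
    rw [mul_zero, mul_zero, add_zero, add_zero] at hsum
    refine hsum.congr fun ε => ?_
    rw [pow_succ, inv_pow, inv_pow]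
    ring
  filter_upwards [hlim.eventually (ge_mem_nhds (lt_add_one (A * C))),
    (tendsto_rpow_mul_inv_sq_atTop hβ).eventually_ge_atTop (A * C + 1)] with ε hle hge
  exact hle.trans hge

lemma IsSlowForcing.eventually_barrierParameter_mem {ξ : ℝ → ℝ → ℝ} (hξ : IsSlowForcing ξ) {β : ℝ}
    (hβ : 0 < β) {s : Set ℝ} (hs : s ∈ 𝓝 0) (T : ℝ) : ∀ᶠ ε in 𝓝[>] 0, ∀ σ : ℝ, |σ| = 1 →
      ∀ t ∈ Icc 0 T, barrierParameter σ β ε (ξ ε) t ∈ s := by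
  obtain ⟨b, hb, hbs⟩ := Metric.mem_nhds_iff.1 hs
  filter_upwards [self_mem_nhdsWithin,
    Metric.tendstoUniformlyOn_iff.1 (hξ.tendsto T) (b / 2) (half_pos hb),
    (tendsto_rpow_nhdsGT_zero hβ).eventually (gt_mem_nhds (half_pos hb))]
    with ε (hε : 0 < ε) hnoise hpow σ hσ t ht
  have hnoise_t := hnoise t ht
  rw [Pi.zero_apply, dist_zero_left, Real.norm_eq_abs] at hnoise_t
  refine hbs (mem_ball_zero_iff.2 ?_)
  calc ‖barrierParameter σ β ε (ξ ε) t‖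
      ≤ |ε * ξ ε t| + |σ * ε ^ β| := abs_add_le _ _
    _ = |ε * ξ ε t| + ε ^ β := by
        rw [abs_mul σ, hσ, one_mul, abs_of_pos (Real.rpow_pos_of_pos hε β)]
    _ < b := by linarith

lemma exists_pos_two_mul_le {η N : ℝ} (hη : 0 < η) (hN : 0 ≤ N) :
    ∃ R, 0 < R ∧ 2 * R ≤ η ∧ N * (2 * R) ≤ 1 / 2 := by
  refine ⟨min η (1 / (2 * N + 1)) / 2, by positivity, ?_, ?_⟩
  · rw [mul_div_cancel₀ _ two_ne_zero]
    exact min_le_left _ _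
  · calc N * (2 * (min η (1 / (2 * N + 1)) / 2)) ≤ N * (1 / (2 * N + 1)) := by
          rw [mul_div_cancel₀ _ two_ne_zero]
          gcongr
          exact min_le_right _ _
      _ ≤ 1 / 2 := by
          rw [mul_one_div, div_le_div_iff₀ (by positivity) two_pos]
          linarith

section Main

variable {n : ℕ} {D : Set (EuclideanSpace ℝ (Fin n))} {r : EuclideanSpace ℝ (Fin n) → ℝ}
  {ξ : ℝ → ℝ → ℝ} {δ₀ : ℝ} {mMinus mPlus : ℝ → ℝ} {m : ℝ → ℝ → ℝ} {c : ℝ → ℝ}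
  {β N a c₁ η : ℝ}

theorem eventually_isClassical_barrier_and_residual_nonneg (hn : 2 ≤ n)
    (hD : Bornology.IsBounded D) (hDo : IsOpen D) (hξ : IsSlowForcing ξ)
    (hm : IsTravellingWave δ₀ mMinus mPlus m c) (hβ : 0 < β) (hβ' : β < 2) (hN : 0 ≤ N)
    (ha : 0 < a) (hc₁ : 2 * n * N ^ 2 ≤ c₁) (hη : 0 < η) (K T : ℝ) (p : ℕ) :
    ∀ᶠ ε in 𝓝[>] 0, ∀ σ τ : ℝ, |σ| = 1 → τ ≤ T → ∀ (O : Set (EuclideanSpace ℝ (Fin n)))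
      (U : ℝ → Set (EuclideanSpace ℝ (Fin n))) (d : EuclideanSpace ℝ (Fin n) → ℝ → ℝ),
      IsForcedCurvatureFlow D O U (forcing c σ β ε (ξ ε)) N η τ →
      IsDistanceExtension D O U η (K * (ε ^ p)⁻¹) τ d →
      IsClassical D τ (barrier m σ a c₁ β ε (ξ ε) d) ∧
      ∀ t ∈ Ioo 0 τ, ∀ x ∈ D, 0 ≤ σ * residual ε (ξ ε) (barrier m σ a c₁ β ε (ξ ε) d) x t := by
  have hc₁₀ : 0 ≤ c₁ := hc₁.trans' (by positivity)
  obtain ⟨A, l, hl, hwave⟩ := hm.exists_isWaveBound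
  obtain ⟨C, hC⟩ := hξ.deriv_bounded T
  obtain ⟨R, hR, hRη, hRN⟩ := exists_pos_two_mul_le hη hN
  have hshift : Tendsto (fun ε : ℝ => ε ^ a * Real.exp (c₁ * T)) (𝓝[>] 0) (𝓝 0) := by
    simpa only [zero_mul] using (tendsto_rpow_nhdsGT_zero ha).mul_const (Real.exp (c₁ * T))
  filter_upwards [self_mem_nhdsWithin, hξ.differentiable, hC,
    hξ.eventually_barrierParameter_mem hβ
      (inter_mem hwave (Ioo_mem_nhds hm.zero_mem.1 hm.zero_mem.2)) T,
    hshift.eventually (ge_mem_nhds hR),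
    (tendsto_rpow_mul_inv_sq_atTop hβ').eventually_ge_atTop (A * C + c₁ * (A / l)),
    eventually_add_exp_neg_mul_le hβ' hl hR A C K p]
    with ε (hε : 0 < ε) hdiff hderiv hparameter hshiftε hnear hfar σ τ hσ hτ O U d hflow hext
  refine ⟨isClassical_barrier hm hDo hext.classical hdiff
    fun t ht => (hparameter σ hσ t ⟨ht.1, ht.2.trans hτ⟩).2, fun t ht x hx => ?_⟩
  have htT : t ∈ Icc 0 T := ⟨ht.1.le, ht.2.le.trans hτ⟩
  obtain ⟨⟨hc, hbound⟩, hδ₀⟩ := hparameter σ hσ t htT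
  refine hext.mul_residual_barrier_nonneg hflow hn hD hDo hη hN hm hσ hε rfl hδ₀ (hdiff t)
    (hderiv t htT) hl hc hbound hc₁ hRη hRN ht hx (hshiftε.trans' ?_) hnear hfar
  gcongr
  exact htT.2

theorem eventually_isSubsolution_barrier_and_isSupersolution_barrier (hn : 2 ≤ n)
    (hD : Bornology.IsBounded D) (hr : IsDefiningFunction r D) (hξ : IsSlowForcing ξ)
    (hm : IsTravellingWave δ₀ mMinus mPlus m c) (hβ : 0 < β) (hβ' : β < 2) (hN : 0 ≤ N)
    (ha : 0 < a) (hc₁ : 2 * n * N ^ 2 ≤ c₁) (hη : 0 < η) (K T : ℝ) (p : ℕ) :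
    ∀ᶠ ε in 𝓝[>] 0, ∀ τ ≤ T, ∀ (O : Set (EuclideanSpace ℝ (Fin n)))
      (U : ℝ → Set (EuclideanSpace ℝ (Fin n))) (d : EuclideanSpace ℝ (Fin n) → ℝ → ℝ),
      IsDistanceExtension D O U η (K * (ε ^ p)⁻¹) τ d →
      (IsForcedCurvatureFlow D O U (forcing c (-1) β ε (ξ ε)) N η τ →
        IsSubsolution D r ε (ξ ε) τ (barrier m (-1) a c₁ β ε (ξ ε) d)) ∧
      (IsForcedCurvatureFlow D O U (forcing c 1 β ε (ξ ε)) N η τ →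
        IsSupersolution D r ε (ξ ε) τ (barrier m 1 a c₁ β ε (ξ ε) d)) := by
  filter_upwards [eventually_isClassical_barrier_and_residual_nonneg hn hD hr.isOpen hξ hm hβ hβ'
    hN ha hc₁ hη K T p] with ε hbarrier τ hτ O U d hext
  have hneumann : ∀ σ : ℝ, ∀ t ∈ Ioo 0 τ, ∀ x ∈ frontier D,
      HasOuterNormalDeriv r (fun y => barrier m σ a c₁ β ε (ξ ε) d y t) x 0 :=
    fun σ t ht x hx => hasOuterNormalDeriv_barrier hr hx
      (hext.const_near t (Ioo_subset_Icc_self ht) x hx)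
  refine ⟨fun hflow => ?_, fun hflow => ?_⟩
  · obtain ⟨hclassical, hresidual⟩ :=
      hbarrier (-1) τ (by rw [abs_neg, abs_one]) hτ O U d hflow hext
    exact ⟨hclassical, fun t ht x hx => by linarith [hresidual t ht x hx],
      fun t ht x hx => ⟨0, hneumann (-1) t ht x hx, le_rfl⟩⟩
  · obtain ⟨hclassical, hresidual⟩ := hbarrier 1 τ abs_one hτ O U d hflow hext
    exact ⟨hclassical, fun t ht x hx => by linarith [hresidual t ht x hx],
      fun t ht x hx => ⟨0, hneumann 1 t ht x hx, le_rfl⟩⟩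

end Main

end AllenCahn

theorem mainTheorem2_general {n : ℕ} (hn : 2 ≤ n)
    {D : Set (EuclideanSpace ℝ (Fin n))} {r : EuclideanSpace ℝ (Fin n) → ℝ}
    (hD : Bornology.IsBounded D) (hr : AllenCahn.IsDefiningFunction r D)
    {Ξ : ℝ → ℝ → ℝ} (hΞ : AllenCahn.IsSlowForcing Ξ)
    {δ₀ : ℝ} {mMinus mPlus : ℝ → ℝ} {m : ℝ → ℝ → ℝ} {c : ℝ → ℝ}
    (hm : AllenCahn.IsTravellingWave δ₀ mMinus mPlus m c)
    {β : ℝ} (hβ : 0 < β) (hβ' : β < 2) {N : ℝ} (hN : 0 ≤ N) {a : ℝ} (ha : 0 < a) {c₁ : ℝ}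
    (hc₁ : 2 * n * N ^ 2 ≤ c₁) {η : ℝ} (hη : 0 < η) (K T : ℝ) (p : ℕ) :
    ∃ ε₀ : ℝ, 0 < ε₀ ∧ ∀ ε ∈ Ioc 0 ε₀, ∀ ξ : ℝ → ℝ, ξ = Ξ ε →
      ∀ (τm τp : ℝ) (Om Op : Set (EuclideanSpace ℝ (Fin n)))
        (Um Up : ℝ → Set (EuclideanSpace ℝ (Fin n)))
        (dm dp : EuclideanSpace ℝ (Fin n) → ℝ → ℝ),
        τm ∈ Icc 0 T → τp ∈ Icc 0 T →
        AllenCahn.IsForcedCurvatureFlow D Om Um (AllenCahn.forcing c (-1) β ε ξ) N η τm →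
        AllenCahn.IsForcedCurvatureFlow D Op Up (AllenCahn.forcing c 1 β ε ξ) N η τp →
        AllenCahn.IsDistanceExtension D Om Um η (K * (ε ^ p)⁻¹) τm dm →
        AllenCahn.IsDistanceExtension D Op Up η (K * (ε ^ p)⁻¹) τp dp →
        ∀ um up : EuclideanSpace ℝ (Fin n) → ℝ → ℝ,
        um = AllenCahn.barrier m (-1) a c₁ β ε ξ dm →
        up = AllenCahn.barrier m 1 a c₁ β ε ξ dp →
        AllenCahn.IsSubsolution D r ε ξ τm um ∧
        AllenCahn.IsSupersolution D r ε ξ τp up ∧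
        ∀ (τ : ℝ) (u : EuclideanSpace ℝ (Fin n) → ℝ → ℝ),
          AllenCahn.IsSolution D r ε ξ τ u →
          (∀ x ∈ D, um x 0 ≤ u x 0 ∧ u x 0 ≤ up x 0) →
          ∀ x ∈ D, ∀ t ∈ Icc 0 τ,
            (t ≤ τm → um x t ≤ u x t) ∧ (t ≤ τp → u x t ≤ up x t) := by
  obtain ⟨ε₀, hε₀, hbarrier⟩ := mem_nhdsGT_iff_exists_Ioc_subset.1
    (AllenCahn.eventually_isSubsolution_barrier_and_isSupersolution_barrier hn hD hr hΞ hm hβ hβ'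
      hN ha hc₁ hη K T p)
  refine ⟨ε₀, hε₀, ?_⟩
  rintro ε hε _ rfl τm τp Om Op Um Up dm dp hτm hτp hfm hfp hem hep _ _ rfl rfl
  have hsub := (hbarrier hε τm hτm.2 Om Um dm hem).1 hfm
  have hsup := (hbarrier hε τp hτp.2 Op Up dp hep).2 hfp
  refine ⟨hsub, hsup, fun τ u hu h0 x hx t ht => ⟨fun htm => ?_, fun htp => ?_⟩⟩
  · exact AllenCahn.IsSubsolution.le_isSupersolution hD hr (hsub.mono htm)
      (hu.isSupersolution.mono ht.2) (fun y hy => (h0 y hy).1) hx ⟨ht.1, le_rfl⟩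
  · exact AllenCahn.IsSubsolution.le_isSupersolution hD hr (hu.isSubsolution.mono ht.2)
      (hsup.mono htp) (fun y hy => (h0 y hy).2) hx ⟨ht.1, le_rfl⟩

theorem mainTheorem2 {n : ℕ} (hn : 2 ≤ n)
    (D : Set (EuclideanSpace ℝ (Fin n))) (r : EuclideanSpace ℝ (Fin n) → ℝ)
    (hD : Bornology.IsBounded D) (hr : AllenCahn.IsDefiningFunction r D)
    {Ω : Type*} [MeasurableSpace Ω] (P : Measure Ω) [IsProbabilityMeasure P]
    (B B' : ℝ≥0 → Ω → ℝ) (hB : IsBrownianReal B P) (hB' : IsBrownianReal B' P)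
    (hBB' : IndepFun (fun ω t => B t ω) (fun ω t => B' t ω) P)
    (ρ : ℝ → ℝ) (hρ : AllenCahn.IsMollifier ρ)
    (γ : ℝ) (hγ : 0 < γ) (hγ' : γ < 2 / 3)
    (δ₀ : ℝ) (mMinus mPlus : ℝ → ℝ) (m : ℝ → ℝ → ℝ) (c : ℝ → ℝ)
    (hm : AllenCahn.IsTravellingWave δ₀ mMinus mPlus m c)
    (β : ℝ) (hβ : 1 < β) (hβ' : β < 2) (N : ℝ) (hN : 0 < N) :
    ∃ a : ℝ, 0 < a ∧ ∃ c₁ : ℝ, 0 < c₁ ∧ ∀ᵐ ω ∂P,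
      ∀ (η K T : ℝ) (p : ℕ), 0 < η → 0 < K → 0 < T → ∃ ε₀ : ℝ, 0 < ε₀ ∧ ∀ ε ∈ Ioc 0 ε₀,
        ∀ ξ : ℝ → ℝ, ξ = AllenCahn.noise ρ γ (fun t => AllenCahn.twoSided B B' t ω) ε →
        ∀ (τm τp : ℝ) (Om Op : Set (EuclideanSpace ℝ (Fin n)))
          (Um Up : ℝ → Set (EuclideanSpace ℝ (Fin n)))
          (dm dp : EuclideanSpace ℝ (Fin n) → ℝ → ℝ),
          τm ∈ Icc 0 T → τp ∈ Icc 0 T →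
          AllenCahn.IsForcedCurvatureFlow D Om Um (AllenCahn.forcing c (-1) β ε ξ) N η τm →
          AllenCahn.IsForcedCurvatureFlow D Op Up (AllenCahn.forcing c 1 β ε ξ) N η τp →
          AllenCahn.IsDistanceExtension D Om Um η (K * (ε ^ p)⁻¹) τm dm →
          AllenCahn.IsDistanceExtension D Op Up η (K * (ε ^ p)⁻¹) τp dp →
          ∀ um up : EuclideanSpace ℝ (Fin n) → ℝ → ℝ,
          um = AllenCahn.barrier m (-1) a c₁ β ε ξ dm →
          up = AllenCahn.barrier m 1 a c₁ β ε ξ dp →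
          AllenCahn.IsSubsolution D r ε ξ τm um ∧
          AllenCahn.IsSupersolution D r ε ξ τp up ∧
          ∀ (τ : ℝ) (u : EuclideanSpace ℝ (Fin n) → ℝ → ℝ),
            AllenCahn.IsSolution D r ε ξ τ u →
            (∀ x ∈ D, um x 0 ≤ u x 0 ∧ u x 0 ≤ up x 0) →
            ∀ x ∈ D, ∀ t ∈ Icc 0 τ,
              (t ≤ τm → um x t ≤ u x t) ∧ (t ≤ τp → u x t ≤ up x t) := by
  exact ⟨1, one_pos, 2 * n * N ^ 2, by positivity,
    (AllenCahn.ae_isSlowForcing_noise hB hB' hρ hγ hγ').mono fun ω hω η K T p hη _ _ =>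
      mainTheorem2_general hn hD hr hω hm (zero_lt_one.trans hβ) hβ' hN.le one_pos le_rfl hη K T p⟩
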